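/- Let $(K,v)$ be any valued field with value group $vK$ and residue field $Kv$ (valuations are written additively, and $v$ may be trivial). Let $\Gamma_0$ be an ordered abelian group extension of $vK$ such that $\Gamma_0/vK$ is a torsion group, and let $k_0$ be an algebraic field extension of $Kv$. Let $K(x)$ be the rational function field in one variable over $K$. For an extension of $v$ to $K(x)$, to say that its value group is $\Gamma$ and its residue field is $k$ means: up to an isomorphism of ordered groups that is the identity on $vK$, respectively an isomorphism of fields that is the identity on $Kv$. 1. Assume that $\Gamma_0/vK$ and $k_0|Kv$ are finite. (a) Let $\Gamma$ be the abelian group $\Gamma_0\oplus\mathbb{Z}$ endowed with any group ordering extending the ordering of $\Gamma_0$. If $v$ is trivial on $K$, assume in addition that $k_0|Kv$ is a simple extension. Then there is an extension of $v$ from $K$ to $K(x)$ which has value group $\Gamma$ and residue field $k_0$. (b) If $v$ is non-trivial on $K$, then there is also an extension of $v$ from $K$ to $K(x)$ which has value group $\Gamma_0$ and whose residue field is a rational function field in one variable over $k_0$. 2. Assume that $v$ is non-trivial on $K$ and that $\Gamma_0/vK$ (as a group) and $k_0|Kv$ (as a field extension) are countably generated. Suppose that at least one of $\Gamma_0/vK$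 and $k_0|Kv$ is infinite, or that $(K,v)$ admits an immediate transcendental extension, that is, a transcendental extension of valued fields with the same value group and the same residue field. Then there is an extension of $v$ from $K$ to $K(x)$ which has value group $\Gamma_0$ and residue field $k_0$. -/

import Mathlib

universe uK uL uG uH uk uM

namespace PrescribedValuation

section Valued

variable {K : Type uK} [Field K] {G : Type uG} [AddCommGroup G] [LinearOrder G]
  [IsOrderedAddMonoid G]

/-- The valuation ring of a valuation `v : K → G ∪ {∞}`, written additively:
the set of all `a` with `0 ≤ v a` (see `mem_valRing`). -/
abbrev valRing (v : AddValuation K (WithTop G)) : ValuationSubring K :=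
  (AddValuation.toValuation v).valuationSubring

theorem mem_valRing (v : AddValuation K (WithTop G)) (a : K) : a ∈ valRing v ↔ 0 ≤ v a :=
  Iff.rfl

/-- The residue field `Kv`. -/
abbrev Residue (v : AddValuation K (WithTop G)) : Type uK :=
  IsLocalRing.ResidueField (valRing v)

/-- `v` is trivial on `K`: every nonzero element has value `0`. -/
def IsTrivialVal (v : AddValuation K (WithTop G)) : Prop :=
  ∀ a : K, a ≠ 0 → v a = 0

variable {L : Type uL} [Field L] [Algebra K L] {H : Type uH} [AddCommGroup H] [LinearOrder H]
  [IsOrderedAddMonoid H]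

/-- `(L, w)` is an extension of the valued field `(K, v)`, where `G` is regarded as an ordered
subgroup of `H` through the order-preserving embedding `ι`: the restriction of `w` to `K` is `v`. -/
structure Extends (ι : G →+ H) (v : AddValuation K (WithTop G))
    (w : AddValuation L (WithTop H)) : Prop where
  strictMono : StrictMono ι
  restrict : ∀ a : K, w (algebraMap K L a) = (v a).map ι

namespace Extends

variable {ι : G →+ H} {v : AddValuation K (WithTop G)} {w : AddValuation L (WithTop H)}

theorem nonneg_iff (h : Extends ι v w) (a : K) : 0 ≤ w (algebraMap K L a) ↔ 0 ≤ v a := by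
  rw [h.restrict]
  cases v a with
  | top => simp
  | coe g =>
    rw [WithTop.map_coe, ← WithTop.coe_zero, ← WithTop.coe_zero, WithTop.coe_le_coe,
      WithTop.coe_le_coe, ← map_zero ι, h.strictMono.le_iff_le]

/-- The inclusion of valuation rings induced by an extension of valued fields. -/
def ringMap (h : Extends ι v w) : valRing v →+* valRing w :=
  ((algebraMap K L).comp (valRing v).subtype).codRestrict (valRing w)
    fun a => (h.nonneg_iff (a : K)).2 a.2

@[simp]
theorem coe_ringMap (h : Extends ι v w) (a : valRing v) :
    (h.ringMap a : L) = algebraMap K L (a : K) :=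
  rfl

theorem isLocalHom_ringMap (h : Extends ι v w) : IsLocalHom h.ringMap := by
  refine ⟨fun a ha => ?_⟩
  obtain ⟨b, hb⟩ := isUnit_iff_exists_inv.1 ha
  have hb' : algebraMap K L (a : K) * (b : L) = 1 := congrArg Subtype.val hb
  have hinv : algebraMap K L ((a : K)⁻¹) = (b : L) := by
    rw [map_inv₀]
    exact inv_eq_of_mul_eq_one_right hb'
  have ha0 : (a : K) ≠ 0 := by
    intro h0
    rw [h0, map_zero, zero_mul] at hb'
    exact zero_ne_one hb'
  have hmem : ((a : K)⁻¹) ∈ valRing v := by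
    refine (mem_valRing v _).2 ((h.nonneg_iff _).1 ?_)
    rw [hinv]
    exact b.2
  exact isUnit_iff_exists_inv.2 ⟨⟨_, hmem⟩, Subtype.ext (mul_inv_cancel₀ ha0)⟩

/-- The canonical embedding `Kv → Lw` of residue fields, sending the residue class of `a` to the
residue class of `a` in `L`. -/
noncomputable def residueMap (h : Extends ι v w) : Residue v →+* Residue w :=
  haveI := h.isLocalHom_ringMap
  IsLocalRing.ResidueField.map h.ringMap

theorem residueMap_residue (h : Extends ι v w) (a : valRing v) :
    h.residueMap (IsLocalRing.residue _ a) = IsLocalRing.residue _ (h.ringMap a) :=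
  rfl

end Extends

/-- The valuation `v` of `K` has an extension `w` to `L` with value group `H` (an extension of the
ordered group `G` through `ι`) and with residue field `k` (up to an isomorphism which is the
identity on `Kv`). -/
def HasExtension (v : AddValuation K (WithTop G)) (L : Type uL) [Field L] [Algebra K L]
    (ι : G →+ H) (k : Type uk) [Field k] [Algebra (Residue v) k] : Prop :=
  ∃ (w : AddValuation L (WithTop H)) (h : Extends ι v w),
    Function.Surjective w ∧
      ∃ φ : k ≃+* Residue w, ∀ z : Residue v, φ (algebraMap (Residue v) k z) = h.residueMap z

end Valued

/-- The valued field `(K, v)` with value group `G` admits an immediate transcendental extension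
`(L, w)`: the canonical embeddings of value groups and of residue fields are surjective. -/
def AdmitsImmediateTranscendental {K : Type uK} [Field K] {G : Type uG} [AddCommGroup G]
    [LinearOrder G] [IsOrderedAddMonoid G] (v : AddValuation K (WithTop G)) : Prop :=
  ∃ (L : Type uM) (_ : Field L) (_ : Algebra K L)
    (H : Type uG) (_ : AddCommGroup H) (_ : LinearOrder H) (_ : IsOrderedAddMonoid H)
    (ι : G →+ H) (w : AddValuation L (WithTop H)) (h : Extends ι v w),
    Algebra.Transcendental K L ∧ Function.Surjective w ∧
      Function.Surjective ι ∧ Function.Surjective h.residueMap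

/-- The abelian group `A` is generated by a countable subset. -/
def GroupCountablyGenerated (A : Type uG) [AddCommGroup A] : Prop :=
  ∃ S : Set A, S.Countable ∧ AddSubgroup.closure S = ⊤

/-- The field extension `E | F` is generated by a countable subset. -/
def FieldCountablyGenerated (F : Type uK) (E : Type uL) [Field F] [Field E] [Algebra F E] : Prop :=
  ∃ S : Set E, S.Countable ∧ IntermediateField.adjoin F S = ⊤

end PrescribedValuation

open PrescribedValuation

set_option linter.unusedSectionVars false

namespace PrescribedValuation

section Basic

variable {K : Type*} [Field K] {G : Type*} [AddCommGroup G] [LinearOrder G]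
  [IsOrderedAddMonoid G] (v : AddValuation K (WithTop G))

theorem residue_eq_zero_iff (a : valRing v) :
    IsLocalRing.residue (valRing v) a = 0 ↔ 0 < v (a : K) := by
  rw [IsLocalRing.residue_eq_zero_iff]
  exact (AddValuation.toValuation v).valuationSubring.valuation_lt_one_iff a |>.trans
    (by
      rw [← (Valuation.isEquiv_valuation_valuationSubring
        (AddValuation.toValuation v)).lt_one_iff_lt_one]
      rfl)

theorem residue_eq_iff (a b : valRing v) :
    IsLocalRing.residue (valRing v) a = IsLocalRing.residue (valRing v) b ↔
      0 < v ((a : K) - b) := by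
  rw [← sub_eq_zero, ← map_sub, residue_eq_zero_iff]
  rfl

variable {v}

theorem exists_coe_eq {a : K} (ha : a ≠ 0) : ∃ g : G, v a = g := by
  obtain ⟨g, hg⟩ := WithTop.ne_top_iff_exists.1 ((AddValuation.ne_top_iff v).2 ha)
  exact ⟨g, hg.symm⟩

theorem ne_zero_of_coe {a : K} {g : G} (h : v a = g) : a ≠ 0 := by
  rintro rfl
  rw [AddValuation.map_zero] at h
  exact WithTop.top_ne_coe h

theorem eq_of_lt_sub {a b : K} (h : v a < v (a - b)) : v b = v a :=
  AddValuation.map_eq_of_lt_sub v (by rwa [AddValuation.map_sub_swap])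

theorem lt_sub_symm {a b : K} (h : v a < v (a - b)) : v b < v (b - a) := by
  rw [eq_of_lt_sub h, AddValuation.map_sub_swap]
  exact h

theorem lt_sub_mul {a a' b b' : K} (h : v a < v (a - a')) (h' : v b < v (b - b')) :
    v (a * b) < v (a * b - a' * b') := by
  have ha : v a ≠ ⊤ := h.ne_top
  have hb : v b ≠ ⊤ := h'.ne_top
  rw [show a * b - a' * b' = a * (b - b') + (a - a') * b' by ring, AddValuation.map_mul]
  apply AddValuation.map_lt_add
  · rw [AddValuation.map_mul]
    exact WithTop.add_lt_add_left ha h'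
  · rw [AddValuation.map_mul, eq_of_lt_sub h']
    exact WithTop.add_lt_add_right hb h

theorem lt_sub_inv {a a' : K} (h : v a < v (a - a')) : v a⁻¹ < v (a⁻¹ - a'⁻¹) := by
  have ha : a ≠ 0 := (AddValuation.ne_top_iff v).1 h.ne_top
  have ha' : a' ≠ 0 := (AddValuation.ne_top_iff v).1 (by rw [eq_of_lt_sub h]; exact h.ne_top)
  obtain ⟨g, hg⟩ := exists_coe_eq (v := v) (inv_ne_zero ha)
  have e : a⁻¹ - a'⁻¹ = -(a⁻¹ * a'⁻¹ * (a - a')) := by field_simp; ring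
  have h1 : v a'⁻¹ = v a⁻¹ := by rw [AddValuation.map_inv, AddValuation.map_inv, eq_of_lt_sub h]
  have h2 : v a⁻¹ + v a = 0 := by
    rw [← AddValuation.map_mul, inv_mul_cancel₀ ha, AddValuation.map_one]
  rw [e, AddValuation.map_neg, AddValuation.map_mul, AddValuation.map_mul, h1]
  calc v a⁻¹ = v a⁻¹ + (v a⁻¹ + v a) := by rw [h2, add_zero]
    _ = v a⁻¹ + v a⁻¹ + v a := by rw [add_assoc]
    _ < _ := WithTop.add_lt_add_left (by rw [hg]; exact WithTop.coe_ne_top) h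

theorem lt_sub_div {a a' b b' : K} (h : v a < v (a - a')) (h' : v b < v (b - b')) :
    v (a / b) < v (a / b - a' / b') := by
  simpa only [div_eq_mul_inv] using lt_sub_mul h (lt_sub_inv h')

theorem lt_sub_self {a : K} (ha : a ≠ 0) : v a < v (a - a) := by
  rw [sub_self, AddValuation.map_zero]
  exact (WithTop.lt_top_iff_ne_top).2 ((AddValuation.ne_top_iff v).2 ha)

end Basic

theorem exists_ringEquiv_of_range_eq {A B C : Type*} [Field A] [Field B] [Field C]
    (f : A →+* C) (g : B →+* C) (h : f.range = g.range) :
    ∃ φ : A ≃+* B, ∀ a, g (φ a) = f a := by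
  let F : A ≃+* f.range := RingEquiv.ofBijective f.rangeRestrict
    ⟨fun x y hxy => f.injective (congrArg Subtype.val hxy), f.rangeRestrict_surjective⟩
  let F' : B ≃+* g.range := RingEquiv.ofBijective g.rangeRestrict
    ⟨fun x y hxy => g.injective (congrArg Subtype.val hxy), g.rangeRestrict_surjective⟩
  refine ⟨F.trans ((RingEquiv.subringCongr h).trans F'.symm), fun a => ?_⟩
  have := congrArg Subtype.val (F'.apply_symm_apply (RingEquiv.subringCongr h (F a)))
  exact this

section Criterion

variable {K : Type*} [Field K] {G : Type*} [AddCommGroup G] [LinearOrder G]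
  [IsOrderedAddMonoid G] {v : AddValuation K (WithTop G)}
  {L M : Type*} [Field L] [Field M]
  {Γ H : Type*} [AddCommGroup Γ] [LinearOrder Γ] [IsOrderedAddMonoid Γ]
  [AddCommGroup H] [LinearOrder H] [IsOrderedAddMonoid H]

theorem map_withTop_add (J : Γ →+ H) (a b : WithTop Γ) :
    (a + b).map J = a.map J + b.map J := by
  cases a <;> cases b <;> simp [← WithTop.coe_add]

theorem map_withTop_zero (J : Γ →+ H) : (0 : WithTop Γ).map J = 0 :=
  congrArg ((↑) : H → WithTop H) J.map_zero

theorem strictMono_map {J : Γ →+ H} (hJ : StrictMono J) : StrictMono (WithTop.map J) :=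
  hJ.withTop_map

/-- A valuation on a subfield whose values lie in `J(Γ)` can be read as a `Γ`-valuation. -/
theorem exists_pullback {J : Γ →+ H} (hJ : StrictMono J) (W : AddValuation M (WithTop H))
    (τ : L →+* M) (h : ∀ u : L, u ≠ 0 → ∃ g : Γ, W (τ u) = (J g : H)) :
    ∃ w : AddValuation L (WithTop Γ), ∀ u, (w u).map J = W (τ u) := by
  have h' : ∀ u : L, ∃ g : WithTop Γ, g.map J = W (τ u) := by
    intro u
    by_cases hu : u = 0
    · exact ⟨⊤, by rw [hu, map_zero, AddValuation.map_zero]; rfl⟩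
    · obtain ⟨g, hg⟩ := h u hu
      exact ⟨g, by rw [hg]; rfl⟩
  choose f hf using h'
  have hinj := (strictMono_map hJ).injective
  refine ⟨AddValuation.of f (hinj ?_) (hinj ?_) (fun x y => ?_) (fun x y => hinj ?_), hf⟩
  · rw [hf, map_zero, AddValuation.map_zero]; rfl
  · rw [hf, map_one, AddValuation.map_one, map_withTop_zero]
  · rw [← (strictMono_map hJ).le_iff_le, (strictMono_map hJ).monotone.map_min, hf, hf, hf, map_add]
    exact AddValuation.map_add _ _ _
  · rw [map_withTop_add, hf, hf, hf, map_mul, AddValuation.map_mul]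

theorem map_nonneg_iff {J : Γ →+ H} (hJ : StrictMono J) (a : WithTop Γ) :
    0 ≤ a.map J ↔ 0 ≤ a := by
  rw [← map_withTop_zero J, (strictMono_map hJ).le_iff_le]

theorem map_pos_iff {J : Γ →+ H} (hJ : StrictMono J) (a : WithTop Γ) :
    0 < a.map J ↔ 0 < a := by
  rw [← map_withTop_zero J, (strictMono_map hJ).lt_iff_lt]

/-- If every element of `L` is asymptotically equal (inside a valued field `M`) to an element of a
subset `N` and conversely, then `L` has the values and residues of `N`. -/
theorem exists_extension_of_approx [Algebra K L] [Algebra K M]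
    {ι : G →+ Γ} (hι : StrictMono ι) {k : Type*} [Field k] [Algebra (Residue v) k]
    {i : G →+ H} {W : AddValuation M (WithTop H)} (hW : Extends i v W) (τ : L →ₐ[K] M)
    {J : Γ →+ H} (hJ : StrictMono J) (hJi : ∀ g, J (ι g) = i g)
    (jk : k →+* Residue W) (hjk : ∀ z, jk (algebraMap (Residue v) k z) = hW.residueMap z)
    (N : Set M)
    (n1 : ∀ e ∈ N, e ≠ 0 → ∃ g : Γ, W e = (J g : H))
    (n2 : ∀ g : Γ, ∃ e ∈ N, W e = (J g : H))
    (n3 : ∀ y : valRing W, (y : M) ∈ N → IsLocalRing.residue _ y ∈ jk.range)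
    (n4 : ∀ z : k, ∃ y : valRing W, (y : M) ∈ N ∧ IsLocalRing.residue _ y = jk z)
    (t1 : ∀ u : L, u ≠ 0 → ∃ e ∈ N, W (τ u) < W (τ u - e))
    (t2 : ∀ e ∈ N, e ≠ 0 → ∃ u : L, W e < W (e - τ u)) :
    ∃ (w : AddValuation L (WithTop Γ)) (h : Extends ι v w),
      Function.Surjective w ∧
      (∃ φ : k ≃+* Residue w, ∀ z : Residue v, φ (algebraMap (Residue v) k z) = h.residueMap z) ∧
      ∀ u, (w u).map J = W (τ u) := by
  have hval : ∀ u : L, u ≠ 0 → ∃ g : Γ, W (τ u) = (J g : H) := by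
    intro u hu
    obtain ⟨e, he, hlt⟩ := t1 u hu
    have h1 := eq_of_lt_sub hlt
    have he0 : e ≠ 0 := (AddValuation.ne_top_iff W).1 (by rw [h1]; exact hlt.ne_top)
    obtain ⟨g, hg⟩ := n1 e he he0
    exact ⟨g, by rw [← h1, hg]⟩
  obtain ⟨w, hw⟩ := exists_pullback hJ W (τ : L →+* M) hval
  replace hw : ∀ u, (w u).map J = W (τ u) := hw
  have hinj := (strictMono_map hJ).injective
  have hext : Extends ι v w := by
    refine ⟨hι, fun a => hinj ?_⟩
    rw [hw, AlgHom.commutes, hW.restrict, WithTop.map_map]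
    congr 1
    exact funext fun g => (hJi g).symm
  let _ : Algebra L M := (τ : L →+* M).toAlgebra
  have hext' : Extends J w W := ⟨hJ, fun a => (hw a).symm⟩
  have hcoe : ∀ a : valRing w, ((hext'.ringMap a : valRing W) : M) = τ a := fun a => rfl
  refine ⟨w, hext, fun g => ?_, ?_, hw⟩
  · cases g with
    | top => exact ⟨0, AddValuation.map_zero w⟩
    | coe g =>
      obtain ⟨e, he, hg⟩ := n2 g
      obtain ⟨u, hu⟩ := t2 e he (ne_zero_of_coe hg)
      refine ⟨u, hinj ?_⟩
      rw [hw, eq_of_lt_sub hu, hg]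
      rfl
  · have hrange : jk.range = hext'.residueMap.range := by
      ext t
      constructor
      · rintro ⟨z, rfl⟩
        obtain ⟨y, hyN, hy⟩ := n4 z
        by_cases hy0 : (y : M) = 0
        · refine ⟨0, ?_⟩
          rw [map_zero, ← hy, show y = 0 from Subtype.ext hy0, map_zero]
        · obtain ⟨u, hu⟩ := t2 y hyN hy0
          have h0 : 0 ≤ w u := by
            rw [← map_nonneg_iff hJ, hw, eq_of_lt_sub hu]
            exact y.2
          refine ⟨IsLocalRing.residue _ (⟨u, h0⟩ : valRing w), ?_⟩
          rw [← hy, hext'.residueMap_residue, eq_comm, residue_eq_iff, hcoe]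
          exact lt_of_le_of_lt y.2 hu
      · rintro ⟨z, rfl⟩
        obtain ⟨a, rfl⟩ := IsLocalRing.residue_surjective z
        rw [hext'.residueMap_residue]
        by_cases ha : (a : L) = 0
        · rw [show a = 0 from Subtype.ext ha, map_zero, map_zero]
          exact zero_mem _
        · obtain ⟨e, he, hlt⟩ := t1 a ha
          have h0 : 0 ≤ W (τ a) := by
            rw [← hw, map_nonneg_iff hJ]
            exact a.2
          have h1 : 0 ≤ W e := by rwa [eq_of_lt_sub hlt]
          have h2 := n3 ⟨e, h1⟩ he
          rwa [← (residue_eq_iff W (hext'.ringMap a) ⟨e, h1⟩).2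
            (by rw [hcoe]; exact lt_of_le_of_lt h0 hlt)] at h2
    obtain ⟨φ, hφ⟩ := exists_ringEquiv_of_range_eq jk hext'.residueMap hrange
    refine ⟨φ, fun z => hext'.residueMap.injective ?_⟩
    rw [hφ, hjk]
    obtain ⟨a, rfl⟩ := IsLocalRing.residue_surjective z
    rw [hext.residueMap_residue, hext'.residueMap_residue, hW.residueMap_residue]
    congr 1
    exact Subtype.ext (τ.commutes (a : K)).symm

end Criterion

end PrescribedValuation

namespace PrescribedValuation

section Existence

variable {L : Type uL} [Field L] {H₀ : Type uH} [AddCommGroup H₀] [LinearOrder H₀]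
  [IsOrderedAddMonoid H₀] {u : AddValuation L (WithTop H₀)}

/-- The additive valuation attached to a valuation subring. -/
theorem exists_addValuation_of_valuationSubring {M : Type uM} [Field M] (B : ValuationSubring M) :
    ∃ (H : Type uM) (_ : AddCommGroup H) (_ : LinearOrder H) (_ : IsOrderedAddMonoid H)
      (W : AddValuation M (WithTop H)), Function.Surjective W ∧ ∀ x, 0 ≤ W x ↔ x ∈ B := by
  classical
  let H := Additive (B.ValueGroupˣ)ᵒᵈ
  let val : ∀ x : M, x ≠ 0 → H := fun x hx =>
    Additive.ofMul (OrderDual.toDual (Units.mk0 (B.valuation x) ((B.valuation.ne_zero_iff).2 hx)))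
  have hle : ∀ x y hx hy, val x hx ≤ val y hy ↔ B.valuation y ≤ B.valuation x :=
    fun x y hx hy => Iff.rfl
  let f : M → WithTop H := fun x => if hx : x = 0 then ⊤ else (val x hx : H)
  have f0 : f 0 = ⊤ := dif_pos rfl
  have fne : ∀ x (hx : x ≠ 0), f x = (val x hx : H) := fun x hx => dif_neg hx
  have fle : ∀ x y, f x ≤ f y ↔ B.valuation y ≤ B.valuation x := by
    intro x y
    by_cases hx : x = 0
    · by_cases hy : y = 0
      · simp [hx, hy]
      · subst hx
        rw [f0, fne y hy]
        simp [hy]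
    · by_cases hy : y = 0
      · simp [hy, f0]
      · rw [fne x hx, fne y hy, WithTop.coe_le_coe, hle _ _ hx hy]
  have f1 : f 1 = 0 := by
    rw [fne 1 one_ne_zero, ← WithTop.coe_zero]
    congr 1
    change Additive.ofMul (OrderDual.toDual _) = Additive.ofMul (OrderDual.toDual 1)
    congr 2
    exact Units.ext (map_one _)
  refine ⟨H, inferInstance, inferInstance, inferInstance,
    AddValuation.of f f0 f1 (fun x y => ?_) (fun x y => ?_), ?_, ?_⟩
  · rcases le_total (f x) (f y) with h | h
    · rw [min_eq_left h, fle]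
      rw [fle] at h
      exact B.valuation.map_add_le le_rfl h
    · rw [min_eq_right h, fle]
      rw [fle] at h
      exact B.valuation.map_add_le h le_rfl
  · by_cases hx : x = 0
    · rw [hx, zero_mul, f0, top_add]
    by_cases hy : y = 0
    · rw [hy, mul_zero, f0, add_top]
    rw [fne x hx, fne y hy, fne _ (mul_ne_zero hx hy), ← WithTop.coe_add]
    congr 1
    exact congrArg (fun z : B.ValueGroupˣ => Additive.ofMul (OrderDual.toDual z))
      (show Units.mk0 (B.valuation (x * y)) ((B.valuation.ne_zero_iff).2 (mul_ne_zero hx hy)) =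
        Units.mk0 (B.valuation x) ((B.valuation.ne_zero_iff).2 hx) *
          Units.mk0 (B.valuation y) ((B.valuation.ne_zero_iff).2 hy)
        from Units.ext (map_mul B.valuation x y))
  · intro h
    cases h with
    | top => exact ⟨0, f0⟩
    | coe h =>
      obtain ⟨x, hx⟩ := B.valuation_surjective (OrderDual.ofDual (Additive.toMul h)).1
      have hx0 : x ≠ 0 := (B.valuation.ne_zero_iff).1 (by rw [hx]; exact Units.ne_zero _)
      refine ⟨x, ?_⟩
      rw [AddValuation.of_apply, fne x hx0]
      congr 1
      change Additive.ofMul (OrderDual.toDual _) =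
        Additive.ofMul (OrderDual.toDual (OrderDual.ofDual (Additive.toMul h)))
      congr 2
      exact Units.ext hx
  · intro x
    rw [AddValuation.of_apply, ← f1, fle, map_one, B.valuation_le_one_iff]

/-- Two valuations with compatible valuation rings give an extension of valued fields. -/
theorem exists_extends_of_nonneg_iff (hu : Function.Surjective u) {M : Type uM} [Field M]
    [Algebra L M] {H : Type*} [AddCommGroup H] [LinearOrder H] [IsOrderedAddMonoid H]
    (W : AddValuation M (WithTop H)) (h : ∀ a : L, 0 ≤ u a ↔ 0 ≤ W (algebraMap L M a)) :
    ∃ i : H₀ →+ H, Extends i u W := by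
  have hle : ∀ a b : L, u a ≤ u b ↔ W (algebraMap L M a) ≤ W (algebraMap L M b) := by
    intro a b
    by_cases ha : a = 0
    · subst ha
      simp
    · have e : b = a * (b / a) := by field_simp
      obtain ⟨g, hg⟩ := exists_coe_eq (v := u) ha
      obtain ⟨g', hg'⟩ := exists_coe_eq (v := W) ((map_ne_zero (algebraMap L M)).2 ha)
      rw [e, map_mul (algebraMap L M), AddValuation.map_mul, AddValuation.map_mul, hg, hg']
      have k1 : ∀ z : WithTop H₀, (g : WithTop H₀) ≤ g + z ↔ 0 ≤ z := fun z => by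
        cases z with
        | top => simp
        | coe z => rw [← WithTop.coe_add, WithTop.coe_le_coe, ← WithTop.coe_zero,
            WithTop.coe_le_coe, le_add_iff_nonneg_right]
      have k2 : ∀ z : WithTop H, (g' : WithTop H) ≤ g' + z ↔ 0 ≤ z := fun z => by
        cases z with
        | top => simp
        | coe z => rw [← WithTop.coe_add, WithTop.coe_le_coe, ← WithTop.coe_zero,
            WithTop.coe_le_coe, le_add_iff_nonneg_right]
      rw [k1, k2, h]
  have heq : ∀ a b : L, u a = u b ↔ W (algebraMap L M a) = W (algebraMap L M b) :=
    fun a b => by rw [le_antisymm_iff, le_antisymm_iff, hle, hle]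
  choose s hs using fun g : H₀ => hu (g : WithTop H₀)
  have hs' : ∀ g, ∃ g' : H, W (algebraMap L M (s g)) = g' := fun g =>
    exists_coe_eq ((map_ne_zero (algebraMap L M)).2 (ne_zero_of_coe (hs g)))
  choose i hi using hs'
  have hmul : ∀ g g', i (g + g') = i g + i g' := by
    intro g g'
    have : u (s (g + g')) = u (s g * s g') := by
      rw [AddValuation.map_mul, hs, hs, hs, WithTop.coe_add]
    rw [heq, map_mul (algebraMap L M), AddValuation.map_mul, hi, hi, hi, ← WithTop.coe_add] at this
    exact WithTop.coe_injective this
  refine ⟨AddMonoidHom.mk' i hmul, ?_, fun a => ?_⟩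
  · intro g g' hlt
    have : u (s g) < u (s g') := by rw [hs, hs]; exact WithTop.coe_lt_coe.2 hlt
    rw [← not_le, hle, not_le, hi, hi] at this
    exact WithTop.coe_lt_coe.1 this
  · by_cases ha : a = 0
    · rw [ha, map_zero, AddValuation.map_zero, AddValuation.map_zero]
      rfl
    · obtain ⟨g, hg⟩ := exists_coe_eq (v := u) ha
      rw [hg, (heq a (s g)).1 (by rw [hg, hs]), hi]
      rfl

/-- Existence of extensions of a valuation whose valuation ring contains a given subring `A`,
under the obvious necessary condition. -/
theorem exists_extends_of_subring (hu : Function.Surjective u) {M : Type uM} [Field M]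
    [Algebra L M] (A : Subring M) (hA : ∀ a : L, 0 ≤ u a → algebraMap L M a ∈ A)
    (I : Ideal A) (hI : I ≠ ⊤)
    (hIu : ∀ (a : L) (ha : 0 < u a), (⟨algebraMap L M a, hA a ha.le⟩ : A) ∈ I) :
    ∃ (H : Type uM) (_ : AddCommGroup H) (_ : LinearOrder H) (_ : IsOrderedAddMonoid H)
      (i : H₀ →+ H) (W : AddValuation M (WithTop H)),
      Extends i u W ∧ Function.Surjective W ∧ ∀ x ∈ A, 0 ≤ W x := by
  obtain ⟨B, hAB, hIB⟩ := I.image_subset_nonunits_valuationSubring hI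
  obtain ⟨H, i1, i2, i3, W, hW, hWB⟩ := exists_addValuation_of_valuationSubring B
  have key : ∀ a : L, 0 ≤ u a ↔ 0 ≤ W (algebraMap L M a) := by
    intro a
    rw [hWB]
    refine ⟨fun h => hAB (hA a h), fun h => ?_⟩
    by_contra hneg
    rw [not_le] at hneg
    have ha0 : a ≠ 0 := by
      rintro rfl
      rw [AddValuation.map_zero] at hneg
      exact not_top_lt hneg
    have hpos : 0 < u a⁻¹ := by
      obtain ⟨g, hg⟩ := exists_coe_eq (v := u) ha0
      rw [AddValuation.map_inv, hg]
      rw [hg, ← WithTop.coe_zero, WithTop.coe_lt_coe] at hneg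
      exact WithTop.coe_lt_coe.2 (neg_pos.2 hneg)
    have h1 : algebraMap L M a⁻¹ ∈ B.nonunits := hIB ⟨_, hIu _ hpos, rfl⟩
    rw [map_inv₀, B.inv_mem_nonunits_iff] at h1
    rcases h1 with h1 | h1
    · exact ha0 ((map_eq_zero _).1 h1)
    · exact h1 h
  obtain ⟨i, hi⟩ := exists_extends_of_nonneg_iff hu W key
  exact ⟨H, i1, i2, i3, i, W, hi, hW, fun x hx => (hWB x).2 (hAB hx)⟩

/-- Every valuation extends to every extension field. -/
theorem exists_extends (hu : Function.Surjective u) (M : Type uM) [Field M] [Algebra L M] :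
    ∃ (H : Type uM) (_ : AddCommGroup H) (_ : LinearOrder H) (_ : IsOrderedAddMonoid H)
      (i : H₀ →+ H) (W : AddValuation M (WithTop H)), Extends i u W ∧ Function.Surjective W := by
  let A : Subring M := (valRing u).toSubring.map (algebraMap L M)
  let f : valRing u →+* A := ((algebraMap L M).comp (valRing u).subtype).codRestrict A
    fun a => ⟨a, a.2, rfl⟩
  have hf : Function.Bijective f := by
    refine ⟨fun x y h => ?_, ?_⟩
    · exact Subtype.ext ((algebraMap L M).injective (congrArg Subtype.val h))
    · rintro ⟨_, a, ha, rfl⟩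
      exact ⟨⟨a, ha⟩, rfl⟩
  let F := RingEquiv.ofBijective f hf
  have hA : ∀ a : L, 0 ≤ u a → algebraMap L M a ∈ A := fun a ha => ⟨a, ha, rfl⟩
  obtain ⟨H, i1, i2, i3, i, W, h, hW, -⟩ := exists_extends_of_subring hu A hA
    ((IsLocalRing.maximalIdeal (valRing u)).comap F.symm.toRingHom)
    (Ideal.comap_ne_top _ (IsLocalRing.maximalIdeal.isMaximal _).ne_top) (by
      intro a ha
      rw [Ideal.mem_comap]
      have : F.symm ⟨algebraMap L M a, hA a ha.le⟩ = ⟨a, ha.le⟩ := by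
        rw [RingEquiv.symm_apply_eq]
        rfl
      change F.symm _ ∈ _
      rw [this, ← IsLocalRing.residue_eq_zero_iff, residue_eq_zero_iff]
      exact ha)
  exact ⟨H, i1, i2, i3, i, W, h, hW⟩

end Existence

section AlgClosed

variable {Ω : Type uL} [Field Ω] [IsAlgClosed Ω] {H : Type uH} [AddCommGroup H] [LinearOrder H]
  [IsOrderedAddMonoid H] {W : AddValuation Ω (WithTop H)}

theorem isAlgClosed_residue : IsAlgClosed (Residue W) := by
  refine IsAlgClosed.of_exists_root _ fun p hp hirr => ?_
  obtain ⟨q, hq, -, hqm⟩ := Polynomial.lifts_and_natDegree_eq_and_monic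
    (f := IsLocalRing.residue (valRing W))
    ((Polynomial.mem_lifts _).2 (Polynomial.map_surjective _ IsLocalRing.residue_surjective p)) hp
  obtain ⟨x, hx⟩ := IsAlgClosed.exists_aeval_eq_zero Ω q (by
    rw [← hqm.degree_map (IsLocalRing.residue (valRing W)), hq]
    exact (Polynomial.degree_pos_of_irreducible hirr).ne')
  have hint : IsIntegral (valRing W) x := ⟨q, hqm, hx⟩
  obtain ⟨y, rfl⟩ := (IsIntegrallyClosed.isIntegral_iff).1 hint
  refine ⟨IsLocalRing.residue _ y, ?_⟩
  rw [Polynomial.aeval_algebraMap_apply, map_eq_zero_iff _ (FaithfulSMul.algebraMap_injective _ _)]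
    at hx
  rw [Polynomial.coe_aeval_eq_eval] at hx
  rw [← hq, Polynomial.eval_map, Polynomial.eval₂_at_apply, hx, map_zero]

theorem exists_nsmul_mem_range {G Γ : Type*} [AddCommGroup G] [AddCommGroup Γ] {ι : G →+ Γ}
    (htors : IsAddTorsion (Γ ⧸ ι.range)) (g : Γ) : ∃ n : ℕ, 0 < n ∧ ∃ g' : G, ι g' = n • g := by
  obtain ⟨n, hn, h⟩ := isOfFinAddOrder_iff_nsmul_eq_zero.1 (htors (QuotientAddGroup.mk g))
  refine ⟨n, hn, ?_⟩
  rw [← QuotientAddGroup.mk_nsmul, QuotientAddGroup.eq_zero_iff] at h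
  exact h

/-- A torsion extension of ordered groups embeds into the value group of an algebraically closed
valued field. -/
theorem exists_strictMono_extension (hW : Function.Surjective W) {G Γ : Type*} [AddCommGroup G]
    [LinearOrder G] [IsOrderedAddMonoid G] [AddCommGroup Γ] [LinearOrder Γ] [IsOrderedAddMonoid Γ]
    {ι : G →+ Γ} (hι : StrictMono ι) (htors : IsAddTorsion (Γ ⧸ ι.range))
    {i : G →+ H} (hi : StrictMono i) :
    ∃ J : Γ →+ H, StrictMono J ∧ ∀ g, J (ι g) = i g := by
  have hdiv : ∀ n : ℤ, n ≠ 0 → Function.Surjective (fun h : H => n • h) := by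
    intro n hn h
    obtain ⟨x, hx⟩ := hW (h : WithTop H)
    obtain ⟨y, hy⟩ := IsAlgClosed.exists_pow_nat_eq x (Int.natAbs_pos.2 hn)
    have hy0 : y ≠ 0 := by
      rintro rfl
      rw [zero_pow (Int.natAbs_pos.2 hn).ne'] at hy
      exact ne_zero_of_coe hx hy.symm
    obtain ⟨g, hg⟩ := exists_coe_eq (v := W) hy0
    rw [← hy, AddValuation.map_pow, hg, ← WithTop.coe_nsmul, WithTop.coe_inj] at hx
    rcases Int.natAbs_eq n with e | e
    · exact ⟨g, by rw [← hx]; change n • g = _; rw [e, natCast_zsmul, Int.natAbs_natCast]⟩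
    · refine ⟨-g, ?_⟩
      rw [← hx]
      change n • -g = _
      rw [e, neg_smul_neg, natCast_zsmul, Int.natAbs_neg, Int.natAbs_natCast]
  let _ : DivisibleBy H ℤ := divisibleByOfSMulRightSurj H ℤ fun hn => hdiv _ hn
  obtain ⟨J, hJ⟩ := (Module.Baer.of_divisible H).extension_property ι.toIntLinearMap hι.injective
    i.toIntLinearMap
  have hJ' : ∀ g, J (ι g) = i g := fun g => LinearMap.congr_fun hJ g
  refine ⟨J.toAddMonoidHom, ?_, hJ'⟩
  intro a b hab
  obtain ⟨n, hn, g, hg⟩ := exists_nsmul_mem_range htors (b - a)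
  have h1 : 0 < ι g := by
    rw [hg]
    exact nsmul_pos (sub_pos.2 hab) hn.ne'
  rw [← map_zero ι, hι.lt_iff_lt] at h1
  have h2 : 0 < n • (J b - J a) := by
    rw [← map_sub, ← map_nsmul, ← hg, hJ', ← map_zero i]
    exact hi h1
  exact sub_pos.1 ((nsmul_pos_iff hn.ne').1 h2)

end AlgClosed

end PrescribedValuation

namespace PrescribedValuation

/-- A field extension `Ω` of a valued field `(K, v)`, with an extension of `v` to `Ω`, an embedding
of the ordered group `Γ` over the value group of `K` and of the field `k` over the residue field
of `K`. -/
structure Ambient {K : Type*} [Field K] {G : Type*} [AddCommGroup G] [LinearOrder G]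
    [IsOrderedAddMonoid G] (v : AddValuation K (WithTop G)) {Γ : Type*} [AddCommGroup Γ]
    [LinearOrder Γ] [IsOrderedAddMonoid Γ] (ι : G →+ Γ) (k : Type*) [Field k]
    [Algebra (Residue v) k] (Ω : Type*) [Field Ω] [Algebra K Ω] (H : Type*) [AddCommGroup H]
    [LinearOrder H] [IsOrderedAddMonoid H] where
  i : G →+ H
  W : AddValuation Ω (WithTop H)
  ext : Extends i v W
  J : Γ →+ H
  strictMono_J : StrictMono J
  J_ι : ∀ g, J (ι g) = i g
  jk : k →+* Residue W
  jk_algebraMap : ∀ z, jk (algebraMap (Residue v) k z) = ext.residueMap z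

section Sums

variable {K : Type*} [Field K] {G : Type*} [AddCommGroup G] [LinearOrder G]
  [IsOrderedAddMonoid G] {v : AddValuation K (WithTop G)}

theorem exists_eq_of_le_sum {κ : Type*} [Fintype κ] {t : κ → K} (h0 : ∑ j, t j ≠ 0)
    (h : ∀ j, v (∑ j, t j) ≤ v (t j)) : ∃ j, v (∑ j, t j) = v (t j) := by
  by_contra! hne
  exact lt_irrefl _ (AddValuation.map_lt_sum v ((AddValuation.ne_top_iff v).2 h0)
    fun j (_ : j ∈ Finset.univ) => lt_of_le_of_ne (h j) (hne j))

/-- If the nonzero terms of a sum have pairwise distinct values, then the value of the sum is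
the smallest one. -/
theorem sum_le_of_injective {κ : Type*} [Fintype κ] {t : κ → K}
    (h : ∀ j j', t j ≠ 0 → v (t j) = v (t j') → j = j') (j : κ) : v (∑ j, t j) ≤ v (t j) := by
  classical
  obtain ⟨j₀, -, hj₀⟩ := Finset.exists_min_image Finset.univ (fun j => v (t j)) ⟨j, Finset.mem_univ j⟩
  refine le_trans (le_of_eq ?_) (hj₀ j (Finset.mem_univ j))
  by_cases h0 : t j₀ = 0
  · have : ∀ j, t j = 0 := fun j => by
      have := hj₀ j (Finset.mem_univ j)
      simp only [h0, AddValuation.map_zero, top_le_iff] at this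
      exact (AddValuation.top_iff v).1 this
    simp [this]
  · rw [← Finset.add_sum_erase _ _ (Finset.mem_univ j₀)]
    refine AddValuation.map_add_eq_of_lt_left v (AddValuation.map_lt_sum v
      ((AddValuation.ne_top_iff v).2 h0) fun j' hj' => lt_of_le_of_ne (hj₀ j' (Finset.mem_univ _)) ?_)
    intro he
    exact (Finset.ne_of_mem_erase hj') (h _ _ h0 he).symm

end Sums

section Simple

variable {E Ω : Type*} [Field E] [Field Ω] [Algebra E Ω]

theorem exists_sum_of_mem_adjoin {b : Ω} {f : Polynomial E} (hf : f.Monic)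
    (hb : Polynomial.aeval b f = 0) {x : Ω} (hx : x ∈ IntermediateField.adjoin E {b}) :
    ∃ c : Fin f.natDegree → E, x = ∑ j, algebraMap E Ω (c j) * b ^ (j : ℕ) := by
  have hint : IsIntegral E b := ⟨f, hf, hb⟩
  rw [← IntermediateField.mem_toSubalgebra,
    IntermediateField.adjoin_simple_toSubalgebra_of_isAlgebraic hint.isAlgebraic,
    Algebra.adjoin_singleton_eq_range_aeval] at hx
  obtain ⟨p, rfl⟩ := hx
  refine ⟨fun j => (p %ₘ f).coeff j, ?_⟩
  change Polynomial.aeval b p = _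
  rw [← Polynomial.modByMonic_add_div p f, map_add, map_mul, hb, zero_mul, add_zero,
    Polynomial.modByMonic_add_div p f]
  by_cases h1 : f = 1
  · subst h1
    simp
  rw [Polynomial.aeval_eq_sum_range' (Polynomial.natDegree_modByMonic_lt p hf h1),
    Finset.sum_range]
  simp only [Algebra.smul_def]

theorem minpoly_eq_of_linearIndependent {b : Ω} (hb0 : b ≠ 0) {f : Polynomial E} (hf : f.Monic)
    (hb : Polynomial.aeval b f = 0)
    (hind : ∀ c : Fin f.natDegree → E, ∑ j, algebraMap E Ω (c j) * b ^ (j : ℕ) = 0 →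
      ∀ j, algebraMap E Ω (c j) * b ^ (j : ℕ) = 0) : minpoly E b = f := by
  have hint : IsIntegral E b := ⟨f, hf, hb⟩
  refine (Polynomial.eq_of_monic_of_dvd_of_natDegree_le (minpoly.monic hint) hf
    (minpoly.dvd E b hb) ?_).symm
  by_contra! hlt
  have h1 := hind (fun j => (minpoly E b).coeff j) (by
    rw [← minpoly.aeval E b, Polynomial.aeval_eq_sum_range' hlt, Finset.sum_range]
    simp only [Algebra.smul_def]) ⟨_, hlt⟩
  simp only [Polynomial.coeff_natDegree, (minpoly.monic hint).leadingCoeff, map_one, one_mul] at h1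
  exact hb0 ((pow_eq_zero_iff (minpoly.natDegree_pos hint).ne').1 h1)

theorem finite_restrictScalars {K Ω : Type*} [Field K] [Field Ω] [Algebra K Ω]
    (E : IntermediateField K Ω) (F : IntermediateField E Ω) [FiniteDimensional K E]
    [FiniteDimensional E F] : FiniteDimensional K (F.restrictScalars K) := by
  have : IsScalarTower K E F := IsScalarTower.of_algebraMap_eq fun _ => rfl
  exact Module.Finite.trans (R := K) E F

theorem isSeparable_restrictScalars {K Ω : Type*} [Field K] [Field Ω] [Algebra K Ω]
    (E : IntermediateField K Ω) (F : IntermediateField E Ω) [Algebra.IsSeparable K E]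
    [Algebra.IsSeparable E F] : Algebra.IsSeparable K (F.restrictScalars K) := by
  have : IsScalarTower K E F := IsScalarTower.of_algebraMap_eq fun _ => rfl
  exact Algebra.IsSeparable.trans K E F

end Simple

namespace Ambient

variable {K : Type*} [Field K] {G : Type*} [AddCommGroup G] [LinearOrder G]
  [IsOrderedAddMonoid G] {v : AddValuation K (WithTop G)} {Γ : Type*} [AddCommGroup Γ]
  [LinearOrder Γ] [IsOrderedAddMonoid Γ] {ι : G →+ Γ} {k : Type*} [Field k]
  [Algebra (Residue v) k] {Ω : Type*} [Field Ω] [Algebra K Ω] {H : Type*} [AddCommGroup H]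
  [LinearOrder H] [IsOrderedAddMonoid H] (S : Ambient v ι k Ω H)

/-- Finite separable subextensions of `Ω | K` with values in `Γ` and residues in `k`, having a
`K`-basis which is a valuation basis. -/
structure Good (E : IntermediateField K Ω) : Prop where
  finite : FiniteDimensional K E
  separable : Algebra.IsSeparable K E
  basis : ∃ (κ : Type) (_ : Fintype κ) (β : κ → Ω), (∀ j, β j ∈ E) ∧
    (∀ x ∈ E, ∃ c : κ → K, x = ∑ j, algebraMap K Ω (c j) * β j) ∧
    ∀ (c : κ → K) (j : κ), S.W (∑ j, algebraMap K Ω (c j) * β j) ≤ S.W (algebraMap K Ω (c j) * β j)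
  val : ∀ x ∈ E, x ≠ 0 → ∃ g : Γ, S.W x = (S.J g : H)
  res : ∀ y : valRing S.W, (y : Ω) ∈ E → IsLocalRing.residue _ y ∈ S.jk.range

variable {S}

theorem Good.adjoin {E : IntermediateField K Ω} (hE : S.Good E) {b : Ω} {γ : Γ}
    (hbγ : S.W b = (S.J γ : H)) {f : Polynomial E} (hf : f.Monic)
    (hb : Polynomial.aeval b f = 0) (hder : Polynomial.derivative f ≠ 0)
    (hind : ∀ (c : Fin f.natDegree → E) (j), S.W (∑ j, (c j : Ω) * b ^ (j : ℕ)) ≤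
      S.W ((c j : Ω) * b ^ (j : ℕ)))
    (hres : ∀ (c : Fin f.natDegree → E) (y : valRing S.W), (y : Ω) = ∑ j, (c j : Ω) * b ^ (j : ℕ) →
      IsLocalRing.residue _ y ∈ S.jk.range) :
    S.Good ((IntermediateField.adjoin E {b}).restrictScalars K) := by
  have hb0 : b ≠ 0 := ne_zero_of_coe hbγ
  have hint : IsIntegral E b := ⟨f, hf, hb⟩
  have hmin : minpoly E b = f := minpoly_eq_of_linearIndependent hb0 hf hb fun c hc j => by
    have := hind c j
    change ∑ j, (c j : Ω) * b ^ (j : ℕ) = 0 at hc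
    rw [hc, AddValuation.map_zero, top_le_iff, AddValuation.top_iff] at this
    exact this
  have := hE.finite
  have := hE.separable
  have : FiniteDimensional E (IntermediateField.adjoin E {b}) :=
    IntermediateField.adjoin.finiteDimensional hint
  have hsep : IsSeparable E b := by
    rw [IsSeparable, Polynomial.separable_iff_derivative_ne_zero (minpoly.irreducible hint), hmin]
    exact hder
  have : Algebra.IsSeparable E (IntermediateField.adjoin E {b}) :=
    (IntermediateField.isSeparable_adjoin_simple_iff_isSeparable E Ω).2 hsep
  refine ⟨finite_restrictScalars E _, isSeparable_restrictScalars E _, ?_, ?_, ?_⟩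
  · obtain ⟨κ, _, β, hβ, hspan, hle⟩ := hE.basis
    have hsum : ∀ c : κ × Fin f.natDegree → K, ∑ p, algebraMap K Ω (c p) * (β p.1 * b ^ (p.2 : ℕ)) =
        ∑ j, (∑ i, algebraMap K Ω (c (i, j)) * β i) * b ^ (j : ℕ) := by
      intro c
      rw [Fintype.sum_prod_type_right]
      simp only [Finset.sum_mul, mul_assoc]
    refine ⟨κ × Fin f.natDegree, inferInstance, fun p => β p.1 * b ^ (p.2 : ℕ), ?_, ?_, ?_⟩
    · rintro ⟨i, j⟩
      exact mul_mem ((IntermediateField.adjoin E {b}).algebraMap_mem ⟨β i, hβ i⟩)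
        (pow_mem (IntermediateField.mem_adjoin_simple_self E b) _)
    · intro x hx
      obtain ⟨c, hc⟩ := exists_sum_of_mem_adjoin hf hb hx
      choose d hd using fun j => hspan (c j) (c j).2
      refine ⟨fun p => d p.2 p.1, ?_⟩
      rw [hsum, hc]
      exact Finset.sum_congr rfl fun j _ => by rw [← hd j]; rfl
    · rintro c ⟨i, j⟩
      rw [hsum]
      have hmem : ∀ j, ∑ i, algebraMap K Ω (c (i, j)) * β i ∈ E := fun j =>
        sum_mem fun i _ => mul_mem (E.algebraMap_mem _) (hβ i)
      refine (hind (fun j => ⟨_, hmem j⟩) j).trans ?_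
      rw [← mul_assoc, AddValuation.map_mul, AddValuation.map_mul _ _ (b ^ _)]
      exact add_le_add_left (hle (fun i => c (i, j)) i) _
  · intro x hx hx0
    obtain ⟨c, hc⟩ := exists_sum_of_mem_adjoin hf hb hx
    change x = ∑ j, (c j : Ω) * b ^ (j : ℕ) at hc
    obtain ⟨j, hj⟩ := exists_eq_of_le_sum (v := S.W) (by rw [← hc]; exact hx0) (hind c)
    rw [← hc] at hj
    have hcj : (c j : Ω) ≠ 0 := by
      intro h0
      rw [h0, zero_mul, AddValuation.map_zero, AddValuation.top_iff] at hj
      exact hx0 hj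
    obtain ⟨g, hg⟩ := hE.val _ (c j).2 hcj
    refine ⟨g + (j : ℕ) • γ, ?_⟩
    rw [hj, AddValuation.map_mul, AddValuation.map_pow, hg, hbγ, map_add, map_nsmul,
      WithTop.coe_add, WithTop.coe_nsmul]
  · intro y hy
    obtain ⟨c, hc⟩ := exists_sum_of_mem_adjoin hf hb hy
    exact hres c y hc

end Ambient

end PrescribedValuation

namespace PrescribedValuation

namespace Ambient

variable {K : Type*} [Field K] {G : Type*} [AddCommGroup G] [LinearOrder G]
  [IsOrderedAddMonoid G] {v : AddValuation K (WithTop G)} {Γ : Type*} [AddCommGroup Γ]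
  [LinearOrder Γ] [IsOrderedAddMonoid Γ] {ι : G →+ Γ} {k : Type*} [Field k]
  [Algebra (Residue v) k] {Ω : Type*} [Field Ω] [Algebra K Ω] {H : Type*} [AddCommGroup H]
  [LinearOrder H] [IsOrderedAddMonoid H] (S : Ambient v ι k Ω H)

/-- The elements of `Γ` which are values of elements of `E`. -/
def valSub (E : IntermediateField K Ω) : AddSubgroup Γ where
  carrier := {γ | ∃ x ∈ E, S.W x = (S.J γ : H)}
  zero_mem' := ⟨1, one_mem E, by rw [AddValuation.map_one, map_zero]; rfl⟩
  add_mem' := by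
    rintro γ γ' ⟨x, hx, h⟩ ⟨x', hx', h'⟩
    exact ⟨x * x', mul_mem hx hx', by rw [AddValuation.map_mul, h, h', map_add]; rfl⟩
  neg_mem' := by
    rintro γ ⟨x, hx, h⟩
    exact ⟨x⁻¹, inv_mem hx, by rw [AddValuation.map_inv, h, map_neg]; rfl⟩

theorem mem_valSub {E : IntermediateField K Ω} {γ : Γ} :
    γ ∈ S.valSub E ↔ ∃ x ∈ E, S.W x = (S.J γ : H) :=
  Iff.rfl

/-- The elements of `k` which are residues of elements of `E`. -/
def resSub (E : IntermediateField K Ω) : IntermediateField (Residue v) k where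
  carrier := {z | ∃ y : valRing S.W, (y : Ω) ∈ E ∧ IsLocalRing.residue _ y = S.jk z}
  mul_mem' := by
    rintro z z' ⟨y, hy, h⟩ ⟨y', hy', h'⟩
    exact ⟨y * y', mul_mem hy hy', by rw [map_mul, h, h', map_mul]⟩
  add_mem' := by
    rintro z z' ⟨y, hy, h⟩ ⟨y', hy', h'⟩
    exact ⟨y + y', add_mem hy hy', by rw [map_add, h, h', map_add]⟩
  algebraMap_mem' := by
    intro r
    obtain ⟨a, rfl⟩ := IsLocalRing.residue_surjective r
    exact ⟨S.ext.ringMap a, E.algebraMap_mem _, by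
      rw [S.jk_algebraMap, S.ext.residueMap_residue]⟩
  inv_mem' := by
    rintro z ⟨y, hy, h⟩
    by_cases hz : z = 0
    · exact ⟨0, zero_mem E, by rw [hz, inv_zero, map_zero, map_zero]⟩
    · have hu : IsUnit y := by
        rw [← IsLocalRing.residue_ne_zero_iff_isUnit, h]
        exact (map_ne_zero _).2 hz
      obtain ⟨y', hy'⟩ := isUnit_iff_exists_inv.1 hu
      have e : (y' : Ω) = (y : Ω)⁻¹ := eq_inv_of_mul_eq_one_right (congrArg Subtype.val hy')
      refine ⟨y', by rw [e]; exact inv_mem hy, ?_⟩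
      rw [map_inv₀, ← h]
      exact eq_inv_of_mul_eq_one_right (by rw [← map_mul, hy', map_one])

theorem mem_resSub {E : IntermediateField K Ω} {z : k} :
    z ∈ S.resSub E ↔ ∃ y : valRing S.W, (y : Ω) ∈ E ∧ IsLocalRing.residue _ y = S.jk z :=
  Iff.rfl

variable {S}

theorem valSub_mono {E F : IntermediateField K Ω} (h : E ≤ F) : S.valSub E ≤ S.valSub F := by
  rintro γ ⟨x, hx, e⟩
  exact ⟨x, h hx, e⟩

theorem resSub_mono {E F : IntermediateField K Ω} (h : E ≤ F) : S.resSub E ≤ S.resSub F := by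
  rintro γ ⟨x, hx, e⟩
  exact ⟨x, h hx, e⟩

theorem range_le_valSub (hv : Function.Surjective v) (E : IntermediateField K Ω) :
    ι.range ≤ S.valSub E := by
  rintro _ ⟨g, rfl⟩
  obtain ⟨a, ha⟩ := hv (g : WithTop G)
  exact ⟨algebraMap K Ω a, E.algebraMap_mem a, by rw [S.ext.restrict, ha, S.J_ι]; rfl⟩

theorem Good.exists_val (hv : Function.Surjective v) (htors : IsAddTorsion (Γ ⧸ ι.range))
    [IsAlgClosed Ω] {E : IntermediateField K Ω} (hE : S.Good E) (γ : Γ) :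
    ∃ E', E ≤ E' ∧ S.Good E' ∧ γ ∈ S.valSub E' := by
  classical
  by_cases hγ : γ ∈ S.valSub E
  · exact ⟨E, le_rfl, hE, hγ⟩
  have hex : ∃ m : ℕ, 0 < m ∧ m • γ ∈ S.valSub E := by
    obtain ⟨n, hn, g, hg⟩ := exists_nsmul_mem_range htors γ
    exact ⟨n, hn, range_le_valSub hv E ⟨g, hg⟩⟩
  obtain ⟨hm0, hmγ⟩ := Nat.find_spec hex
  have hmin : ∀ n, 0 < n → n < Nat.find hex → n • γ ∉ S.valSub E := fun n hn hlt h =>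
    Nat.find_min hex hlt ⟨hn, h⟩
  generalize Nat.find hex = m at hm0 hmγ hmin
  have hm2 : 2 ≤ m := by
    by_contra! h
    obtain rfl : m = 1 := by omega
    rw [one_nsmul] at hmγ
    exact hγ hmγ
  obtain ⟨d, hdE, hd⟩ := hmγ
  have hc : ∃ c ∈ E, ∃ δ : H, S.W c = δ ∧ (m - 1) • S.J γ ≤ δ := by
    rcases le_total γ 0 with h | h
    · refine ⟨1, one_mem E, 0, AddValuation.map_one _, ?_⟩
      rw [← map_nsmul, ← map_zero S.J, S.strictMono_J.le_iff_le]
      exact nsmul_nonpos h _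
    · refine ⟨d, hdE, _, hd, ?_⟩
      rw [← map_nsmul, S.strictMono_J.le_iff_le]
      exact nsmul_le_nsmul_left h (Nat.sub_le _ _)
  obtain ⟨c, hcE, δ, hcδ, hδ⟩ := hc
  have hc0 : c ≠ 0 := ne_zero_of_coe hcδ
  let f : Polynomial E := Polynomial.X ^ m +
    (Polynomial.C (⟨c, hcE⟩ : E) * Polynomial.X - Polynomial.C (⟨d, hdE⟩ : E))
  have hlow : (Polynomial.C (⟨c, hcE⟩ : E) * Polynomial.X - Polynomial.C (⟨d, hdE⟩ : E)).degree <
      (m : WithBot ℕ) :=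
    lt_of_le_of_lt (by compute_degree; simp) (by exact_mod_cast hm2 : ((1 : ℕ) : WithBot ℕ) < m)
  have hf : f.Monic := Polynomial.monic_X_pow_add hlow
  have hfdeg : f.natDegree = m := by
    refine Polynomial.natDegree_eq_of_degree_eq_some ?_
    rw [Polynomial.degree_add_eq_left_of_degree_lt (by rwa [Polynomial.degree_X_pow]),
      Polynomial.degree_X_pow]
  obtain ⟨b, hb⟩ := IsAlgClosed.exists_aeval_eq_zero Ω f (by
    rw [Polynomial.degree_eq_natDegree hf.ne_zero, hfdeg]
    exact_mod_cast hm0.ne')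
  have hbeq : b ^ m + (c * b - d) = 0 := by
    simpa [f] using hb
  have hb0 : b ≠ 0 := by
    rintro rfl
    rw [zero_pow hm0.ne', mul_zero, zero_add, zero_sub, neg_eq_zero] at hbeq
    exact ne_zero_of_coe hd hbeq
  obtain ⟨β, hβ⟩ := exists_coe_eq (v := S.W) hb0
  have hpow : S.W (b ^ m) = ((m • β : H) : WithTop H) := by
    rw [AddValuation.map_pow, hβ, WithTop.coe_nsmul]
  have hcb : S.W (c * b) = ((δ + β : H) : WithTop H) := by
    rw [AddValuation.map_mul, hcδ, hβ, WithTop.coe_add]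
  have hm1 : ∀ h : H, m • h = (m - 1) • h + h := fun h => by
    rw [← succ_nsmul, Nat.sub_add_cancel hm0]
  have hβγ : β = S.J γ := by
    rcases lt_trichotomy β (S.J γ) with h | h | h
    · exfalso
      have h1 : S.W (b ^ m) < S.W (d - c * b) := by
        refine lt_of_lt_of_le (lt_min ?_ ?_) (AddValuation.map_sub _ _ _)
        · rw [hpow, hd, WithTop.coe_lt_coe, map_nsmul]
          exact nsmul_lt_nsmul_right hm0.ne' h
        · rw [hpow, hcb, WithTop.coe_lt_coe, hm1]
          refine add_lt_add_left (lt_of_lt_of_le ?_ hδ) β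
          exact nsmul_lt_nsmul_right (by omega) h
      rw [show d - c * b = b ^ m by linear_combination -hbeq] at h1
      exact lt_irrefl _ h1
    · exact h
    · exfalso
      have h1 : S.W d < S.W (b ^ m + c * b) := by
        refine AddValuation.map_lt_add _ ?_ ?_
        · rw [hpow, hd, WithTop.coe_lt_coe, map_nsmul]
          exact nsmul_lt_nsmul_right hm0.ne' h
        · rw [hcb, hd, WithTop.coe_lt_coe, map_nsmul, hm1]
          exact add_lt_add_of_le_of_lt hδ h
      rw [show b ^ m + c * b = d by linear_combination hbeq] at h1
      exact lt_irrefl _ h1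
  subst hβγ
  have hterm : ∀ (e : E) (j : ℕ), (e : Ω) * b ^ j ≠ 0 →
      ∃ g ∈ S.valSub E, S.W ((e : Ω) * b ^ j) = (S.J (g + j • γ) : H) := by
    intro e j hne
    obtain ⟨g, hg⟩ := hE.val e e.2 (left_ne_zero_of_mul hne)
    refine ⟨g, ⟨e, e.2, hg⟩, ?_⟩
    rw [AddValuation.map_mul, AddValuation.map_pow, hg, hβ, map_add, map_nsmul, WithTop.coe_add,
      WithTop.coe_nsmul]
  have hind : ∀ (e : Fin f.natDegree → E) (j), S.W (∑ j, (e j : Ω) * b ^ (j : ℕ)) ≤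
      S.W ((e j : Ω) * b ^ (j : ℕ)) := by
    intro e
    refine sum_le_of_injective ?_
    intro j j' hne heq
    have hne' : (e j' : Ω) * b ^ (j' : ℕ) ≠ 0 := by
      rw [← AddValuation.ne_top_iff S.W, ← heq]
      exact (AddValuation.ne_top_iff S.W).2 hne
    obtain ⟨g, hg, h1⟩ := hterm _ _ hne
    obtain ⟨g', hg', h2⟩ := hterm _ _ hne'
    rw [h1, h2, WithTop.coe_inj, S.strictMono_J.injective.eq_iff] at heq
    have hjm : (j : ℕ) < m := hfdeg ▸ j.2
    have hjm' : (j' : ℕ) < m := hfdeg ▸ j'.2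
    rcases lt_trichotomy (j : ℕ) j' with h | h | h
    · exfalso
      refine hmin (j' - j) (by omega) (by omega) ?_
      have : ((j' : ℕ) - j) • γ = g - g' := by
        rw [sub_nsmul _ h.le, ← sub_eq_add_neg, sub_eq_sub_iff_add_eq_add]
        exact (add_comm _ _).trans heq.symm
      rw [this]
      exact sub_mem hg hg'
    · exact Fin.ext h
    · exfalso
      refine hmin (j - j') (by omega) (by omega) ?_
      have : ((j : ℕ) - j') • γ = g' - g := by
        rw [sub_nsmul _ h.le, ← sub_eq_add_neg, sub_eq_sub_iff_add_eq_add]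
        exact (add_comm _ _).trans heq
      rw [this]
      exact sub_mem hg' hg
  refine ⟨_, ?_, hE.adjoin hβ hf hb ?_ hind ?_, b, IntermediateField.mem_adjoin_simple_self E b, hβ⟩
  · exact fun x hx => (IntermediateField.adjoin E {b}).algebraMap_mem ⟨x, hx⟩
  · intro hder
    have h1 : (Polynomial.derivative f).coeff 0 = 0 := by rw [hder, Polynomial.coeff_zero]
    rw [Polynomial.coeff_derivative] at h1
    simp only [f, Polynomial.coeff_add, Polynomial.coeff_X_pow, Polynomial.coeff_sub,
      Polynomial.coeff_C_mul, Polynomial.coeff_X, Polynomial.coeff_C] at h1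
    rw [if_neg (by omega)] at h1
    simp at h1
    exact hc0 (congrArg Subtype.val h1)
  · intro e y hy
    have hj0 : 0 < f.natDegree := by omega
    have h1 : ∀ j, j ≠ ⟨0, hj0⟩ → 0 < S.W ((e j : Ω) * b ^ (j : ℕ)) := by
      intro j hj
      have h2 : 0 ≤ S.W ((e j : Ω) * b ^ (j : ℕ)) := by
        refine le_trans ?_ (hind e j)
        rw [← hy]
        exact y.2
      refine lt_of_le_of_ne h2 fun h3 => ?_
      have hne : (e j : Ω) * b ^ (j : ℕ) ≠ 0 := by
        rw [← AddValuation.ne_top_iff S.W, ← h3]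
        exact WithTop.zero_ne_top
      obtain ⟨g, hg, h4⟩ := hterm _ _ hne
      rw [← h3, ← WithTop.coe_zero, WithTop.coe_inj, ← map_zero S.J,
        S.strictMono_J.injective.eq_iff] at h4
      have hjpos : 0 < (j : ℕ) := Nat.pos_of_ne_zero fun h => hj (Fin.ext h)
      refine hmin j hjpos (hfdeg ▸ j.2) ?_
      rw [show (j : ℕ) • γ = -g from eq_neg_of_add_eq_zero_right h4.symm]
      exact neg_mem hg
    have h5 : 0 < S.W ((y : Ω) - e ⟨0, hj0⟩) := by
      rw [hy, ← Finset.add_sum_erase _ _ (Finset.mem_univ (⟨0, hj0⟩ : Fin f.natDegree))]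
      simp only [pow_zero, mul_one, add_sub_cancel_left]
      exact AddValuation.map_lt_sum _ WithTop.zero_ne_top fun j hj => h1 j (Finset.ne_of_mem_erase hj)
    have h6 : 0 ≤ S.W (e ⟨0, hj0⟩ : Ω) := by
      rw [show (e ⟨0, hj0⟩ : Ω) = y - (y - e ⟨0, hj0⟩) by ring]
      exact AddValuation.map_le_sub _ y.2 h5.le
    rw [(residue_eq_iff S.W y ⟨_, h6⟩).2 h5]
    exact hE.res _ (e ⟨0, hj0⟩).2

end Ambient

end PrescribedValuation

namespace PrescribedValuation

section Roots

variable {Ω : Type*} [Field Ω] {H : Type*} [AddCommGroup H] [LinearOrder H]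
  [IsOrderedAddMonoid H] {W : AddValuation Ω (WithTop H)}

/-- A monic polynomial with a small value at `z` has a root close to `z`. -/
theorem exists_root_close [IsAlgClosed Ω] {f : Polynomial Ω} (hf : f.Monic) {z : Ω}
    (hz : 0 < W (f.eval z)) : ∃ r, f.eval r = 0 ∧ 0 < W (z - r) := by
  by_contra! hcon
  have hroot : ∀ r ∈ f.roots, W (z - r) ≤ 0 := fun r hr =>
    hcon r (Polynomial.isRoot_of_mem_roots hr)
  rw [(IsAlgClosed.splits f).eval_eq_prod_roots_of_monic hf] at hz
  refine absurd hz (not_lt.2 ?_)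
  generalize f.roots = s at hroot
  induction s using Multiset.induction with
  | empty => simp
  | cons a s ih =>
    rw [Multiset.map_cons, Multiset.prod_cons, AddValuation.map_mul]
    exact add_nonpos (hroot a (Multiset.mem_cons_self a s))
      (ih fun r hr => hroot r (Multiset.mem_cons_of_mem hr))

end Roots

section Residues

variable {K : Type*} [Field K] {G : Type*} [AddCommGroup G] [LinearOrder G]
  [IsOrderedAddMonoid G] {v : AddValuation K (WithTop G)}

/-- If the residues of `b^j`, `j < n`, are linearly independent then the `b^j` form a valuation
independent family of elements of value `0`. -/
theorem sum_pow_le_of_linearIndependent {L : Type*} [Field L] [Algebra K L] {H : Type*}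
    [AddCommGroup H] [LinearOrder H] [IsOrderedAddMonoid H] {i : G →+ H}
    {w : AddValuation L (WithTop H)} (h : Extends i v w) (b : valRing w) (hb : w b = 0) {n : ℕ}
    (hli : ∀ g : Fin n → Residue v,
      ∑ j, h.residueMap (g j) * IsLocalRing.residue _ b ^ (j : ℕ) = 0 → ∀ j, g j = 0)
    (c : Fin n → K) (j : Fin n) :
    w (∑ j, algebraMap K L (c j) * (b : L) ^ (j : ℕ)) ≤
      w (algebraMap K L (c j) * (b : L) ^ (j : ℕ)) := by
  by_contra! hlt
  obtain ⟨j₀, -, hj₀⟩ := Finset.exists_min_image Finset.univ (fun j => v (c j))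
    ⟨j, Finset.mem_univ j⟩
  have hpow : ∀ (a : K) (m : ℕ), w (algebraMap K L a * (b : L) ^ m) = (v a).map i := by
    intro a m
    rw [AddValuation.map_mul, AddValuation.map_pow, hb, smul_zero, add_zero, h.restrict]
  have hlt' : w (algebraMap K L (c j₀)) < w (∑ j, algebraMap K L (c j) * (b : L) ^ (j : ℕ)) := by
    refine lt_of_le_of_lt ?_ hlt
    rw [hpow, h.restrict]
    exact (strictMono_map h.strictMono).monotone (hj₀ j (Finset.mem_univ j))
  have hc0 : c j₀ ≠ 0 := by
    intro h0
    rw [h0, map_zero, AddValuation.map_zero] at hlt'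
    exact not_top_lt hlt'
  have hd : ∀ j, 0 ≤ v (c j / c j₀) := by
    intro j
    have h1 := hj₀ j (Finset.mem_univ j)
    have h2 : v (c j) = v (c j / c j₀) + v (c j₀) := by
      rw [← AddValuation.map_mul, div_mul_cancel₀ _ hc0]
    obtain ⟨g, hg⟩ := exists_coe_eq (v := v) hc0
    simp only [h2, hg] at h1
    by_contra! h3
    exact absurd h1 (not_le.2 (by
      conv_rhs => rw [← zero_add (g : WithTop G)]
      exact WithTop.add_lt_add_right WithTop.coe_ne_top h3))
  have hsum := hli (fun j => IsLocalRing.residue _ (⟨c j / c j₀, hd j⟩ : valRing v)) (by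
    have e : ∑ j, h.residueMap (IsLocalRing.residue _ (⟨c j / c j₀, hd j⟩ : valRing v)) *
        IsLocalRing.residue _ b ^ (j : ℕ) = IsLocalRing.residue _
          (∑ j, h.ringMap ⟨c j / c j₀, hd j⟩ * b ^ (j : ℕ)) := by
      rw [map_sum]
      refine Finset.sum_congr rfl fun j _ => ?_
      rw [map_mul, map_pow, h.residueMap_residue]
    rw [e, residue_eq_zero_iff]
    have e2 : ((∑ j, h.ringMap ⟨c j / c j₀, hd j⟩ * b ^ (j : ℕ) : valRing w) : L) =
        (∑ j, algebraMap K L (c j) * (b : L) ^ (j : ℕ)) / algebraMap K L (c j₀) := by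
      rw [Finset.sum_div]
      push_cast
      refine Finset.sum_congr rfl fun j _ => ?_
      rw [h.coe_ringMap, map_div₀]
      ring
    rw [e2]
    have hc0' : algebraMap K L (c j₀) ≠ 0 := (map_ne_zero _).2 hc0
    obtain ⟨g, hg⟩ := exists_coe_eq (v := w) hc0'
    have e3 : w (∑ j, algebraMap K L (c j) * (b : L) ^ (j : ℕ)) =
        w ((∑ j, algebraMap K L (c j) * (b : L) ^ (j : ℕ)) / algebraMap K L (c j₀)) +
          w (algebraMap K L (c j₀)) := by
      rw [← AddValuation.map_mul, div_mul_cancel₀ _ hc0']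
    rw [e3] at hlt'
    by_contra! h3
    refine absurd hlt' (not_lt.2 ?_)
    conv_rhs => rw [← zero_add (w (algebraMap K L (c j₀)))]
    exact add_le_add_left h3 _) j₀
  rw [residue_eq_zero_iff] at hsum
  change 0 < v (c j₀ / c j₀) at hsum
  rw [div_self hc0, AddValuation.map_one] at hsum
  exact lt_irrefl _ hsum

end Residues

namespace Ambient

variable {K : Type*} [Field K] {G : Type*} [AddCommGroup G] [LinearOrder G]
  [IsOrderedAddMonoid G] {v : AddValuation K (WithTop G)} {Γ : Type*} [AddCommGroup Γ]
  [LinearOrder Γ] [IsOrderedAddMonoid Γ] {ι : G →+ Γ} {k : Type*} [Field k]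
  [Algebra (Residue v) k] {Ω : Type*} [Field Ω] [Algebra K Ω] {H : Type*} [AddCommGroup H]
  [LinearOrder H] [IsOrderedAddMonoid H] {S : Ambient v ι k Ω H}

theorem Good.exists_res (hv : ∃ π : K, π ≠ 0 ∧ 0 < v π)
    (halg : Algebra.IsAlgebraic (Residue v) k) [IsAlgClosed Ω] {E : IntermediateField K Ω}
    (hE : S.Good E) (ζ : k) : ∃ E', E ≤ E' ∧ S.Good E' ∧ ζ ∈ S.resSub E' := by
  by_cases hζ : ζ ∈ S.resSub E
  · exact ⟨E, le_rfl, hE, hζ⟩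
  let w : AddValuation E (WithTop H) := S.W.comap (algebraMap E Ω)
  have hw : Extends (AddMonoidHom.id H) w S.W :=
    ⟨strictMono_id, fun a => by
      change S.W (a : Ω) = (S.W (a : Ω)).map id
      rw [WithTop.map_id]
      rfl⟩
  have hvw : Extends S.i v w := ⟨S.ext.strictMono, fun a => S.ext.restrict a⟩
  let _ : Algebra (Residue w) (Residue S.W) := hw.residueMap.toAlgebra
  have hint : IsIntegral (Residue w) (S.jk ζ) := by
    obtain ⟨p, hp, hpζ⟩ := (halg.isAlgebraic ζ).isIntegral
    refine ⟨p.map hvw.residueMap, hp.map _, ?_⟩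
    rw [Polynomial.eval₂_map]
    have e : (algebraMap (Residue w) (Residue S.W)).comp hvw.residueMap =
        S.jk.comp (algebraMap (Residue v) k) := by
      ext z
      obtain ⟨a, rfl⟩ := IsLocalRing.residue_surjective z
      rw [RingHom.comp_apply, RingHom.comp_apply, S.jk_algebraMap, S.ext.residueMap_residue,
        hvw.residueMap_residue]
      rfl
    rw [e, ← Polynomial.hom_eval₂, hpζ, map_zero]
  obtain ⟨f₀, hf₀, hf₀deg, hf₀m⟩ := Polynomial.lifts_and_natDegree_eq_and_monic
    (f := IsLocalRing.residue (valRing w))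
    ((Polynomial.mem_lifts _).2 (Polynomial.map_surjective _ IsLocalRing.residue_surjective
      (minpoly (Residue w) (S.jk ζ)))) (minpoly.monic hint)
  have hdeg2 : 2 ≤ f₀.natDegree := by
    rw [hf₀deg]
    by_contra! hlt
    have h1 : (minpoly (Residue w) (S.jk ζ)).natDegree = 1 := by
      have := minpoly.natDegree_pos hint
      omega
    obtain ⟨z, hz⟩ := minpoly.natDegree_eq_one_iff.1 h1
    obtain ⟨a, rfl⟩ := IsLocalRing.residue_surjective z
    exact hζ ⟨hw.ringMap a, (a : E).2, hz⟩
  obtain ⟨π, hπ0, hπ⟩ := hv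
  have hπw : 0 < w (algebraMap K E π) := by
    rw [hvw.restrict]
    exact (map_pos_iff S.ext.strictMono _).2 hπ
  have hF : ∃ F : Polynomial (valRing w), F.Monic ∧ F.natDegree = f₀.natDegree ∧
      F.map (IsLocalRing.residue (valRing w)) = minpoly (Residue w) (S.jk ζ) ∧
      (Polynomial.derivative (F.map (valRing w).subtype)) ≠ 0 := by
    by_cases hder : Polynomial.derivative (f₀.map (valRing w).subtype) = 0
    · have hlow : (Polynomial.C (⟨_, hπw.le⟩ : valRing w) * Polynomial.X).degree < f₀.degree := by
        rw [Polynomial.degree_eq_natDegree hf₀m.ne_zero]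
        refine lt_of_le_of_lt (Polynomial.degree_C_mul_X_le _) ?_
        exact_mod_cast hdeg2
      refine ⟨f₀ + Polynomial.C (⟨_, hπw.le⟩ : valRing w) * Polynomial.X,
        hf₀m.add_of_left hlow, ?_, ?_, ?_⟩
      · exact Polynomial.natDegree_eq_natDegree (Polynomial.degree_add_eq_left_of_degree_lt hlow)
      · rw [Polynomial.map_add, hf₀, Polynomial.map_mul, Polynomial.map_C,
          (residue_eq_zero_iff w _).2 hπw, Polynomial.C_0, zero_mul, add_zero]
      · rw [Polynomial.map_add, Polynomial.derivative_add, hder, zero_add, Polynomial.map_mul,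
          Polynomial.map_C, Polynomial.map_X, Polynomial.derivative_C_mul_X]
        exact Polynomial.C_ne_zero.2 ((map_ne_zero (algebraMap K E)).2 hπ0)
    · exact ⟨f₀, hf₀m, rfl, hf₀, hder⟩
  obtain ⟨F, hFm, hFdeg, hFres, hFder⟩ := hF
  obtain ⟨z, hz⟩ := IsLocalRing.residue_surjective (S.jk ζ)
  have hFz : 0 < S.W (((F.map (valRing w).subtype).map (algebraMap E Ω)).eval (z : Ω)) := by
    have e1 : ((F.map (valRing w).subtype).map (algebraMap E Ω)).eval (z : Ω) =
        ((F.map hw.ringMap).eval z : valRing S.W) := by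
      rw [Polynomial.map_map, Polynomial.eval_map, Polynomial.eval_map]
      exact (Polynomial.hom_eval₂ F hw.ringMap (valRing S.W).subtype z).symm
    rw [e1, ← residue_eq_zero_iff, Polynomial.eval_map, Polynomial.hom_eval₂, hz]
    have e2 : (IsLocalRing.residue (valRing S.W)).comp hw.ringMap =
        (algebraMap (Residue w) (Residue S.W)).comp (IsLocalRing.residue (valRing w)) := rfl
    rw [e2, ← Polynomial.eval₂_map, hFres]
    exact minpoly.aeval _ _
  obtain ⟨b, hb, hbz⟩ := exists_root_close ((hFm.map _).map _) hFz
  have hbint : 0 ≤ S.W b := by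
    rw [show b = z - (z - b) by ring]
    exact AddValuation.map_le_sub _ z.2 hbz.le
  have hbres : IsLocalRing.residue _ (⟨b, hbint⟩ : valRing S.W) = S.jk ζ := by
    rw [← hz, eq_comm, residue_eq_iff]
    exact hbz
  have hb0 : S.W b = 0 := by
    refine le_antisymm ?_ hbint
    by_contra! h
    have h1 := (residue_eq_zero_iff S.W ⟨b, hbint⟩).2 h
    rw [hbres, map_eq_zero] at h1
    exact hζ (h1 ▸ zero_mem _)
  have hdegE : (F.map (valRing w).subtype).natDegree = (minpoly (Residue w) (S.jk ζ)).natDegree := by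
    rw [hFm.natDegree_map, hFdeg, hf₀deg]
  have hli : ∀ g : Fin (F.map (valRing w).subtype).natDegree → Residue w,
      ∑ j, hw.residueMap (g j) * IsLocalRing.residue _ (⟨b, hbint⟩ : valRing S.W) ^ (j : ℕ) = 0 →
        ∀ j, g j = 0 := by
    rw [hdegE, hbres]
    intro g hg
    refine Fintype.linearIndependent_iff.1 (linearIndependent_pow (K := Residue w) (S.jk ζ)) g ?_
    simp only [Algebra.smul_def]
    exact hg
  have hind := sum_pow_le_of_linearIndependent hw ⟨b, hbint⟩ hb0 hli
  have hbE : Polynomial.aeval b (F.map (valRing w).subtype) = 0 := by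
    rw [Polynomial.aeval_def, ← Polynomial.eval_map]
    exact hb
  refine ⟨_, ?_, hE.adjoin (γ := 0) ?_ (hFm.map _) hbE hFder hind ?_, ⟨b, hbint⟩,
    IntermediateField.mem_adjoin_simple_self E b, hbres⟩
  · exact fun x hx => (IntermediateField.adjoin E {b}).algebraMap_mem ⟨x, hx⟩
  · rw [hb0, map_zero]
    rfl
  · intro c y hy
    have hc : ∀ j, 0 ≤ S.W (c j : Ω) := by
      intro j
      have h1 := hind c j
      rw [AddValuation.map_mul _ (algebraMap E Ω (c j)), AddValuation.map_pow, hb0, smul_zero,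
        add_zero] at h1
      refine le_trans ?_ h1
      refine le_trans y.2 (le_of_eq ?_)
      rw [hy]
      rfl
    have e : y = ∑ j, (⟨c j, hc j⟩ : valRing S.W) * ⟨b, hbint⟩ ^ (j : ℕ) := by
      refine Subtype.ext ?_
      push_cast
      exact hy
    rw [e, map_sum]
    refine sum_mem fun j _ => ?_
    rw [map_mul, map_pow, hbres]
    exact mul_mem (hE.res _ (c j).2) (pow_mem (RingHom.mem_range_self S.jk ζ) _)

end Ambient

end PrescribedValuation

namespace PrescribedValuation

open Polynomial IntermediateField

section CoeffBound

variable {K : Type*} [Field K] {M : Type*} [Field M] [Algebra K M] {H : Type*} [AddCommGroup H]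
  [LinearOrder H] [IsOrderedAddMonoid H]

/-- The coefficients of an element of `K(a)` with respect to the basis of powers of `a` are bounded
in terms of the value of the element, up to the constant `r`. -/
def CoeffBound (w : AddValuation M (WithTop H)) (a : M) (r : K) : Prop :=
  ∀ f : K[X], f.degree < (minpoly K a).degree → ∀ j,
    w (aeval a f) ≤ w (algebraMap K M (r * f.coeff j))

theorem exists_poly_of_mem_adjoin {a : M} (ha : IsIntegral K a) {x : M} (hx : x ∈ K⟮a⟯) :
    ∃ f : K[X], f.degree < (minpoly K a).degree ∧ aeval a f = x := by
  rw [← mem_toSubalgebra, adjoin_simple_toSubalgebra_of_isAlgebraic ha.isAlgebraic,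
    Algebra.adjoin_singleton_eq_range_aeval] at hx
  obtain ⟨p, rfl⟩ := hx
  refine ⟨p %ₘ minpoly K a, degree_modByMonic_lt _ (minpoly.monic ha), ?_⟩
  change _ = aeval a p
  rw [← modByMonic_add_div p (minpoly K a), map_add, map_mul, minpoly.aeval, zero_mul, add_zero,
    modByMonic_add_div p (minpoly K a)]

theorem eq_of_aeval_eq {a : M} {f g : K[X]} (hf : f.degree < (minpoly K a).degree)
    (hg : g.degree < (minpoly K a).degree) (h : aeval a f = aeval a g) : f = g := by
  rw [← sub_eq_zero]
  by_contra hne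
  refine absurd (minpoly.degree_le_of_ne_zero K a hne (by rw [map_sub, h, sub_self])) (not_le.2 ?_)
  exact lt_of_le_of_lt (degree_sub_le _ _) (max_lt hf hg)

theorem CoeffBound.mono {w : AddValuation M (WithTop H)} {a : M} {r r' : K}
    (h : CoeffBound w a r) (hr : w (algebraMap K M r) ≤ w (algebraMap K M r')) :
    CoeffBound w a r' := fun f hf j => (h f hf j).trans (by
      rw [map_mul (algebraMap K M), map_mul (algebraMap K M), AddValuation.map_mul,
        AddValuation.map_mul]
      exact add_le_add_left hr _)

theorem CoeffBound.of_strictMono {w : AddValuation M (WithTop H)} {M' : Type*} [Field M']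
    [Algebra K M'] {H' : Type*} [AddCommGroup H'] [LinearOrder H'] [IsOrderedAddMonoid H']
    {w' : AddValuation M' (WithTop H')} {J : H →+ H'} (hJ : StrictMono J) (τ : M →ₐ[K] M')
    (h : ∀ x, (w x).map J = w' (τ x)) {a : M} {r : K} :
    CoeffBound w a r ↔ CoeffBound w' (τ a) r := by
  unfold CoeffBound
  rw [minpoly.algHom_eq τ τ.toRingHom.injective]
  refine forall₃_congr fun f _ j => ?_
  rw [← (strictMono_map hJ).le_iff_le, h, h, ← τ.commutes, aeval_algHom_apply]

/-- Polynomials of degree smaller than `[K(a) : K]` take asymptotically equal values at `a` and at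
points close to `a`. -/
theorem CoeffBound.aeval_add {w : AddValuation M (WithTop H)} {a : M} {r : K}
    (hr : CoeffBound w a r) (ha : 0 ≤ w a) {h : M} (h0 : 0 ≤ w h)
    (hrh : w (algebraMap K M r) < w h) {f : K[X]} (hf : f.degree < (minpoly K a).degree)
    (hf0 : f ≠ 0) : w (aeval a f) < w (aeval a f - aeval (a + h) f) := by
  have hfa : aeval a f ≠ 0 := fun h1 => hf0 (eq_of_aeval_eq hf (by
    rw [degree_zero]
    exact lt_of_le_of_lt bot_le hf) (by rw [h1, map_zero]))
  rw [AddValuation.map_sub_swap]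
  have e : aeval (a + h) f - aeval a f =
      ∑ j ∈ Finset.range (f.natDegree + 1), algebraMap K M (f.coeff j) * ((a + h) ^ j - a ^ j) := by
    rw [aeval_eq_sum_range, aeval_eq_sum_range, ← Finset.sum_sub_distrib]
    exact Finset.sum_congr rfl fun j _ => by
      rw [Algebra.smul_def, Algebra.smul_def, mul_sub]
  rw [e]
  refine AddValuation.map_lt_sum _ ((AddValuation.ne_top_iff w).2 hfa) fun j _ => ?_
  by_cases hj : f.coeff j = 0
  · rw [hj, map_zero, zero_mul, AddValuation.map_zero]
    exact WithTop.lt_top_iff_ne_top.2 ((AddValuation.ne_top_iff w).2 hfa)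
  have hah : 0 ≤ w (a + h) := AddValuation.map_le_add _ ha h0
  obtain ⟨q, hq⟩ := sub_dvd_pow_sub_pow (⟨a + h, hah⟩ : valRing w) ⟨a, ha⟩ j
  have hq' : (a + h) ^ j - a ^ j = h * q := by
    have := congrArg Subtype.val hq
    push_cast at this
    rw [this]
    congr 1
    exact add_sub_cancel_left a h
  refine lt_of_le_of_lt (hr f hf j) ?_
  rw [hq', map_mul, AddValuation.map_mul, AddValuation.map_mul, AddValuation.map_mul, add_comm]
  refine WithTop.add_lt_add_left ((AddValuation.ne_top_iff w).2 ((_root_.map_ne_zero _).2 hj))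
    (lt_of_lt_of_le hrh ?_)
  exact le_add_of_nonneg_right q.2

end CoeffBound

theorem exists_max_val {K : Type*} [Field K] {G : Type*} [AddCommGroup G] [LinearOrder G]
    [IsOrderedAddMonoid G] (v : AddValuation K (WithTop G)) {κ : Type*} [Finite κ] (r : κ → K)
    (hr : ∀ p, r p ≠ 0) : ∃ s : K, s ≠ 0 ∧ 0 ≤ v s ∧ ∀ p, v (r p) ≤ v s := by
  obtain ⟨p, hp⟩ := Finite.exists_max (fun p : Option κ => v (p.elim 1 r))
  refine ⟨p.elim 1 r, ?_, ?_, fun q => hp (some q)⟩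
  · cases p with
    | none => exact one_ne_zero
    | some p => exact hr p
  · simpa using hp none

section Primitive

variable {K : Type*} [Field K] {Ω : Type*} [Field Ω] [Algebra K Ω]

/-- If `a ∈ E` and `E | K` is finite separable, infinitely many constants yield a primitive
element of the form `a + c d`. -/
theorem exists_primitive_add {E : IntermediateField K Ω} [FiniteDimensional K E]
    [Algebra.IsSeparable K E] {a : Ω} (ha : a ∈ E) :
    ∃ d ∈ E, ∀ c : ℕ → K, Function.Injective c → ∃ n, K⟮a + algebraMap K Ω (c n) * d⟯ = E := by
  obtain ⟨d, hd⟩ := Field.exists_primitive_element K E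
  refine ⟨d, d.2, fun c hc => ?_⟩
  have : Finite (IntermediateField K E) :=
    Field.exists_primitive_element_iff_finite_intermediateField K E |>.1 ⟨inferInstance, d, hd⟩
  obtain ⟨m, n, hmn, heq⟩ := Finite.exists_ne_map_eq_of_infinite
    (fun n => K⟮(⟨a, ha⟩ : E) + algebraMap K E (c n) * d⟯)
  refine ⟨m, ?_⟩
  have htop : K⟮(⟨a, ha⟩ : E) + algebraMap K E (c m) * d⟯ = ⊤ := by
    rw [eq_top_iff, ← hd, adjoin_simple_le_iff]
    have h1 := mem_adjoin_simple_self K ((⟨a, ha⟩ : E) + algebraMap K E (c m) * d)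
    have h2 := mem_adjoin_simple_self K ((⟨a, ha⟩ : E) + algebraMap K E (c n) * d)
    change K⟮_⟯ = K⟮_⟯ at heq
    rw [← heq] at h2
    have h3 := sub_mem h1 h2
    rw [add_sub_add_left_eq_sub, ← sub_mul, ← map_sub] at h3
    have h4 := mul_mem (IntermediateField.algebraMap_mem _ (c m - c n)⁻¹) h3
    rwa [← mul_assoc, ← map_mul, inv_mul_cancel₀ (sub_ne_zero.2 fun h => hmn (hc h)), map_one,
      one_mul] at h4
  have h5 := congrArg IntermediateField.lift htop
  rw [lift_adjoin_simple, lift_top] at h5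
  exact h5

end Primitive

namespace Ambient

variable {K : Type*} [Field K] {G : Type*} [AddCommGroup G] [LinearOrder G]
  [IsOrderedAddMonoid G] {v : AddValuation K (WithTop G)} {Γ : Type*} [AddCommGroup Γ]
  [LinearOrder Γ] [IsOrderedAddMonoid Γ] {ι : G →+ Γ} {k : Type*} [Field k]
  [Algebra (Residue v) k] {Ω : Type*} [Field Ω] [Algebra K Ω] {H : Type*} [AddCommGroup H]
  [LinearOrder H] [IsOrderedAddMonoid H] {S : Ambient v ι k Ω H}

theorem le_iff (S : Ambient v ι k Ω H) (a b : K) :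
    S.W (algebraMap K Ω a) ≤ S.W (algebraMap K Ω b) ↔ v a ≤ v b := by
  rw [S.ext.restrict, S.ext.restrict, (strictMono_map S.ext.strictMono).le_iff_le]

theorem exists_le_val (S : Ambient v ι k Ω H) (hv : Function.Surjective v)
    (htors : IsAddTorsion (Γ ⧸ ι.range)) (g : Γ) :
    ∃ c : K, c ≠ 0 ∧ (S.J g : WithTop H) ≤ S.W (algebraMap K Ω c) := by
  rcases le_total g 0 with h | h
  · refine ⟨1, one_ne_zero, ?_⟩
    rw [map_one, AddValuation.map_one, ← WithTop.coe_zero, WithTop.coe_le_coe, ← map_zero S.J,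
      S.strictMono_J.le_iff_le]
    exact h
  · obtain ⟨n, hn, g', hg'⟩ := exists_nsmul_mem_range htors g
    obtain ⟨c, hc⟩ := hv (g' : WithTop G)
    refine ⟨c, ne_zero_of_coe hc, ?_⟩
    rw [S.ext.restrict, hc, WithTop.map_coe, ← S.J_ι, WithTop.coe_le_coe,
      S.strictMono_J.le_iff_le, hg']
    exact le_self_nsmul h hn.ne'

theorem Good.isIntegral {E : IntermediateField K Ω} (hE : S.Good E) {a : Ω} (ha : a ∈ E) :
    IsIntegral K a := by
  have := hE.finite
  exact (IntermediateField.isIntegral_iff (x := (⟨a, ha⟩ : E))).1 (IsIntegral.of_finite K _)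

theorem Good.exists_coeffBound (hv : Function.Surjective v)
    (htors : IsAddTorsion (Γ ⧸ ι.range)) {a : Ω} (hE : S.Good K⟮a⟯) :
    ∃ r : K, r ≠ 0 ∧ 0 ≤ v r ∧ CoeffBound S.W a r := by
  have hint := hE.isIntegral (mem_adjoin_simple_self K a)
  obtain ⟨κ, _, β, hβ, hspan, hle⟩ := hE.basis
  choose p hpdeg hp using fun i => exists_poly_of_mem_adjoin hint (hβ i)
  have hr : ∀ q : κ × Fin (minpoly K a).natDegree, ∃ r : K, r ≠ 0 ∧
      S.W (β q.1) ≤ S.W (algebraMap K Ω (r * (p q.1).coeff q.2)) := by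
    rintro ⟨i, j⟩
    simp only
    by_cases h0 : (p i).coeff j = 0
    · exact ⟨1, one_ne_zero, by rw [h0, mul_zero, map_zero, AddValuation.map_zero]; exact le_top⟩
    · have hβ0 : β i ≠ 0 := by
        intro h1
        have : p i = 0 := eq_of_aeval_eq (hpdeg i) (by
          rw [degree_zero]
          exact lt_of_le_of_lt bot_le (hpdeg i)) (by rw [hp, h1, map_zero])
        rw [this, coeff_zero] at h0
        exact h0 rfl
      obtain ⟨g, hg⟩ := hE.val _ (hβ i) hβ0
      obtain ⟨c, hc0, hc⟩ := S.exists_le_val hv htors g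
      refine ⟨c / (p i).coeff j, div_ne_zero hc0 h0, ?_⟩
      rwa [div_mul_cancel₀ _ h0, hg]
  choose r hr0 hr using hr
  obtain ⟨s, hs0, hs1, hs⟩ := exists_max_val v r hr0
  refine ⟨s, hs0, hs1, fun f hf j => ?_⟩
  have hmem : aeval a f ∈ K⟮a⟯ := by
    rw [← mem_toSubalgebra, adjoin_simple_toSubalgebra_of_isAlgebraic hint.isAlgebraic,
      Algebra.adjoin_singleton_eq_range_aeval]
    exact ⟨f, rfl⟩
  obtain ⟨c, hc⟩ := hspan _ hmem
  have hsum : f = ∑ i, C (c i) * p i := by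
    refine eq_of_aeval_eq hf ?_ ?_
    · refine lt_of_le_of_lt (degree_sum_le _ _) ?_
      rw [Finset.sup_lt_iff (lt_of_le_of_lt bot_le hf)]
      exact fun i _ => by
        rw [← smul_eq_C_mul]
        exact lt_of_le_of_lt (degree_smul_le _ _) (hpdeg i)
    · rw [hc, map_sum]
      exact Finset.sum_congr rfl fun i _ => by rw [map_mul, aeval_C, hp]
  by_cases hj : j < (minpoly K a).natDegree
  · have e : algebraMap K Ω (s * f.coeff j) =
        ∑ i, algebraMap K Ω (c i) * algebraMap K Ω (s * (p i).coeff j) := by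
      conv_lhs => rw [hsum]
      rw [finsetSum_coeff, Finset.mul_sum, map_sum]
      refine Finset.sum_congr rfl fun i _ => ?_
      rw [coeff_C_mul, ← map_mul]
      congr 1
      ring
    rw [e]
    refine AddValuation.map_le_sum _ fun i _ => ?_
    have h1 := hle c i
    rw [← hc] at h1
    refine h1.trans ?_
    rw [AddValuation.map_mul, AddValuation.map_mul]
    refine add_le_add_right ((hr (i, ⟨j, hj⟩)).trans ?_) _
    rw [map_mul (algebraMap K Ω), map_mul (algebraMap K Ω), AddValuation.map_mul,
        AddValuation.map_mul]
    exact add_le_add_left ((S.le_iff _ _).2 (hs _)) _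
  · rw [coeff_eq_zero_of_degree_lt, mul_zero, map_zero, AddValuation.map_zero]
    · exact le_top
    · refine lt_of_lt_of_le hf ?_
      rw [degree_eq_natDegree (minpoly.ne_zero hint)]
      exact_mod_cast not_lt.1 hj

theorem good_bot (S : Ambient v ι k Ω H) : S.Good ⊥ := by
  refine ⟨inferInstance, inferInstance, ⟨Unit, inferInstance, fun _ => 1, fun _ => one_mem _, ?_, ?_⟩,
    ?_, ?_⟩
  · intro x hx
    obtain ⟨a, rfl⟩ := mem_bot.1 hx
    exact ⟨fun _ => a, by simp⟩
  · intro c j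
    simp
  · intro x hx hx0
    obtain ⟨a, rfl⟩ := mem_bot.1 hx
    obtain ⟨g, hg⟩ := exists_coe_eq (v := v) (a := a) (by rintro rfl; simp at hx0)
    exact ⟨ι g, by rw [S.ext.restrict, hg, S.J_ι]; rfl⟩
  · intro y hy
    obtain ⟨a, ha⟩ := mem_bot.1 hy
    have h0 : 0 ≤ v a := by
      rw [← S.ext.nonneg_iff, ha]
      exact y.2
    refine ⟨algebraMap _ _ (IsLocalRing.residue _ (⟨a, h0⟩ : valRing v)), ?_⟩
    rw [S.jk_algebraMap, S.ext.residueMap_residue]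
    congr 1
    exact Subtype.ext ha

/-- Integral elements `a` generating a good extension, together with a coefficient bound. -/
structure Approx (S : Ambient v ι k Ω H) (a : Ω) (r : K) : Prop where
  good : S.Good K⟮a⟯
  nonneg : 0 ≤ S.W a
  ne_zero : r ≠ 0
  nonneg_r : 0 ≤ v r
  bound : CoeffBound S.W a r

theorem exists_approx (S : Ambient v ι k Ω H) (hv : Function.Surjective v)
    (htors : IsAddTorsion (Γ ⧸ ι.range)) : ∃ r : K, S.Approx 0 r := by
  have h : S.Good K⟮(0 : Ω)⟯ := by
    rw [adjoin_zero]
    exact S.good_bot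
  obtain ⟨r, hr0, hr1, hr⟩ := h.exists_coeffBound hv htors
  exact ⟨r, h, by rw [AddValuation.map_zero]; exact le_top, hr0, hr1, hr⟩

theorem Approx.exists_next (hv : Function.Surjective v) (htors : IsAddTorsion (Γ ⧸ ι.range))
    (halg : Algebra.IsAlgebraic (Residue v) k) [IsAlgClosed Ω] {π : K} (hπ0 : π ≠ 0) (hπ : 0 < v π)
    {a : Ω} {r : K} (h : S.Approx a r) (γ : Γ) (ζ : k) :
    ∃ a' r', S.Approx a' r' ∧ K⟮a⟯ ≤ K⟮a'⟯ ∧ γ ∈ S.valSub K⟮a'⟯ ∧ ζ ∈ S.resSub K⟮a'⟯ ∧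
      S.W (algebraMap K Ω (π * r)) ≤ S.W (a' - a) ∧ v r ≤ v r' := by
  obtain ⟨E₁, hE₁, hg₁, hγ⟩ := h.good.exists_val hv htors γ
  obtain ⟨E, hE, hg, hζ⟩ := hg₁.exists_res ⟨π, hπ0, hπ⟩ halg ζ
  replace hγ := valSub_mono hE hγ
  replace hE := hE₁.trans hE
  have haE : a ∈ E := hE (mem_adjoin_simple_self K a)
  have := hg.finite
  have := hg.separable
  obtain ⟨d, hdE, hd⟩ := exists_primitive_add haE
  obtain ⟨c, hc0, hc⟩ : ∃ c : K, c ≠ 0 ∧ 0 ≤ S.W (algebraMap K Ω c * d) := by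
    by_cases hd0 : d = 0
    · exact ⟨1, one_ne_zero, by rw [hd0, mul_zero, AddValuation.map_zero]; exact le_top⟩
    · obtain ⟨g, hg⟩ := hg.val d hdE hd0
      obtain ⟨c, hc0, hc⟩ := S.exists_le_val hv htors (-g)
      refine ⟨c, hc0, ?_⟩
      rw [AddValuation.map_mul, hg]
      refine le_trans (le_of_eq ?_) (add_le_add_left hc _)
      rw [← WithTop.coe_add, map_neg, neg_add_cancel]
      rfl
  obtain ⟨n, hn⟩ := hd (fun n => c * (π * r) * π ^ n) (by
    intro m n hmn
    have h1 := mul_left_cancel₀ (mul_ne_zero hc0 (mul_ne_zero hπ0 h.ne_zero)) hmn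
    have h2 := congrArg v h1
    obtain ⟨g, hg⟩ := exists_coe_eq (v := v) hπ0
    rw [AddValuation.map_pow, AddValuation.map_pow, hg, ← WithTop.coe_nsmul, ← WithTop.coe_nsmul,
      WithTop.coe_inj] at h2
    rw [hg] at hπ
    exact (nsmul_left_strictMono (WithTop.coe_pos.1 hπ)).injective h2)
  have hW : S.W (algebraMap K Ω (π * r)) ≤ S.W (algebraMap K Ω (c * (π * r) * π ^ n) * d) := by
    rw [show algebraMap K Ω (c * (π * r) * π ^ n) * d = algebraMap K Ω (π * r) *
      ((algebraMap K Ω c * d) * algebraMap K Ω (π ^ n)) by rw [map_mul, map_mul]; ring]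
    rw [AddValuation.map_mul]
    refine le_add_of_nonneg_right ?_
    rw [AddValuation.map_mul]
    refine add_nonneg hc ?_
    rw [S.ext.nonneg_iff, AddValuation.map_pow]
    exact nsmul_nonneg hπ.le n
  rw [← hn] at hg hE hγ hζ
  obtain ⟨s, hs0, hs1, hs⟩ := hg.exists_coeffBound hv htors
  have hπr : 0 ≤ v (π * r) := by
    rw [AddValuation.map_mul]
    exact add_nonneg hπ.le h.nonneg_r
  refine ⟨_, s * r, ⟨hg, AddValuation.map_le_add _ h.nonneg (le_trans ?_ hW),
    mul_ne_zero hs0 h.ne_zero, ?_, hs.mono ((S.le_iff _ _).2 ?_)⟩, hE, hγ, hζ, ?_, ?_⟩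
  · rwa [S.ext.nonneg_iff]
  · rw [AddValuation.map_mul]
    exact add_nonneg hs1 h.nonneg_r
  · rw [AddValuation.map_mul]
    exact le_add_of_nonneg_right h.nonneg_r
  · rw [add_sub_cancel_left]
    exact hW
  · rw [AddValuation.map_mul]
    exact le_add_of_nonneg_left hs1

end Ambient

end PrescribedValuation

namespace PrescribedValuation

open Polynomial IntermediateField

theorem exists_seq_of_groupCountablyGenerated {G Γ : Type*} [AddCommGroup G] [AddCommGroup Γ]
    {ι : G →+ Γ} (h : GroupCountablyGenerated (Γ ⧸ ι.range)) :
    ∃ γ : ℕ → Γ, ∀ A : AddSubgroup Γ, ι.range ≤ A → (∀ n, γ n ∈ A) → A = ⊤ := by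
  obtain ⟨T, hT, hcl⟩ := h
  obtain ⟨f, hf⟩ := (hT.insert 0).exists_eq_range (Set.insert_nonempty _ _)
  choose γ hγ using fun n => QuotientAddGroup.mk_surjective (f n)
  refine ⟨γ, fun A hA hmem => ?_⟩
  have h1 : A.map (QuotientAddGroup.mk' ι.range) = ⊤ := by
    rw [eq_top_iff, ← hcl, AddSubgroup.closure_le]
    intro t ht
    have : t ∈ Set.range f := hf ▸ Set.mem_insert_of_mem _ ht
    obtain ⟨n, rfl⟩ := this
    exact ⟨γ n, hmem n, hγ n⟩
  rw [eq_top_iff]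
  intro g _
  have h2 : QuotientAddGroup.mk' ι.range g ∈ A.map (QuotientAddGroup.mk' ι.range) :=
    h1 ▸ AddSubgroup.mem_top _
  obtain ⟨g', hg', he⟩ := h2
  have h3 := (QuotientAddGroup.eq).1 he
  rw [show g = g' + (-g' + g) by abel]
  exact add_mem hg' (hA h3)

theorem exists_seq_of_fieldCountablyGenerated {F k : Type*} [Field F] [Field k] [Algebra F k]
    (h : FieldCountablyGenerated F k) :
    ∃ ζ : ℕ → k, ∀ A : IntermediateField F k, (∀ n, ζ n ∈ A) → A = ⊤ := by
  obtain ⟨T, hT, hcl⟩ := h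
  obtain ⟨f, hf⟩ := (hT.insert 0).exists_eq_range (Set.insert_nonempty _ _)
  refine ⟨f, fun A hmem => ?_⟩
  rw [eq_top_iff, ← hcl, adjoin_le_iff]
  intro t ht
  have : t ∈ Set.range f := hf ▸ Set.mem_insert_of_mem _ ht
  obtain ⟨n, rfl⟩ := this
  exact hmem n

theorem groupCountablyGenerated_of_finite (A : Type*) [AddCommGroup A] [Finite A] :
    GroupCountablyGenerated A :=
  ⟨Set.univ, Set.countable_univ, by simp⟩

theorem fieldCountablyGenerated_of_finite (F k : Type*) [Field F] [Field k] [Algebra F k]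
    [FiniteDimensional F k] : FieldCountablyGenerated F k := by
  refine ⟨Set.range (Module.finBasis F k), Set.countable_range _, ?_⟩
  rw [eq_top_iff]
  intro x _
  rw [← (Module.finBasis F k).sum_repr x]
  exact sum_mem fun i _ => IntermediateField.smul_mem _ (subset_adjoin F _ (Set.mem_range_self i))

namespace Ambient

variable {K : Type*} [Field K] {G : Type*} [AddCommGroup G] [LinearOrder G]
  [IsOrderedAddMonoid G] {v : AddValuation K (WithTop G)} {Γ : Type*} [AddCommGroup Γ]
  [LinearOrder Γ] [IsOrderedAddMonoid Γ] {ι : G →+ Γ} {k : Type*} [Field k]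
  [Algebra (Residue v) k] {Ω : Type*} [Field Ω] [Algebra K Ω] {H : Type*} [AddCommGroup H]
  [LinearOrder H] [IsOrderedAddMonoid H] {S : Ambient v ι k Ω H}

/-- An approximating sequence `a n` such that the values and residues of the fields `K(a n)`
exhaust the given sequences. -/
structure Chain (S : Ambient v ι k Ω H) (π : K) (γ : ℕ → Γ) (ζ : ℕ → k) (a : ℕ → Ω)
    (r : ℕ → K) : Prop where
  approx : ∀ n, S.Approx (a n) (r n)
  le_succ : ∀ n, K⟮a n⟯ ≤ K⟮a (n + 1)⟯
  val : ∀ n, γ n ∈ S.valSub K⟮a (n + 1)⟯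
  res : ∀ n, ζ n ∈ S.resSub K⟮a (n + 1)⟯
  close_succ : ∀ n, S.W (algebraMap K Ω (π * r n)) ≤ S.W (a (n + 1) - a n)
  r_succ : ∀ n, v (r n) ≤ v (r (n + 1))

theorem exists_chain (S : Ambient v ι k Ω H) (hv : Function.Surjective v)
    (htors : IsAddTorsion (Γ ⧸ ι.range)) (halg : Algebra.IsAlgebraic (Residue v) k)
    [IsAlgClosed Ω] {π : K} (hπ0 : π ≠ 0) (hπ : 0 < v π) (γ : ℕ → Γ) (ζ : ℕ → k) :
    ∃ a r, S.Chain π γ ζ a r := by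
  obtain ⟨r₀, hr₀⟩ := S.exists_approx hv htors
  have hstep : ∀ (n : ℕ) (s : {p : Ω × K // S.Approx p.1 p.2}),
      ∃ s' : {p : Ω × K // S.Approx p.1 p.2}, K⟮s.1.1⟯ ≤ K⟮s'.1.1⟯ ∧ γ n ∈ S.valSub K⟮s'.1.1⟯ ∧
        ζ n ∈ S.resSub K⟮s'.1.1⟯ ∧ S.W (algebraMap K Ω (π * s.1.2)) ≤ S.W (s'.1.1 - s.1.1) ∧
        v s.1.2 ≤ v s'.1.2 := by
    rintro n ⟨⟨a, r⟩, h⟩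
    obtain ⟨a', r', h', hs⟩ := h.exists_next hv htors halg hπ0 hπ (γ n) (ζ n)
    exact ⟨⟨(a', r'), h'⟩, hs⟩
  choose next hnext using hstep
  let s : ℕ → {p : Ω × K // S.Approx p.1 p.2} := fun n => Nat.rec ⟨(0, r₀), hr₀⟩ next n
  exact ⟨fun n => (s n).1.1, fun n => (s n).1.2, fun n => (s n).2, fun n => (hnext n (s n)).1,
    fun n => (hnext n (s n)).2.1, fun n => (hnext n (s n)).2.2.1,
    fun n => (hnext n (s n)).2.2.2.1, fun n => (hnext n (s n)).2.2.2.2⟩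

namespace Chain

variable {π : K} {γ : ℕ → Γ} {ζ : ℕ → k} {a : ℕ → Ω} {r : ℕ → K}

theorem monotone (h : S.Chain π γ ζ a r) : Monotone fun n => K⟮a n⟯ :=
  monotone_nat_of_le_succ h.le_succ

theorem close (h : S.Chain π γ ζ a r) {m n : ℕ} (hmn : m ≤ n) :
    S.W (algebraMap K Ω (π * r m)) ≤ S.W (a n - a m) := by
  induction n, hmn using Nat.le_induction with
  | base =>
    rw [sub_self, AddValuation.map_zero]
    exact le_top
  | succ n hmn ih =>
    rw [← sub_add_sub_cancel (a (n + 1)) (a n) (a m)]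
    refine AddValuation.map_le_add _ (le_trans ?_ (h.close_succ n)) ih
    rw [S.le_iff, AddValuation.map_mul, AddValuation.map_mul]
    exact add_le_add_right ((monotone_nat_of_le_succ h.r_succ) hmn) _

theorem mem_iSup (h : S.Chain π γ ζ a r) {x : Ω} :
    x ∈ ⨆ n, K⟮a n⟯ ↔ ∃ n, x ∈ K⟮a n⟯ := by
  rw [← SetLike.mem_coe, IntermediateField.coe_iSup_of_directed h.monotone.directed_le]
  simp

end Chain

/-- `N` has exactly the values in `Γ` and the residues in `k`. -/
structure Full (S : Ambient v ι k Ω H) (N : IntermediateField K Ω) : Prop where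
  val : ∀ x ∈ N, x ≠ 0 → ∃ g : Γ, S.W x = (S.J g : H)
  res : ∀ y : valRing S.W, (y : Ω) ∈ N → IsLocalRing.residue _ y ∈ S.jk.range
  valSub_eq : S.valSub N = ⊤
  resSub_eq : S.resSub N = ⊤

theorem Chain.full_iSup {π : K} {γ : ℕ → Γ} {ζ : ℕ → k} {a : ℕ → Ω} {r : ℕ → K}
    (h : S.Chain π γ ζ a r) (hv : Function.Surjective v)
    (hγ : ∀ A : AddSubgroup Γ, ι.range ≤ A → (∀ n, γ n ∈ A) → A = ⊤)
    (hζ : ∀ A : IntermediateField (Residue v) k, (∀ n, ζ n ∈ A) → A = ⊤) :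
    S.Full (⨆ n, K⟮a n⟯) where
  val x hx hx0 := by
    obtain ⟨n, hn⟩ := h.mem_iSup.1 hx
    exact (h.approx n).good.val x hn hx0
  res y hy := by
    obtain ⟨n, hn⟩ := h.mem_iSup.1 hy
    exact (h.approx n).good.res y hn
  valSub_eq := hγ _ (range_le_valSub hv _) fun n =>
    valSub_mono (le_iSup (fun n => K⟮a n⟯) (n + 1)) (h.val n)
  resSub_eq := hζ _ fun n => resSub_mono (le_iSup (fun n => K⟮a n⟯) (n + 1)) (h.res n)

theorem Good.full {E : IntermediateField K Ω} (h : S.Good E) (h1 : S.valSub E = ⊤)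
    (h2 : S.resSub E = ⊤) : S.Full E :=
  ⟨h.val, h.res, h1, h2⟩

theorem Chain.exists_full {π : K} {γ : ℕ → Γ} {ζ : ℕ → k} {a : ℕ → Ω} {r : ℕ → K}
    (h : S.Chain π γ ζ a r) (hv : Function.Surjective v) (hN : S.Full (⨆ n, K⟮a n⟯))
    [Finite (Γ ⧸ ι.range)] [FiniteDimensional (Residue v) k] : ∃ n, S.Full K⟮a n⟯ := by
  have h1 : ∀ g : Γ, ∃ n, g ∈ S.valSub K⟮a n⟯ := by
    intro g
    have : g ∈ S.valSub (⨆ n, K⟮a n⟯) := hN.valSub_eq ▸ AddSubgroup.mem_top g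
    obtain ⟨x, hx, hg⟩ := this
    obtain ⟨n, hn⟩ := h.mem_iSup.1 hx
    exact ⟨n, x, hn, hg⟩
  have h2 : ∀ z : k, ∃ n, z ∈ S.resSub K⟮a n⟯ := by
    intro z
    have : z ∈ S.resSub (⨆ n, K⟮a n⟯) := hN.resSub_eq ▸ IntermediateField.mem_top
    obtain ⟨x, hx, hg⟩ := this
    obtain ⟨n, hn⟩ := h.mem_iSup.1 hx
    exact ⟨n, x, hn, hg⟩
  choose n₁ hn₁ using h1
  choose n₂ hn₂ using h2
  obtain ⟨m₁, hm₁⟩ := (Set.finite_range fun q : Γ ⧸ ι.range => n₁ q.out).bddAbove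
  obtain ⟨m₂, hm₂⟩ := (Set.finite_range fun j => n₂ (Module.finBasis (Residue v) k j)).bddAbove
  refine ⟨max m₁ m₂, (h.approx _).good.full ?_ ?_⟩
  · rw [eq_top_iff]
    intro g _
    have h3 : ((QuotientAddGroup.mk g : Γ ⧸ ι.range).out) ∈ S.valSub K⟮a (max m₁ m₂)⟯ :=
      valSub_mono (h.monotone ((hm₁ ⟨_, rfl⟩).trans (le_max_left _ _))) (hn₁ _)
    obtain ⟨t, ht⟩ := QuotientAddGroup.mk_out_eq_add ι.range g
    rw [show g = (QuotientAddGroup.mk g : Γ ⧸ ι.range).out - t by rw [ht]; abel]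
    exact sub_mem h3 (range_le_valSub hv _ t.2)
  · rw [eq_top_iff]
    intro z _
    rw [← (Module.finBasis (Residue v) k).sum_repr z]
    refine sum_mem fun j _ => IntermediateField.smul_mem _ ?_
    exact resSub_mono (h.monotone ((hm₂ ⟨j, rfl⟩).trans (le_max_right _ _))) (hn₂ _)

theorem Good.finite_quotient {E : IntermediateField K Ω} (hE : S.Good E)
    (h : S.valSub E = ⊤) : Finite (Γ ⧸ ι.range) := by
  obtain ⟨κ, _, β, hβ, hspan, hle⟩ := hE.basis
  have hβγ : ∀ j, ∃ g : Γ, β j ≠ 0 → S.W (β j) = (S.J g : H) := by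
    intro j
    by_cases h0 : β j = 0
    · exact ⟨0, fun h1 => absurd h0 h1⟩
    · obtain ⟨g, hg⟩ := hE.val _ (hβ j) h0
      exact ⟨g, fun _ => hg⟩
  choose g hg using hβγ
  refine Finite.of_surjective (fun j => (QuotientAddGroup.mk (g j) : Γ ⧸ ι.range)) fun q => ?_
  obtain ⟨γ, rfl⟩ := QuotientAddGroup.mk_surjective q
  have : γ ∈ S.valSub E := h ▸ AddSubgroup.mem_top γ
  obtain ⟨x, hx, hxγ⟩ := this
  obtain ⟨c, rfl⟩ := hspan x hx
  obtain ⟨j, hj⟩ := exists_eq_of_le_sum (ne_zero_of_coe hxγ) (hle c)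
  refine ⟨j, ?_⟩
  have hne : algebraMap K Ω (c j) * β j ≠ 0 := ne_zero_of_coe (hj.symm.trans hxγ)
  have hc0 : c j ≠ 0 := fun h0 => hne (by rw [h0, map_zero, zero_mul])
  obtain ⟨δ, hδ⟩ := exists_coe_eq (v := v) hc0
  rw [hxγ, AddValuation.map_mul, hg j (right_ne_zero_of_mul hne), S.ext.restrict, hδ,
    WithTop.map_coe, ← S.J_ι, ← WithTop.coe_add, WithTop.coe_inj, ← map_add,
    S.strictMono_J.injective.eq_iff] at hj
  refine (QuotientAddGroup.eq).2 ⟨δ, ?_⟩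
  rw [hj]
  abel

theorem Good.finiteDimensional_residue {E : IntermediateField K Ω} (hE : S.Good E)
    (h : S.resSub E = ⊤) : FiniteDimensional (Residue v) k := by
  classical
  obtain ⟨κ, _, β, hβ, hspan, hle⟩ := hE.basis
  have hnorm : ∀ j, ∃ (z : k), ∀ c : K, 0 ≤ S.W (algebraMap K Ω c * β j) →
      ∃ (s : Residue v) (y : valRing S.W), (y : Ω) = algebraMap K Ω c * β j ∧
        IsLocalRing.residue _ y = S.jk (s • z) := by
    intro j
    by_cases hj : ∃ c : K, S.W (algebraMap K Ω c * β j) = 0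
    · obtain ⟨c₀, hc₀⟩ := hj
      have hmem : algebraMap K Ω c₀ * β j ∈ E := mul_mem (E.algebraMap_mem _) (hβ j)
      obtain ⟨z, hz⟩ := hE.res ⟨_, hc₀.ge⟩ hmem
      have hc₀0 : c₀ ≠ 0 := by
        rintro rfl
        rw [map_zero, zero_mul, AddValuation.map_zero] at hc₀
        exact WithTop.top_ne_zero hc₀
      refine ⟨z, fun c hc => ?_⟩
      have e : algebraMap K Ω c * β j =
          algebraMap K Ω (c / c₀) * (algebraMap K Ω c₀ * β j) := by
        rw [← mul_assoc, ← map_mul, div_mul_cancel₀ _ hc₀0]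
      have hcc : 0 ≤ v (c / c₀) := by
        rw [← S.ext.nonneg_iff]
        rw [e, AddValuation.map_mul, hc₀, add_zero] at hc
        exact hc
      refine ⟨IsLocalRing.residue _ (⟨_, hcc⟩ : valRing v), S.ext.ringMap ⟨_, hcc⟩ *
        (⟨algebraMap K Ω c₀ * β j, hc₀.ge⟩ : valRing S.W),
        e.symm, ?_⟩
      rw [map_mul, ← hz, Algebra.smul_def, map_mul, S.jk_algebraMap, S.ext.residueMap_residue]
    · refine ⟨0, fun c hc => ⟨0, ⟨_, hc⟩, rfl, ?_⟩⟩
      rw [smul_zero, map_zero, residue_eq_zero_iff]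
      exact lt_of_le_of_ne hc fun h0 => hj ⟨c, h0.symm⟩
  choose z hz using hnorm
  refine Module.Finite.of_surjective (Fintype.linearCombination (Residue v) z) fun t => ?_
  have : t ∈ S.resSub E := h ▸ IntermediateField.mem_top
  obtain ⟨y, hyE, hy⟩ := this
  obtain ⟨c, hc⟩ := hspan y hyE
  have hc0 : ∀ j, 0 ≤ S.W (algebraMap K Ω (c j) * β j) := fun j => by
    refine le_trans ?_ (hle c j)
    rw [← hc]
    exact y.2
  choose s x hx hxs using fun j => hz j (c j) (hc0 j)
  refine ⟨s, S.jk.injective ?_⟩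
  rw [Fintype.linearCombination_apply, map_sum, ← hy]
  have e : y = ∑ j, x j := by
    refine Subtype.ext ?_
    push_cast
    rw [hc]
    exact Finset.sum_congr rfl fun j _ => (hx j).symm
  rw [e, map_sum]
  exact Finset.sum_congr rfl fun j _ => (hxs j).symm

theorem Chain.exists_degree_lt {π : K} {γ : ℕ → Γ} {ζ : ℕ → k} {a : ℕ → Ω} {r : ℕ → K}
    (h : S.Chain π γ ζ a r) (hN : S.Full (⨆ n, K⟮a n⟯))
    (hinf : Infinite (Γ ⧸ ι.range) ∨ ¬ FiniteDimensional (Residue v) k) (d : ℕ) :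
    ∃ n, d < (minpoly K (a n)).natDegree := by
  by_contra! hle
  have hfr : ∀ n, Module.finrank K K⟮a n⟯ ≤ d := fun n => by
    rw [adjoin.finrank ((h.approx n).good.isIntegral (mem_adjoin_simple_self K _))]
    exact hle n
  obtain ⟨n₀, hn₀⟩ : ∃ n₀, ∀ n, Module.finrank K K⟮a n⟯ ≤ Module.finrank K K⟮a n₀⟯ := by
    have hfin : (Set.range fun n => Module.finrank K K⟮a n⟯).Finite :=
      (Set.finite_Iic d).subset (by rintro _ ⟨n, rfl⟩; exact hfr n)
    obtain ⟨_, ⟨n₀, rfl⟩, hmax⟩ := hfin.exists_maximal (Set.range_nonempty _)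
    refine ⟨n₀, fun n => ?_⟩
    by_contra! hlt
    exact absurd (hmax ⟨n, rfl⟩ hlt.le) (not_le.2 hlt)
  have heq : (⨆ n, K⟮a n⟯) = K⟮a n₀⟯ := by
    refine le_antisymm (iSup_le fun n => ?_) (le_iSup (fun n => K⟮a n⟯) n₀)
    have := (h.approx (max n n₀)).good.finite
    have h1 : K⟮a n₀⟯ = K⟮a (max n n₀)⟯ :=
      IntermediateField.eq_of_le_of_finrank_le (h.monotone (le_max_right _ _)) (hn₀ _)
    rw [h1]
    exact h.monotone (le_max_left _ _)
  rw [heq] at hN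
  rcases hinf with h1 | h1
  · have := (h.approx n₀).good.finite_quotient hN.valSub_eq
    exact not_finite (Γ ⧸ ι.range)
  · exact h1 ((h.approx n₀).good.finiteDimensional_residue hN.resSub_eq)

end Ambient

end PrescribedValuation

namespace PrescribedValuation

open Polynomial IntermediateField

section RationalFunctions

variable {K : Type*} [Field K] {M : Type*} [Field M] [Algebra K M] {H : Type*} [AddCommGroup H]
  [LinearOrder H] [IsOrderedAddMonoid H] {w : AddValuation M (WithTop H)}

theorem aeval_mem_of_mem {N : IntermediateField K M} {x : M} (hx : x ∈ N) (f : K[X]) :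
    aeval x f ∈ N := by
  rw [aeval_eq_sum_range]
  exact sum_mem fun i _ => IntermediateField.smul_mem _ (pow_mem hx i)

/-- The embedding of the rational function field sending the variable to a transcendental
element. -/
noncomputable def ratEval {x : M} (hx : Transcendental K x) : RatFunc K →ₐ[K] M :=
  RatFunc.liftAlgHom (aeval x) (nonZeroDivisors_le_comap_nonZeroDivisors_of_injective _
    (transcendental_iff_injective.1 hx))

theorem ratEval_div {x : M} (hx : Transcendental K x) (p q : K[X]) :
    ratEval hx (algebraMap K[X] (RatFunc K) p / algebraMap K[X] (RatFunc K) q) =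
      aeval x p / aeval x q :=
  RatFunc.liftAlgHom_apply_div _ _ _ _

theorem ratEval_algebraMap {x : M} (hx : Transcendental K x) (p : K[X]) :
    ratEval hx (algebraMap K[X] (RatFunc K) p) = aeval x p := by
  have := ratEval_div hx p 1
  rwa [map_one, div_one, map_one, div_one] at this

theorem exists_approx_ratEval {x : M} (hx : Transcendental K x) {N : Subfield M}
    (h : ∀ f : K[X], f ≠ 0 → ∃ e ∈ N, w (aeval x f) < w (aeval x f - e)) {u : RatFunc K}
    (hu : u ≠ 0) : ∃ e ∈ N, w (ratEval hx u) < w (ratEval hx u - e) := by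
  obtain ⟨e₁, he₁, h₁⟩ := h u.num (RatFunc.num_ne_zero hu)
  obtain ⟨e₂, he₂, h₂⟩ := h u.denom u.denom_ne_zero
  refine ⟨e₁ / e₂, div_mem he₁ he₂, ?_⟩
  rw [← RatFunc.num_div_denom u, ratEval_div]
  exact lt_sub_div h₁ h₂

end RationalFunctions

namespace Ambient

variable {K : Type*} [Field K] {G : Type*} [AddCommGroup G] [LinearOrder G]
  [IsOrderedAddMonoid G] {v : AddValuation K (WithTop G)} {Γ : Type*} [AddCommGroup Γ]
  [LinearOrder Γ] [IsOrderedAddMonoid Γ] {ι : G →+ Γ} {k : Type*} [Field k]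
  [Algebra (Residue v) k] {Ω : Type*} [Field Ω] [Algebra K Ω] {H : Type*} [AddCommGroup H]
  [LinearOrder H] [IsOrderedAddMonoid H] {S : Ambient v ι k Ω H}

theorem Full.hasExtension (hι : StrictMono ι) {N : IntermediateField K Ω} (hN : S.Full N) {x : Ω}
    (hx : Transcendental K x)
    (t1 : ∀ f : K[X], f ≠ 0 → ∃ e ∈ N, S.W (aeval x f) < S.W (aeval x f - e))
    (t2 : ∀ e ∈ N, e ≠ 0 → ∃ f : K[X], S.W e < S.W (e - aeval x f)) :
    HasExtension v (RatFunc K) ι k := by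
  obtain ⟨w, h, hs, hφ, -⟩ := exists_extension_of_approx hι S.ext (ratEval hx) S.strictMono_J S.J_ι
    S.jk S.jk_algebraMap N hN.val (fun g => S.mem_valSub.1 (hN.valSub_eq ▸ AddSubgroup.mem_top g))
    hN.res (fun z => S.mem_resSub.1 (hN.resSub_eq ▸ IntermediateField.mem_top))
    (fun u hu => exists_approx_ratEval (N := N.toSubfield) hx t1 hu)
    (fun e he he0 => by
      obtain ⟨f, hf⟩ := t2 e he he0
      exact ⟨algebraMap K[X] (RatFunc K) f, by rwa [ratEval_algebraMap]⟩)
  exact ⟨w, h, hs, hφ⟩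

/-- Enlarging the ambient valued field. -/
noncomputable def trans (S : Ambient v ι k Ω H) {M : Type*} [Field M] [Algebra K M] [Algebra Ω M]
    [IsScalarTower K Ω M] {H' : Type*} [AddCommGroup H'] [LinearOrder H'] [IsOrderedAddMonoid H']
    {i' : H →+ H'} {W' : AddValuation M (WithTop H')} (h : Extends i' S.W W') :
    Ambient v ι k M H' where
  i := i'.comp S.i
  W := W'
  ext := ⟨h.strictMono.comp S.ext.strictMono, fun a => by
    rw [IsScalarTower.algebraMap_apply K Ω M, h.restrict, S.ext.restrict, WithTop.map_map]
    rfl⟩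
  J := i'.comp S.J
  strictMono_J := h.strictMono.comp S.strictMono_J
  J_ι := fun g => congrArg i' (S.J_ι g)
  jk := h.residueMap.comp S.jk
  jk_algebraMap := fun z => by
    rw [RingHom.comp_apply, S.jk_algebraMap]
    obtain ⟨a, rfl⟩ := IsLocalRing.residue_surjective z
    rw [S.ext.residueMap_residue, h.residueMap_residue]
    refine congrArg (IsLocalRing.residue _) (Subtype.ext ?_)
    exact (IsScalarTower.algebraMap_apply K Ω M (a : K)).symm

theorem Full.map {N : IntermediateField K Ω} (hN : S.Full N) {M : Type*} [Field M] [Algebra K M]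
    [Algebra Ω M] [IsScalarTower K Ω M] {H' : Type*} [AddCommGroup H'] [LinearOrder H']
    [IsOrderedAddMonoid H'] {i' : H →+ H'} {W' : AddValuation M (WithTop H')}
    (h : Extends i' S.W W') : (S.trans h).Full (N.map (IsScalarTower.toAlgHom K Ω M)) where
  val := by
    rintro _ ⟨x, hx, rfl⟩ hx0
    obtain ⟨g, hg⟩ := hN.val x hx (by rintro rfl; exact hx0 (map_zero _))
    refine ⟨g, ?_⟩
    change W' (algebraMap Ω M x) = _
    rw [h.restrict, hg]
    rfl
  res := by
    rintro ⟨_, hy0⟩ ⟨x, hx, rfl⟩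
    have h0 : 0 ≤ S.W x := (h.nonneg_iff x).1 hy0
    obtain ⟨z, hz⟩ := hN.res ⟨x, h0⟩ hx
    refine ⟨z, ?_⟩
    change h.residueMap (S.jk z) = _
    rw [hz, h.residueMap_residue]
    rfl
  valSub_eq := by
    rw [eq_top_iff]
    intro g _
    have : g ∈ S.valSub N := hN.valSub_eq ▸ AddSubgroup.mem_top g
    obtain ⟨x, hx, hg⟩ := this
    refine ⟨algebraMap Ω M x, ⟨x, hx, rfl⟩, ?_⟩
    change W' (algebraMap Ω M x) = _
    rw [h.restrict, hg]
    rfl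
  resSub_eq := by
    rw [eq_top_iff]
    intro z _
    have : z ∈ S.resSub N := hN.resSub_eq ▸ IntermediateField.mem_top
    obtain ⟨y, hy, hz⟩ := this
    refine ⟨h.ringMap y, ⟨y, hy, rfl⟩, ?_⟩
    change _ = h.residueMap (S.jk z)
    rw [← hz, h.residueMap_residue]
    rfl

end Ambient

section PseudoLimit

variable {Ω : Type*} [Field Ω] {H : Type*} [AddCommGroup H] [LinearOrder H]
  [IsOrderedAddMonoid H] {W : AddValuation Ω (WithTop H)}

/-- A pseudo-convergent sequence has a limit in a suitable valuation of the rational function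
field. -/
theorem exists_pseudoLimit {Ω : Type uL} [Field Ω] {W : AddValuation Ω (WithTop H)}
    (hW : Function.Surjective W) (a t : ℕ → Ω) (ht : ∀ n, t n ≠ 0)
    (hat : ∀ m n, m ≤ n → W (t m) ≤ W (a n - a m)) :
    ∃ (H' : Type uL) (_ : AddCommGroup H') (_ : LinearOrder H') (_ : IsOrderedAddMonoid H')
      (i' : H →+ H') (W' : AddValuation (RatFunc Ω) (WithTop H')), Extends i' W W' ∧
      ∀ m, W' (algebraMap Ω (RatFunc Ω) (t m)) ≤
        W' (RatFunc.X - algebraMap Ω (RatFunc Ω) (a m)) := by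
  let A' : Subring (Polynomial Ω) :=
    { carrier := {p | ∃ N, ∀ j, N ≤ j → 0 ≤ W (p.eval (a j))}
      mul_mem' := by
        rintro p q ⟨N, hN⟩ ⟨N', hN'⟩
        refine ⟨max N N', fun j hj => ?_⟩
        rw [eval_mul, AddValuation.map_mul]
        exact add_nonneg (hN j ((le_max_left _ _).trans hj)) (hN' j ((le_max_right _ _).trans hj))
      one_mem' := ⟨0, fun j _ => by rw [eval_one, AddValuation.map_one]⟩
      add_mem' := by
        rintro p q ⟨N, hN⟩ ⟨N', hN'⟩
        refine ⟨max N N', fun j hj => ?_⟩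
        rw [eval_add]
        exact AddValuation.map_le_add _ (hN j ((le_max_left _ _).trans hj))
          (hN' j ((le_max_right _ _).trans hj))
      zero_mem' := ⟨0, fun j _ => by rw [eval_zero, AddValuation.map_zero]; exact le_top⟩
      neg_mem' := by
        rintro p ⟨N, hN⟩
        exact ⟨N, fun j hj => by rw [eval_neg, AddValuation.map_neg]; exact hN j hj⟩ }
  let A : Subring (RatFunc Ω) := A'.map (algebraMap (Polynomial Ω) (RatFunc Ω))
  have hA : ∀ c : Ω, 0 ≤ W c → algebraMap Ω (RatFunc Ω) c ∈ A := fun c hc =>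
    ⟨C c, ⟨0, fun j _ => by rwa [eval_C]⟩, rfl⟩
  let I : Ideal A :=
    { carrier := {y | ∃ p : (Polynomial Ω), algebraMap (Polynomial Ω) (RatFunc Ω) p = y ∧
        ∃ N, ∀ j, N ≤ j → 0 < W (p.eval (a j))}
      add_mem' := by
        rintro x y ⟨p, hp, N, hN⟩ ⟨q, hq, N', hN'⟩
        refine ⟨p + q, by rw [map_add, hp, hq]; rfl, max N N', fun j hj => ?_⟩
        rw [eval_add]
        exact AddValuation.map_lt_add _ (hN j ((le_max_left _ _).trans hj))
          (hN' j ((le_max_right _ _).trans hj))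
      zero_mem' := ⟨0, by rw [map_zero]; rfl, 0, fun j _ => by
        rw [eval_zero, AddValuation.map_zero]
        exact WithTop.top_pos⟩
      smul_mem' := by
        rintro ⟨_, p, ⟨N, hN⟩, rfl⟩ y ⟨q, hq, N', hN'⟩
        refine ⟨p * q, by rw [map_mul, hq]; rfl, max N N', fun j hj => ?_⟩
        rw [eval_mul, AddValuation.map_mul]
        exact lt_of_lt_of_le (hN' j ((le_max_right _ _).trans hj))
          (le_add_of_nonneg_left (hN j ((le_max_left _ _).trans hj))) }
  have hI : I ≠ ⊤ := by
    rw [Ideal.ne_top_iff_one]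
    rintro ⟨p, hp, N, hN⟩
    have h1 : p = 1 := RatFunc.algebraMap_injective Ω (by rw [hp, map_one]; rfl)
    have h2 := hN N le_rfl
    rw [h1, eval_one, AddValuation.map_one] at h2
    exact lt_irrefl _ h2
  obtain ⟨H', i1, i2, i3, i', W', h, -, hAW⟩ := exists_extends_of_subring hW A hA I hI
    fun c hc => ⟨C c, rfl, 0, fun j _ => by rwa [eval_C]⟩
  refine ⟨H', i1, i2, i3, i', W', h, fun m => ?_⟩
  have h1 := hAW (algebraMap (Polynomial Ω) (RatFunc Ω) (C (t m)⁻¹ * (X - C (a m))))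
    ⟨_, ⟨m, fun j hj => by
      rw [eval_mul, eval_C, eval_sub, eval_X, eval_C, AddValuation.map_mul]
      obtain ⟨g, hg⟩ := exists_coe_eq (v := W) (inv_ne_zero (ht m))
      have h2 := add_le_add_right (hat m j hj) (W (t m)⁻¹)
      rwa [← AddValuation.map_mul, inv_mul_cancel₀ (ht m), AddValuation.map_one] at h2⟩, rfl⟩
  have h2 : RatFunc.X - algebraMap Ω (RatFunc Ω) (a m) = algebraMap Ω (RatFunc Ω) (t m) *
      algebraMap (Polynomial Ω) (RatFunc Ω) (C (t m)⁻¹ * (X - C (a m))) := by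
    rw [map_mul, RatFunc.algebraMap_C, map_sub, RatFunc.algebraMap_X, RatFunc.algebraMap_C,
      RatFunc.algebraMap_eq_C, ← mul_assoc, ← map_mul, mul_inv_cancel₀ (ht m), map_one, one_mul]
  rw [h2, AddValuation.map_mul]
  exact le_add_of_nonneg_right h1

end PseudoLimit

namespace Ambient

variable {K : Type*} [Field K] {G : Type*} [AddCommGroup G] [LinearOrder G]
  [IsOrderedAddMonoid G] {v : AddValuation K (WithTop G)} {Γ : Type*} [AddCommGroup Γ]
  [LinearOrder Γ] [IsOrderedAddMonoid Γ] {ι : G →+ Γ} {k : Type*} [Field k]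
  [Algebra (Residue v) k] {Ω : Type*} [Field Ω] [Algebra K Ω] {H : Type*} [AddCommGroup H]
  [LinearOrder H] [IsOrderedAddMonoid H] {S : Ambient v ι k Ω H}

theorem lt_mul_of_pos (S : Ambient v ι k Ω H) {π r : K} (hπ : 0 < v π) (hr : r ≠ 0) :
    S.W (algebraMap K Ω r) < S.W (algebraMap K Ω (π * r)) := by
  obtain ⟨g, hg⟩ := exists_coe_eq (v := S.W) ((map_ne_zero (algebraMap K Ω)).2 hr)
  rw [map_mul, AddValuation.map_mul, hg]
  conv_lhs => rw [← zero_add (g : WithTop H)]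
  refine WithTop.add_lt_add_right WithTop.coe_ne_top ?_
  rw [S.ext.restrict]
  exact (map_pos_iff S.ext.strictMono _).2 hπ

theorem Chain.hasExtension {π : K} (hπ0 : π ≠ 0) (hπ : 0 < v π) {γ : ℕ → Γ} {ζ : ℕ → k}
    {a : ℕ → Ω} {r : ℕ → K} (h : S.Chain π γ ζ a r) (hι : StrictMono ι)
    (hW : Function.Surjective S.W) (hN : S.Full (⨆ n, K⟮a n⟯))
    (hdeg : ∀ d, ∃ n, d < (minpoly K (a n)).natDegree) : HasExtension v (RatFunc K) ι k := by
  obtain ⟨H', _, _, _, i', W', hW', hlim⟩ := exists_pseudoLimit hW a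
    (fun n => algebraMap K Ω (π * r n))
    (fun n => (map_ne_zero (algebraMap K Ω)).2 (mul_ne_zero hπ0 (h.approx n).ne_zero))
    (fun m n hmn => h.close hmn)
  have hclose : ∀ n (f : K[X]), f.degree < (minpoly K (a n)).degree → f ≠ 0 →
      W' (algebraMap Ω (RatFunc Ω) (aeval (a n) f)) <
        W' (algebraMap Ω (RatFunc Ω) (aeval (a n) f) - aeval (RatFunc.X : RatFunc Ω) f) := by
    intro n f hf hf0
    have hap := h.approx n
    have hb : CoeffBound W' (IsScalarTower.toAlgHom K Ω (RatFunc Ω) (a n)) (r n) :=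
      (CoeffBound.of_strictMono hW'.strictMono (IsScalarTower.toAlgHom K Ω (RatFunc Ω))
        fun x => (hW'.restrict x).symm).1 hap.bound
    have h1 : W' (algebraMap K (RatFunc Ω) (r n)) <
        W' (RatFunc.X - algebraMap Ω (RatFunc Ω) (a n)) := by
      refine lt_of_lt_of_le ?_ (hlim n)
      rw [IsScalarTower.algebraMap_apply K Ω (RatFunc Ω), hW'.restrict, hW'.restrict]
      exact strictMono_map hW'.strictMono (S.lt_mul_of_pos hπ hap.ne_zero)
    have h2 : 0 ≤ W' (algebraMap K (RatFunc Ω) (r n)) :=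
      ((S.trans hW').ext.nonneg_iff (r n)).2 hap.nonneg_r
    have h3 := hb.aeval_add (h := RatFunc.X - algebraMap Ω (RatFunc Ω) (a n))
      ((hW'.nonneg_iff _).2 hap.nonneg) (h2.trans h1.le) h1
      (by rwa [minpoly.algHom_eq _ (IsScalarTower.toAlgHom K Ω (RatFunc Ω)).toRingHom.injective])
      hf0
    rw [aeval_algHom_apply] at h3
    change _ < W' (_ - aeval (algebraMap Ω (RatFunc Ω) (a n) + _) f) at h3
    rwa [add_sub_cancel] at h3
  have hdeg' : ∀ f : K[X], ∃ n, f.degree < (minpoly K (a n)).degree := by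
    intro f
    obtain ⟨n, hn⟩ := hdeg f.natDegree
    refine ⟨n, lt_of_le_of_lt degree_le_natDegree ?_⟩
    rw [degree_eq_natDegree (ne_zero_of_natDegree_gt hn)]
    exact_mod_cast hn
  have hx : Transcendental K (RatFunc.X : RatFunc Ω) := by
    rw [transcendental_iff]
    intro f hf
    by_contra hf0
    obtain ⟨n, hn⟩ := hdeg' f
    have := hclose n f hn hf0
    rw [hf, sub_zero] at this
    exact lt_irrefl _ this
  refine (hN.map hW').hasExtension hι hx ?_ ?_
  · intro f hf0
    obtain ⟨n, hn⟩ := hdeg' f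
    refine ⟨algebraMap Ω (RatFunc Ω) (aeval (a n) f), ⟨aeval (a n) f, h.mem_iSup.2 ⟨n, ?_⟩, rfl⟩,
      lt_sub_symm (hclose n f hn hf0)⟩
    exact aeval_mem_of_mem (mem_adjoin_simple_self K (a n)) f
  · rintro _ ⟨y, hy, rfl⟩ hy0
    obtain ⟨n, hn⟩ := h.mem_iSup.1 hy
    obtain ⟨f, hf, rfl⟩ := exists_poly_of_mem_adjoin
      ((h.approx n).good.isIntegral (mem_adjoin_simple_self K _)) hn
    refine ⟨f, hclose n f hf ?_⟩
    rintro rfl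
    rw [map_zero, map_zero] at hy0
    exact hy0 rfl

end Ambient

end PrescribedValuation

namespace PrescribedValuation

open Polynomial IntermediateField

section

variable {K : Type*} [Field K] {G : Type*} [AddCommGroup G] [LinearOrder G]
  [IsOrderedAddMonoid G] {v : AddValuation K (WithTop G)} {Γ : Type*} [AddCommGroup Γ]
  [LinearOrder Γ] [IsOrderedAddMonoid Γ] {ι : G →+ Γ} {k : Type*} [Field k]
  [Algebra (Residue v) k]

theorem exists_ambient (hι : StrictMono ι) (htors : IsAddTorsion (Γ ⧸ ι.range))
    (halg : Algebra.IsAlgebraic (Residue v) k) {L : Type uL} [Field L] [Algebra K L] {H₁ : Type*}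
    [AddCommGroup H₁] [LinearOrder H₁] [IsOrderedAddMonoid H₁] {u : AddValuation L (WithTop H₁)}
    (hu : Function.Surjective u) {ι₁ : G →+ H₁} (h : Extends ι₁ v u) :
    ∃ (H : Type uL) (_ : AddCommGroup H) (_ : LinearOrder H) (_ : IsOrderedAddMonoid H)
      (S : Ambient v ι k (AlgebraicClosure L) H) (i₁ : H₁ →+ H),
      Extends i₁ u S.W ∧ Function.Surjective S.W := by
  obtain ⟨H, _, _, _, i₁, W, hW, hWs⟩ := exists_extends hu (AlgebraicClosure L)
  have hi : StrictMono (i₁.comp ι₁) := hW.strictMono.comp h.strictMono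
  obtain ⟨J, hJ, hJι⟩ := exists_strictMono_extension hWs hι htors hi
  have hvW : Extends (i₁.comp ι₁) v W := ⟨hi, fun a => by
    rw [IsScalarTower.algebraMap_apply K L, hW.restrict, h.restrict, WithTop.map_map]
    rfl⟩
  have : IsAlgClosed (Residue W) := isAlgClosed_residue
  let _ : Algebra (Residue v) (Residue W) := hvW.residueMap.toAlgebra
  let jk : k →ₐ[Residue v] Residue W := IsAlgClosed.lift
  exact ⟨H, _, _, _, ⟨_, W, hvW, J, hJ, hJι, jk, fun z => jk.commutes z⟩, i₁, hW, hWs⟩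

theorem exists_ambient_self {K : Type uK} [Field K] {v : AddValuation K (WithTop G)}
    [Algebra (Residue v) k] (hv : Function.Surjective v) (hι : StrictMono ι)
    (htors : IsAddTorsion (Γ ⧸ ι.range)) (halg : Algebra.IsAlgebraic (Residue v) k) :
    ∃ (H : Type uK) (_ : AddCommGroup H) (_ : LinearOrder H) (_ : IsOrderedAddMonoid H)
      (S : Ambient v ι k (AlgebraicClosure K) H), Function.Surjective S.W := by
  have hid : Extends (AddMonoidHom.id G) v v :=
    ⟨strictMono_id, fun a => by
      change v a = (v a).map id
      rw [WithTop.map_id]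
      rfl⟩
  obtain ⟨H, _, _, _, S, -, -, hS⟩ := exists_ambient (k := k) hι htors halg hv hid
  exact ⟨H, _, _, _, S, hS⟩

theorem exists_pos_of_not_trivial (h : ¬ IsTrivialVal v) : ∃ π : K, π ≠ 0 ∧ 0 < v π := by
  unfold IsTrivialVal at h
  push Not at h
  obtain ⟨a, ha, hne⟩ := h
  rcases lt_or_gt_of_ne hne with h1 | h1
  · refine ⟨a⁻¹, inv_ne_zero ha, ?_⟩
    obtain ⟨g, hg⟩ := exists_coe_eq (v := v) ha
    rw [AddValuation.map_inv, hg]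
    rw [hg, ← WithTop.coe_zero, WithTop.coe_lt_coe] at h1
    exact WithTop.coe_lt_coe.2 (neg_pos.2 h1)
  · exact ⟨a, ha, h1⟩

end

theorem transcendental_add_mul {K Ω : Type*} [Field K] [Field Ω] [Algebra K Ω] {a y : Ω} {d : K}
    (ha : IsAlgebraic K a) (hd : d ≠ 0) (hy : Transcendental K y) :
    Transcendental K (a + algebraMap K Ω d * y) := by
  intro halg
  refine hy ?_
  have h : y = algebraMap K Ω d⁻¹ * (a + algebraMap K Ω d * y - a) := by
    rw [add_sub_cancel_left, ← mul_assoc, ← map_mul, inv_mul_cancel₀ hd, map_one, one_mul]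
  rw [h]
  exact (isAlgebraic_algebraMap _).mul (halg.sub ha)

namespace Ambient

variable {K : Type*} [Field K] {G : Type*} [AddCommGroup G] [LinearOrder G]
  [IsOrderedAddMonoid G] {v : AddValuation K (WithTop G)} {Γ : Type*} [AddCommGroup Γ]
  [LinearOrder Γ] [IsOrderedAddMonoid Γ] {ι : G →+ Γ} {k : Type*} [Field k]
  [Algebra (Residue v) k] {Ω : Type*} [Field Ω] [Algebra K Ω] {H : Type*} [AddCommGroup H]
  [LinearOrder H] [IsOrderedAddMonoid H] {S : Ambient v ι k Ω H}

theorem exists_full_approx (S : Ambient v ι k Ω H) (hv : Function.Surjective v)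
    (hnt : ¬ IsTrivialVal v) (htors : IsAddTorsion (Γ ⧸ ι.range))
    (halg : Algebra.IsAlgebraic (Residue v) k) [IsAlgClosed Ω] [Finite (Γ ⧸ ι.range)]
    [FiniteDimensional (Residue v) k] : ∃ a r, S.Approx a r ∧ S.Full K⟮a⟯ := by
  obtain ⟨π, hπ0, hπ⟩ := exists_pos_of_not_trivial hnt
  obtain ⟨γ, hγ⟩ := exists_seq_of_groupCountablyGenerated
    (groupCountablyGenerated_of_finite (Γ ⧸ ι.range))
  obtain ⟨ζ, hζ⟩ := exists_seq_of_fieldCountablyGenerated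
    (fieldCountablyGenerated_of_finite (Residue v) k)
  obtain ⟨a, r, h⟩ := S.exists_chain hv htors halg hπ0 hπ γ ζ
  obtain ⟨n, hn⟩ := h.exists_full hv (h.full_iSup hv hγ hζ)
  exact ⟨a n, r n, h.approx n, hn⟩

/-- An immediate extension `L` of `K` stays immediate after adjoining a good extension `E`. -/
theorem Good.exists_lt_sub {E : IntermediateField K Ω} (hE : S.Good E) {L : IntermediateField K Ω}
    (hL : ∀ l ∈ L, l ≠ 0 → ∃ c : K, S.W l < S.W (l - algebraMap K Ω c)) {a : Ω} (ha : a ∈ E)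
    {p : L[X]} (hp : aeval a p ≠ 0) : ∃ e ∈ E, S.W (aeval a p) < S.W (aeval a p - e) := by
  obtain ⟨κ, _, β, hβ, hspan, hle⟩ := hE.basis
  have hz : ∃ l : κ → Ω, (∀ i, l i ∈ L) ∧ aeval a p = ∑ i, l i * β i := by
    choose c hc using fun j : ℕ => hspan (a ^ j) (pow_mem ha j)
    refine ⟨fun i => ∑ j ∈ Finset.range (p.natDegree + 1),
      (p.coeff j : Ω) * algebraMap K Ω (c j i), fun i => ?_, ?_⟩
    · exact sum_mem fun j _ => mul_mem (p.coeff j).2 (L.algebraMap_mem _)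
    · simp only [Finset.sum_mul]
      rw [Finset.sum_comm, aeval_eq_sum_range]
      refine Finset.sum_congr rfl fun j _ => ?_
      rw [Algebra.smul_def, hc j, Finset.mul_sum]
      exact Finset.sum_congr rfl fun i _ => by rw [mul_assoc]; rfl
  obtain ⟨l, hl, hz⟩ := hz
  have happ : ∀ i, ∃ c : K, S.W (algebraMap K Ω c) = S.W (l i) ∧
      (l i ≠ 0 → S.W (l i) < S.W (l i - algebraMap K Ω c)) := by
    intro i
    by_cases h0 : l i = 0
    · exact ⟨0, by rw [map_zero, h0], fun h => absurd h0 h⟩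
    · obtain ⟨c, hc⟩ := hL _ (hl i) h0
      exact ⟨c, eq_of_lt_sub hc, fun _ => hc⟩
  choose c hc hc' using happ
  have hterm : ∀ i, S.W (algebraMap K Ω (c i) * β i) = S.W (l i * β i) := fun i => by
    rw [AddValuation.map_mul, AddValuation.map_mul, hc]
  obtain ⟨i₁, hi₁⟩ : ∃ i, l i * β i ≠ 0 := by
    by_contra! hall
    exact hp (by rw [hz]; exact Finset.sum_eq_zero fun i _ => hall i)
  have he : S.W (∑ i, algebraMap K Ω (c i) * β i) <
      S.W (∑ i, algebraMap K Ω (c i) * β i - aeval a p) := by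
    obtain ⟨i₀, -, hi₀⟩ := Finset.exists_min_image Finset.univ (fun i => S.W (l i * β i))
      ⟨i₁, Finset.mem_univ i₁⟩
    have htop : S.W (l i₀ * β i₀) ≠ ⊤ :=
      ne_top_of_le_ne_top ((AddValuation.ne_top_iff S.W).2 hi₁) (hi₀ i₁ (Finset.mem_univ _))
    refine lt_of_le_of_lt ((hle c i₀).trans (hterm i₀).le) ?_
    rw [AddValuation.map_sub_swap, hz, ← Finset.sum_sub_distrib]
    refine AddValuation.map_lt_sum _ htop fun i _ => ?_
    rw [← sub_mul]
    by_cases h0 : l i * β i = 0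
    · rcases mul_eq_zero.1 h0 with h1 | h1
      · have : algebraMap K Ω (c i) = 0 := by
          rw [← AddValuation.top_iff S.W, hc, h1, AddValuation.map_zero]
        rw [h1, this, sub_zero, zero_mul, AddValuation.map_zero]
        exact WithTop.lt_top_iff_ne_top.2 htop
      · rw [h1, mul_zero, AddValuation.map_zero]
        exact WithTop.lt_top_iff_ne_top.2 htop
    · refine lt_of_le_of_lt (hi₀ i (Finset.mem_univ _)) ?_
      rw [AddValuation.map_mul, AddValuation.map_mul]
      exact WithTop.add_lt_add_right ((AddValuation.ne_top_iff S.W).2 (right_ne_zero_of_mul h0))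
        (hc' i (left_ne_zero_of_mul h0))
  exact ⟨_, sum_mem fun i _ => mul_mem (E.algebraMap_mem _) (hβ i), lt_sub_symm he⟩

theorem Approx.hasExtension_of_immediate {a : Ω} {r : K} (h : S.Approx a r) (hN : S.Full K⟮a⟯)
    (hι : StrictMono ι) (hnt : ¬ IsTrivialVal v) {L : IntermediateField K Ω}
    (hL : ∀ l ∈ L, l ≠ 0 → ∃ c : K, S.W l < S.W (l - algebraMap K Ω c)) {y : Ω} (hyL : y ∈ L)
    (hy : Transcendental K y) : HasExtension v (RatFunc K) ι k := by
  obtain ⟨π, hπ0, hπ⟩ := exists_pos_of_not_trivial hnt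
  have hy0 : y ≠ 0 := by
    rintro rfl
    exact hy (isAlgebraic_zero)
  obtain ⟨c, hc⟩ := hL y hyL hy0
  have hc0 : c ≠ 0 := by
    rintro rfl
    rw [map_zero, sub_zero] at hc
    exact lt_irrefl _ hc
  set d : K := π * r / c with hd
  have hd0 : d ≠ 0 := div_ne_zero (mul_ne_zero hπ0 h.ne_zero) hc0
  have hWd : S.W (algebraMap K Ω d * y) = S.W (algebraMap K Ω (π * r)) := by
    rw [AddValuation.map_mul, ← eq_of_lt_sub hc, ← AddValuation.map_mul, ← map_mul, hd,
      div_mul_cancel₀ _ hc0]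
  have h1 : S.W (algebraMap K Ω r) < S.W (algebraMap K Ω d * y) := by
    rw [hWd]
    exact S.lt_mul_of_pos hπ h.ne_zero
  have h2 : 0 ≤ S.W (algebraMap K Ω d * y) := le_trans ((S.ext.nonneg_iff r).2 h.nonneg_r) h1.le
  have hint := h.good.isIntegral (mem_adjoin_simple_self K a)
  have hx : Transcendental K (a + algebraMap K Ω d * y) :=
    transcendental_add_mul hint.isAlgebraic hd0 hy
  refine hN.hasExtension hι hx ?_ ?_
  · intro f hf0
    have hfx : aeval (a + algebraMap K Ω d * y) f =
        aeval a ((f.map (algebraMap K L)).comp (X + C (⟨algebraMap K Ω d * y,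
          mul_mem (L.algebraMap_mem d) hyL⟩ : L))) := by
      rw [aeval_comp, aeval_map_algebraMap]
      simp
    rw [hfx]
    refine h.good.exists_lt_sub hL (mem_adjoin_simple_self K a) ?_
    rw [← hfx]
    exact fun h3 => hf0 ((transcendental_iff.1 hx) f h3)
  · intro e he he0
    obtain ⟨f, hf, rfl⟩ := exists_poly_of_mem_adjoin hint he
    refine ⟨f, h.bound.aeval_add h.nonneg h2 h1 hf ?_⟩
    rintro rfl
    exact he0 (map_zero _)

end Ambient

section Main

variable {K : Type uK} [Field K] {G : Type uG} [AddCommGroup G] [LinearOrder G]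
  [IsOrderedAddMonoid G] {v : AddValuation K (WithTop G)} {Γ : Type*} [AddCommGroup Γ]
  [LinearOrder Γ] [IsOrderedAddMonoid Γ] {ι : G →+ Γ} {k : Type*} [Field k]
  [Algebra (Residue v) k]

theorem hasExtension_of_infinite (hv : Function.Surjective v) (hι : StrictMono ι)
    (htors : IsAddTorsion (Γ ⧸ ι.range)) (halg : Algebra.IsAlgebraic (Residue v) k)
    (hnt : ¬ IsTrivialVal v) (hcγ : GroupCountablyGenerated (Γ ⧸ ι.range))
    (hck : FieldCountablyGenerated (Residue v) k)
    (hinf : Infinite (Γ ⧸ ι.range) ∨ ¬ FiniteDimensional (Residue v) k) :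
    HasExtension v (RatFunc K) ι k := by
  obtain ⟨π, hπ0, hπ⟩ := exists_pos_of_not_trivial hnt
  obtain ⟨H, _, _, _, S, hS⟩ := exists_ambient_self hv hι htors halg
  obtain ⟨γ, hγ⟩ := exists_seq_of_groupCountablyGenerated hcγ
  obtain ⟨ζ, hζ⟩ := exists_seq_of_fieldCountablyGenerated hck
  obtain ⟨a, r, h⟩ := S.exists_chain hv htors halg hπ0 hπ γ ζ
  have hN := h.full_iSup hv hγ hζ
  exact h.hasExtension hπ0 hπ hι hS hN (h.exists_degree_lt hN hinf)

theorem hasExtension_of_admitsImmediate (hv : Function.Surjective v) (hι : StrictMono ι)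
    (htors : IsAddTorsion (Γ ⧸ ι.range)) (halg : Algebra.IsAlgebraic (Residue v) k)
    (hnt : ¬ IsTrivialVal v) [Finite (Γ ⧸ ι.range)] [FiniteDimensional (Residue v) k]
    (himm : AdmitsImmediateTranscendental.{uK, uG, uM} v) : HasExtension v (RatFunc K) ι k := by
  obtain ⟨L, _, _, H₁, _, _, _, ι₁, u, hu, htr, hus, hι₁, hres⟩ := himm
  obtain ⟨H, _, _, _, S, i₁, hi₁, -⟩ := exists_ambient hι htors halg hus hu
  obtain ⟨a, r, h, hN⟩ := S.exists_full_approx hv hnt htors halg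
  obtain ⟨y, hy⟩ := htr
  refine h.hasExtension_of_immediate hN hι hnt
    (L := (IsScalarTower.toAlgHom K L (AlgebraicClosure L)).fieldRange) ?_ ⟨y, rfl⟩
    ((transcendental_algebraMap_iff (algebraMap L (AlgebraicClosure L)).injective).2 hy)
  rintro _ ⟨l, rfl⟩ hl0
  have hl : l ≠ 0 := by
    rintro rfl
    exact hl0 (map_zero _)
  have key : ∃ c : K, u l < u (l - algebraMap K L c) := by
    obtain ⟨g, hg⟩ := exists_coe_eq (v := u) hl
    obtain ⟨g', rfl⟩ := hι₁ g
    obtain ⟨c₀, hc₀⟩ := hv (g' : WithTop G)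
    have hc₀0 : algebraMap K L c₀ ≠ 0 := (_root_.map_ne_zero _).2 (ne_zero_of_coe hc₀)
    have h0 : u (l / algebraMap K L c₀) = 0 := by
      rw [AddValuation.map_div, hg, hu.restrict, hc₀, WithTop.map_coe]
      rw [← WithTop.LinearOrderedAddCommGroup.coe_sub, sub_self]
      rfl
    obtain ⟨z, hz⟩ := hres (IsLocalRing.residue _ (⟨_, h0.ge⟩ : valRing u))
    obtain ⟨c₁, rfl⟩ := IsLocalRing.residue_surjective z
    rw [hu.residueMap_residue, eq_comm, residue_eq_iff] at hz
    refine ⟨c₀ * c₁, ?_⟩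
    have e : l - algebraMap K L (c₀ * c₁) =
        algebraMap K L c₀ * (l / algebraMap K L c₀ - algebraMap K L c₁) := by
      rw [mul_sub, mul_div_cancel₀ _ hc₀0, map_mul]
    have e1 : u l = u (algebraMap K L c₀) := by rw [hg, hu.restrict, hc₀, WithTop.map_coe]
    rw [e, AddValuation.map_mul, e1]
    conv_lhs => rw [← add_zero (u _)]
    exact WithTop.add_lt_add_left ((AddValuation.ne_top_iff u).2 hc₀0) hz
  obtain ⟨c, hc⟩ := key
  refine ⟨c, ?_⟩
  change S.W (algebraMap L _ l) < S.W (algebraMap L _ l - _)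
  rw [IsScalarTower.algebraMap_apply K L, ← map_sub, hi₁.restrict, hi₁.restrict]
  exact strictMono_map hi₁.strictMono hc

end Main

end PrescribedValuation

namespace PrescribedValuation

open Polynomial

section Gauss

variable {F : Type*} [Field F] {Γ : Type*} [AddCommGroup Γ] [LinearOrder Γ]
  [IsOrderedAddMonoid Γ] (w : AddValuation F (WithTop Γ)) (γ : Γ)

/-- The value of the `i`-th term of a polynomial, when the variable has value `γ`. -/
def termVal (p : F[X]) (i : ℕ) : WithTop Γ := w (p.coeff i) + ((i • γ : Γ) : WithTop Γ)

/-- The minimal value of a term. -/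
noncomputable def gaussVal (p : F[X]) : WithTop Γ := p.support.inf (termVal w γ p)

theorem le_gaussVal_iff {p : F[X]} {c : WithTop Γ} :
    c ≤ gaussVal w γ p ↔ ∀ i, c ≤ termVal w γ p i := by
  rw [gaussVal, Finset.le_inf_iff]
  refine ⟨fun h i => ?_, fun h i _ => h i⟩
  by_cases hi : p.coeff i = 0
  · rw [termVal, hi, AddValuation.map_zero, top_add]
    exact le_top
  · exact h i (mem_support_iff.2 hi)

theorem gaussVal_le (p : F[X]) (i : ℕ) : gaussVal w γ p ≤ termVal w γ p i :=
  (le_gaussVal_iff w γ).1 le_rfl i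

theorem gaussVal_zero : gaussVal w γ 0 = ⊤ := by
  rw [gaussVal, support_zero, Finset.inf_empty]

theorem termVal_ne_top {p : F[X]} {i : ℕ} : termVal w γ p i ≠ ⊤ ↔ p.coeff i ≠ 0 := by
  rw [termVal, ← AddValuation.ne_top_iff w, WithTop.add_ne_top]
  exact and_iff_left WithTop.coe_ne_top

theorem exists_gaussVal_eq {p : F[X]} (hp : p ≠ 0) :
    ∃ i, gaussVal w γ p = termVal w γ p i ∧ p.coeff i ≠ 0 := by
  obtain ⟨i, hi, h⟩ := Finset.exists_mem_eq_inf p.support (support_nonempty.2 hp) (termVal w γ p)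
  exact ⟨i, h, mem_support_iff.1 hi⟩

theorem gaussVal_ne_top {p : F[X]} (hp : p ≠ 0) : gaussVal w γ p ≠ ⊤ := by
  obtain ⟨i, hi, hi0⟩ := exists_gaussVal_eq w γ hp
  rw [hi]
  exact (termVal_ne_top w γ).2 hi0

theorem le_map_sum_add {κ : Type*} {s : Finset κ} {x : κ → F} {c δ : WithTop Γ}
    (h : ∀ i ∈ s, c ≤ w (x i) + δ) : c ≤ w (∑ i ∈ s, x i) + δ := by
  refine Finset.sum_induction x (fun y => c ≤ w y + δ) (fun a b ha hb => ?_) ?_ h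
  · refine le_trans (le_min ha hb) ?_
    rw [min_add_add_right]
    exact add_le_add_left (AddValuation.map_add w a b) δ
  · rw [AddValuation.map_zero, top_add]
    exact le_top

theorem map_mul_add_nsmul (x y : F) (i j : ℕ) :
    w (x * y) + (((i + j) • γ : Γ) : WithTop Γ) =
      (w x + ((i • γ : Γ) : WithTop Γ)) + (w y + ((j • γ : Γ) : WithTop Γ)) := by
  rw [AddValuation.map_mul, add_nsmul, WithTop.coe_add]
  abel

theorem gaussVal_mul (p q : F[X]) : gaussVal w γ (p * q) = gaussVal w γ p + gaussVal w γ q := by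
  classical
  by_cases hp : p = 0
  · rw [hp, zero_mul, gaussVal_zero, top_add]
  by_cases hq : q = 0
  · rw [hq, mul_zero, gaussVal_zero, add_top]
  have hP := exists_gaussVal_eq w γ hp
  have hQ := exists_gaussVal_eq w γ hq
  obtain ⟨hi, hi0⟩ := Nat.find_spec hP
  obtain ⟨hj, hj0⟩ := Nat.find_spec hQ
  have hPmin : ∀ i, i < Nat.find hP → gaussVal w γ p < termVal w γ p i := fun i hlt =>
    lt_of_le_of_ne (gaussVal_le w γ p i) fun h => Nat.find_min hP hlt ⟨h, by
      rw [← termVal_ne_top w γ, ← h]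
      exact gaussVal_ne_top w γ hp⟩
  have hQmin : ∀ i, i < Nat.find hQ → gaussVal w γ q < termVal w γ q i := fun i hlt =>
    lt_of_le_of_ne (gaussVal_le w γ q i) fun h => Nat.find_min hQ hlt ⟨h, by
      rw [← termVal_ne_top w γ, ← h]
      exact gaussVal_ne_top w γ hq⟩
  generalize Nat.find hP = i₀ at hi hi0 hPmin
  generalize Nat.find hQ = j₀ at hj hj0 hQmin
  refine le_antisymm ?_ ?_
  · refine (gaussVal_le w γ (p * q) (i₀ + j₀)).trans (le_of_eq ?_)
    rw [hi, hj, termVal, termVal, termVal, ← map_mul_add_nsmul]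
    congr 1
    rw [coeff_mul, ← Finset.add_sum_erase _ _ (Finset.HasAntidiagonal.mem_antidiagonal.2 rfl :
      (i₀, j₀) ∈ Finset.HasAntidiagonal.antidiagonal (i₀ + j₀))]
    refine AddValuation.map_add_eq_of_lt_left w (AddValuation.map_lt_sum w
      ((AddValuation.ne_top_iff w).2 (mul_ne_zero hi0 hj0)) ?_)
    rintro ⟨i, j⟩ hij
    rw [Finset.mem_erase, Finset.HasAntidiagonal.mem_antidiagonal] at hij
    obtain ⟨hne, hsum⟩ := hij
    simp only at hsum ⊢
    have key : termVal w γ p i₀ + termVal w γ q j₀ < termVal w γ p i + termVal w γ q j := by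
      rw [← hi, ← hj]
      rcases lt_or_ge i i₀ with h | h
      · exact lt_of_lt_of_le (WithTop.add_lt_add_right (gaussVal_ne_top w γ hq) (hPmin i h))
          (add_le_add_right (gaussVal_le w γ q j) _)
      · have h' : j < j₀ := by
          by_contra hcon
          exact hne (Prod.ext (by simp only; omega) (by simp only; omega))
        exact lt_of_lt_of_le (WithTop.add_lt_add_left (gaussVal_ne_top w γ hp) (hQmin j h'))
          (add_le_add_left (gaussVal_le w γ p i) _)
    rw [termVal, termVal, termVal, termVal, ← map_mul_add_nsmul, ← map_mul_add_nsmul, hsum] at key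
    exact lt_of_add_lt_add_right key
  · rw [le_gaussVal_iff]
    intro n
    rw [termVal, coeff_mul]
    refine le_map_sum_add w fun x hx => ?_
    rw [← Finset.HasAntidiagonal.mem_antidiagonal.1 hx, map_mul_add_nsmul]
    exact add_le_add (gaussVal_le w γ p _) (gaussVal_le w γ q _)

/-- The Gauss valuation on polynomials, with variable of value `γ`. -/
noncomputable def gaussAddValuation : AddValuation F[X] (WithTop Γ) :=
  AddValuation.of (gaussVal w γ) (gaussVal_zero w γ)
    (by
      refine le_antisymm ?_ ?_
      · refine (gaussVal_le w γ 1 0).trans (le_of_eq ?_)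
        rw [termVal, coeff_one_zero, AddValuation.map_one, zero_nsmul, zero_add, WithTop.coe_zero]
      · rw [le_gaussVal_iff]
        intro i
        rw [termVal, coeff_one]
        split_ifs with h
        · rw [h, AddValuation.map_one, zero_nsmul, zero_add, WithTop.coe_zero]
        · rw [AddValuation.map_zero, top_add]
          exact le_top)
    (fun p q => by
      rw [le_gaussVal_iff]
      intro i
      rw [termVal, coeff_add]
      refine le_trans (min_le_min (gaussVal_le w γ p i) (gaussVal_le w γ q i)) ?_
      rw [termVal, termVal, min_add_add_right]
      exact add_le_add_left (AddValuation.map_add w _ _) _)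
    (gaussVal_mul w γ)

/-- An additive valuation of `F[X]` which is finite on nonzero elements extends to `F(X)`. -/
theorem exists_extension_ratFunc (g : AddValuation F[X] (WithTop Γ))
    (hg : ∀ p, p ≠ 0 → g p ≠ ⊤) : ∃ W : AddValuation (RatFunc F) (WithTop Γ),
      ∀ p, W (algebraMap F[X] (RatFunc F) p) = g p := by
  have h : nonZeroDivisors F[X] ≤ (AddValuation.toValuation g).supp.primeCompl := by
    intro p hp hp'
    exact hg p (nonZeroDivisors.ne_zero hp) ((AddValuation.mem_supp_iff g p).1 hp')
  refine ⟨AddValuation.ofValuation ((AddValuation.toValuation g).extendToLocalization h (RatFunc F)),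
    fun p => ?_⟩
  exact Valuation.extendToLocalization_apply_map_apply (AddValuation.toValuation g) h (RatFunc F) p

/-- The Gauss valuation on the rational function field. -/
theorem exists_gauss : ∃ W : AddValuation (RatFunc F) (WithTop Γ),
    (∀ e, W (algebraMap F (RatFunc F) e) = w e) ∧ W RatFunc.X = γ ∧
      ∀ (p : F[X]) i, W (algebraMap F[X] (RatFunc F) p) ≤
        w (p.coeff i) + ((i • γ : Γ) : WithTop Γ) := by
  obtain ⟨W, hW⟩ := exists_extension_ratFunc (gaussAddValuation w γ)
    fun p hp => gaussVal_ne_top w γ hp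
  replace hW : ∀ p, W (algebraMap F[X] (RatFunc F) p) = gaussVal w γ p := hW
  refine ⟨W, fun e => ?_, ?_, fun p i => ?_⟩
  · rw [RatFunc.algebraMap_eq_C, ← RatFunc.algebraMap_C, hW]
    refine le_antisymm ?_ ?_
    · refine (gaussVal_le w γ _ 0).trans (le_of_eq ?_)
      rw [termVal, coeff_C_zero, zero_nsmul, WithTop.coe_zero, add_zero]
    · rw [le_gaussVal_iff]
      intro i
      rw [termVal, coeff_C]
      split_ifs with h
      · rw [h, zero_nsmul, WithTop.coe_zero, add_zero]
      · rw [AddValuation.map_zero, top_add]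
        exact le_top
  · rw [← RatFunc.algebraMap_X, hW]
    refine le_antisymm ?_ ?_
    · refine (gaussVal_le w γ _ 1).trans (le_of_eq ?_)
      rw [termVal, coeff_X_one, AddValuation.map_one, one_nsmul, zero_add]
    · rw [le_gaussVal_iff]
      intro i
      rw [termVal, coeff_X]
      split_ifs with h
      · rw [← h, one_nsmul, AddValuation.map_one, zero_add]
      · rw [AddValuation.map_zero, top_add]
        exact le_top
  · rw [hW]
    exact gaussVal_le w γ p i

end Gauss

end PrescribedValuation

namespace PrescribedValuation

open Polynomial IntermediateField

theorem lt_sub_pow {K : Type*} [Field K] {G : Type*} [AddCommGroup G] [LinearOrder G]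
    [IsOrderedAddMonoid G] {v : AddValuation K (WithTop G)} {a a' : K} (h : v a < v (a - a'))
    (n : ℕ) : v (a ^ n) < v (a ^ n - a' ^ n) := by
  induction n with
  | zero =>
    rw [pow_zero, pow_zero]
    exact lt_sub_self one_ne_zero
  | succ n ih =>
    rw [pow_succ, pow_succ]
    exact lt_sub_mul ih h

section

variable {K : Type*} [Field K] {G : Type*} [AddCommGroup G] [LinearOrder G]
  [IsOrderedAddMonoid G] {v : AddValuation K (WithTop G)} {Γ : Type*} [AddCommGroup Γ]
  [LinearOrder Γ] [IsOrderedAddMonoid Γ] {ι : G →+ Γ} {k : Type*} [Field k]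
  [Algebra (Residue v) k]

/-- A finite separable simple extension of `K` with value group `Γ` and residue field `k`, together
with a generator whose powers satisfy a coefficient bound. -/
structure SimpleExt (v : AddValuation K (WithTop G)) (ι : G →+ Γ) (k : Type*) [Field k]
    [Algebra (Residue v) k] (E : Type*) [Field E] [Algebra K E] where
  w : AddValuation E (WithTop Γ)
  ext : Extends ι v w
  surjective : Function.Surjective w
  φ : k ≃+* Residue w
  φ_algebraMap : ∀ z, φ (algebraMap (Residue v) k z) = ext.residueMap z
  α : E
  r : K
  isIntegral : IsIntegral K α
  separable : (minpoly K α).Separable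
  exists_poly : ∀ e : E, ∃ f : K[X], f.degree < (minpoly K α).degree ∧ aeval α f = e
  nonneg : 0 ≤ w α
  ne_zero : r ≠ 0
  bound : CoeffBound w α r
  exists_le : ∀ e : E, e ≠ 0 → ∃ c : K, c ≠ 0 ∧ w e ≤ w (algebraMap K E c)

theorem exists_simpleExt {K : Type uK} [Field K] {v : AddValuation K (WithTop G)}
    [Algebra (Residue v) k] (hv : Function.Surjective v) (hnt : ¬ IsTrivialVal v)
    (hι : StrictMono ι) (htors : IsAddTorsion (Γ ⧸ ι.range))
    (halg : Algebra.IsAlgebraic (Residue v) k) [Finite (Γ ⧸ ι.range)]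
    [FiniteDimensional (Residue v) k] :
    ∃ (E : Type uK) (_ : Field E) (_ : Algebra K E), Nonempty (SimpleExt v ι k E) := by
  obtain ⟨H, _, _, _, S, -⟩ := exists_ambient_self (k := k) hv hι htors halg
  obtain ⟨a, r, h, hN⟩ := S.exists_full_approx hv hnt htors halg
  obtain ⟨w, hw, hs, ⟨φ, hφ⟩, hJ⟩ := exists_extension_of_approx hι S.ext K⟮a⟯.val S.strictMono_J
    S.J_ι S.jk S.jk_algebraMap K⟮a⟯ hN.val
    (fun g => S.mem_valSub.1 (hN.valSub_eq ▸ AddSubgroup.mem_top g)) hN.res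
    (fun z => S.mem_resSub.1 (hN.resSub_eq ▸ IntermediateField.mem_top))
    (fun u hu => ⟨u, u.2, lt_sub_self (fun h0 => hu (Subtype.ext h0))⟩)
    (fun e he he0 => ⟨⟨e, he⟩, lt_sub_self he0⟩)
  have hgen : K⟮a⟯.val (AdjoinSimple.gen K a) = a := rfl
  have hmin : minpoly K (AdjoinSimple.gen K a) = minpoly K a := by
    rw [← hgen, minpoly.algHom_eq _ K⟮a⟯.val.toRingHom.injective, hgen]
  have hint := h.good.isIntegral (mem_adjoin_simple_self K a)
  have := h.good.separable
  refine ⟨K⟮a⟯, inferInstance, inferInstance, ⟨⟨w, hw, hs, φ, hφ, AdjoinSimple.gen K a, r, ?_,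
    Algebra.IsSeparable.isSeparable K _, ?_, ?_, h.ne_zero, ?_, ?_⟩⟩⟩
  · exact (IntermediateField.isIntegral_iff).2 hint
  · intro e
    obtain ⟨f, hf, hfe⟩ := exists_poly_of_mem_adjoin hint e.2
    refine ⟨f, hmin ▸ hf, Subtype.ext ?_⟩
    rw [← hfe]
    exact (aeval_algHom_apply K⟮a⟯.val (AdjoinSimple.gen K a) f).symm
  · rw [← map_nonneg_iff S.strictMono_J, hJ]
    exact h.nonneg
  · exact (CoeffBound.of_strictMono S.strictMono_J K⟮a⟯.val hJ).2 h.bound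
  · intro e he
    obtain ⟨g, hg⟩ := exists_coe_eq (v := w) he
    obtain ⟨c, hc0, hc⟩ := S.exists_le_val hv htors g
    refine ⟨c, hc0, ?_⟩
    rw [← (strictMono_map S.strictMono_J).le_iff_le, hJ, hJ]
    refine le_trans (le_of_eq ?_) hc
    rw [← hJ, hg]
    rfl

theorem algebraMap_eq_sum {E : Type*} [Field E] (q : E[X]) : algebraMap E[X] (RatFunc E) q =
    ∑ i ∈ Finset.range (q.natDegree + 1), algebraMap E (RatFunc E) (q.coeff i) * RatFunc.X ^ i := by
  conv_lhs => rw [q.as_sum_range_C_mul_X_pow]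
  rw [map_sum]
  refine Finset.sum_congr rfl fun i _ => ?_
  rw [map_mul, map_pow, RatFunc.algebraMap_X, RatFunc.algebraMap_C, RatFunc.algebraMap_eq_C]

/-- For `d` of sufficiently large value, the field `K(α + d X)` is dense in `E(X)` for every Gauss
valuation, in the sense of asymptotic equality. -/
theorem SimpleExt.exists_dense {E : Type*} [Field E] [Algebra K E] (T : SimpleExt v ι k E) :
    ∃ ρ : K, ρ ≠ 0 ∧ 0 ≤ v ρ ∧ ∀ {Γ' : Type uL} [AddCommGroup Γ'] [LinearOrder Γ']
      [IsOrderedAddMonoid Γ'] (j : Γ →+ Γ') (W : AddValuation (RatFunc E) (WithTop Γ')),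
      Extends j T.w W →
      (∀ (p : E[X]) i, W (algebraMap E[X] (RatFunc E) p) ≤
        W (algebraMap E (RatFunc E) (p.coeff i) * RatFunc.X ^ i)) →
      ∀ d : K, d ≠ 0 → W (algebraMap K (RatFunc E) ρ) <
        W (algebraMap K (RatFunc E) d * RatFunc.X) →
      ∃ τ : RatFunc K →ₐ[K] RatFunc E, ∀ y, y ≠ 0 → ∃ u, W y < W (y - τ u) := by
  obtain ⟨b, hb0, hbp⟩ := IsLocalization.integerNormalization_spec
    (nonZeroDivisors (valRing v)) (minpoly K T.α)
  generalize IsLocalization.integerNormalization (nonZeroDivisors (valRing v)) (minpoly K T.α) =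
    P₀ at hbp
  replace hb0 : (b : K) ≠ 0 := fun h => nonZeroDivisors.ne_zero hb0 (Subtype.ext h)
  set P : K[X] := P₀.map (algebraMap (valRing v) K) with hP
  replace hbp : P = C (b : K) * minpoly K T.α := by
    rw [hbp, ← smul_eq_C_mul]
    rfl
  have hPα : aeval T.α P = 0 := by rw [hbp, map_mul, minpoly.aeval, mul_zero]
  have hPder : aeval T.α (derivative P) ≠ 0 := by
    rw [hbp, derivative_C_mul, map_mul, aeval_C]
    exact mul_ne_zero ((_root_.map_ne_zero _).2 hb0)
      (T.separable.aeval_derivative_ne_zero (minpoly.aeval K T.α))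
  have hP0 : derivative P ≠ 0 := fun h => hPder (by rw [h, map_zero])
  have hPdeg : (derivative P).degree < (minpoly K T.α).degree := by
    refine lt_of_lt_of_eq (degree_derivative_lt ?_) ?_
    · intro h
      rw [h, derivative_zero] at hP0
      exact hP0 rfl
    · rw [hbp, degree_C_mul hb0]
  obtain ⟨c, hc0, hc⟩ := T.exists_le _ hPder
  obtain ⟨ρ, hρ0, hρ1, hρ⟩ := exists_max_val v ![T.r, c] (by
    rw [Fin.forall_fin_two]
    exact ⟨T.ne_zero, hc0⟩)
  rw [Fin.forall_fin_two] at hρ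
  obtain ⟨hρr, hρc⟩ := hρ
  simp only [Matrix.cons_val_zero, Matrix.cons_val_one] at hρr hρc
  refine ⟨ρ, hρ0, hρ1, ?_⟩
  intro Γ' _ _ _ j W hW hWle d hd0 hd
  have hKW : Extends (j.comp ι) v W := ⟨hW.strictMono.comp T.ext.strictMono, fun a => by
    rw [IsScalarTower.algebraMap_apply K E, hW.restrict, T.ext.restrict, WithTop.map_map]
    rfl⟩
  have hle : ∀ s t : K, v s ≤ v t →
      W (algebraMap K (RatFunc E) s) ≤ W (algebraMap K (RatFunc E) t) := fun s t hst => by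
    rw [hKW.restrict, hKW.restrict]
    exact (strictMono_map hKW.strictMono).monotone hst
  set h : RatFunc E := algebraMap K (RatFunc E) d * RatFunc.X with hh
  have hpos : 0 ≤ W h := le_trans ((hKW.nonneg_iff ρ).2 hρ1) hd.le
  have hh0 : h ≠ 0 := mul_ne_zero ((_root_.map_ne_zero _).2 hd0) RatFunc.X_ne_zero
  set x : RatFunc E := algebraMap E (RatFunc E) T.α + h with hx
  have hαpos : 0 ≤ W (algebraMap E (RatFunc E) T.α) := (hW.nonneg_iff _).2 T.nonneg
  have hA : ∀ f : K[X], f.degree < (minpoly K T.α).degree → f ≠ 0 →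
      W (algebraMap E (RatFunc E) (aeval T.α f)) <
        W (algebraMap E (RatFunc E) (aeval T.α f) - aeval x f) := by
    intro f hf hf0
    have hb : CoeffBound W (IsScalarTower.toAlgHom K E (RatFunc E) T.α) T.r :=
      (CoeffBound.of_strictMono hW.strictMono (IsScalarTower.toAlgHom K E (RatFunc E))
        fun x => (hW.restrict x).symm).1 T.bound
    have h3 := hb.aeval_add hαpos hpos (lt_of_le_of_lt (hle _ _ hρr) hd)
      (by rwa [minpoly.algHom_eq _ (IsScalarTower.toAlgHom K E (RatFunc E)).toRingHom.injective])
      hf0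
    rwa [aeval_algHom_apply] at h3
  have hxt : Transcendental K x := by
    refine transcendental_add_mul ?_ hd0 ?_
    · exact T.isIntegral.isAlgebraic.algebraMap
    · have h1 : Transcendental E (RatFunc.X : RatFunc E) := by
        rw [← RatFunc.algebraMap_X]
        exact (transcendental_algebraMap_iff (RatFunc.algebraMap_injective E)).2
          (transcendental_X E)
      exact h1.restrictScalars (algebraMap K E).injective
  have heval : ∀ (Q : (valRing v)[X]) (y : valRing W), (((Q.map hKW.ringMap).eval y : valRing W) : RatFunc E) =
      aeval (y : RatFunc E) (Q.map (algebraMap (valRing v) K)) := by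
    intro Q y
    rw [eval_map, aeval_def, eval₂_map]
    exact hom_eval₂ Q hKW.ringMap (valRing W).subtype y
  set δ : RatFunc E := algebraMap E (RatFunc E) (aeval T.α (derivative P)) with hδ
  have hδ0 : δ ≠ 0 := (_root_.map_ne_zero _).2 hPder
  have hB : W (δ * h) < W (δ * h - aeval x P) := by
    obtain ⟨q, hq⟩ := binomExpansion (P₀.map hKW.ringMap) ⟨_, hαpos⟩ ⟨h, hpos⟩
    have hq' := congrArg (Subtype.val) hq
    push_cast at hq'
    rw [derivative_map, heval, heval, heval, ← derivative_map, ← hP] at hq'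
    change aeval x P = aeval (algebraMap E (RatFunc E) T.α) P +
      aeval (algebraMap E (RatFunc E) T.α) (derivative P) * h + q * h ^ 2 at hq'
    rw [aeval_algebraMap_apply, aeval_algebraMap_apply, hPα, map_zero, zero_add] at hq'
    rw [hq', sub_add_cancel_left, AddValuation.map_neg, AddValuation.map_mul W δ h,
      AddValuation.map_mul W (q : RatFunc E), pow_two, AddValuation.map_mul W h h]
    refine lt_of_lt_of_le ?_ (le_add_of_nonneg_left q.2)
    refine WithTop.add_lt_add_right ((AddValuation.ne_top_iff W).2 hh0) ?_
    refine lt_of_le_of_lt ?_ hd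
    refine le_trans ?_ (hle _ _ hρc)
    rw [hδ, IsScalarTower.algebraMap_apply K E (RatFunc E), hW.restrict, hW.restrict]
    exact (strictMono_map hW.strictMono).monotone hc
  have hX : ∃ s, W RatFunc.X < W (RatFunc.X - ratEval hxt s) := by
    refine ⟨algebraMap K[X] _ P / algebraMap K[X] _ (derivative P) / algebraMap K _ d, ?_⟩
    have h1 := lt_sub_div (lt_sub_div hB (hA _ hPdeg hP0))
      (lt_sub_self (v := W) ((_root_.map_ne_zero (algebraMap K (RatFunc E))).2 hd0))
    rw [mul_div_cancel_left₀ _ hδ0, hh, mul_div_cancel_left₀ _ ((_root_.map_ne_zero _).2 hd0)] at h1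
    rw [map_div₀, ratEval_div, AlgHom.commutes]
    exact h1
  obtain ⟨s, hs⟩ := hX
  have hE : ∀ e : E, ∃ u, e ≠ 0 → W (algebraMap E (RatFunc E) e) <
      W (algebraMap E (RatFunc E) e - ratEval hxt u) := by
    intro e
    obtain ⟨f, hf, rfl⟩ := T.exists_poly e
    refine ⟨algebraMap K[X] _ f, fun he => ?_⟩
    rw [ratEval_algebraMap]
    refine hA f hf ?_
    rintro rfl
    exact he (map_zero _)
  choose U hU using hE
  have hpoly : ∀ q : E[X], q ≠ 0 → ∃ u, W (algebraMap E[X] (RatFunc E) q) <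
      W (algebraMap E[X] (RatFunc E) q - ratEval hxt u) := by
    classical
    intro q hq
    have hq0 : W (algebraMap E[X] (RatFunc E) q) ≠ ⊤ :=
      (AddValuation.ne_top_iff W).2 (RatFunc.algebraMap_ne_zero hq)
    refine ⟨∑ i ∈ Finset.range (q.natDegree + 1),
      if q.coeff i = 0 then 0 else U (q.coeff i) * s ^ i, ?_⟩
    conv_rhs => rw [algebraMap_eq_sum]
    rw [map_sum, ← Finset.sum_sub_distrib]
    refine AddValuation.map_lt_sum W hq0 fun i _ => ?_
    split_ifs with hi
    · rw [hi, map_zero, map_zero, zero_mul, sub_zero, AddValuation.map_zero]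
      exact WithTop.lt_top_iff_ne_top.2 hq0
    · refine lt_of_le_of_lt (hWle q i) ?_
      rw [map_mul (ratEval hxt), map_pow (ratEval hxt)]
      exact lt_sub_mul (hU _ hi) (lt_sub_pow hs i)
  refine ⟨ratEval hxt, fun y hy => ?_⟩
  obtain ⟨u₁, h₁⟩ := hpoly y.num (RatFunc.num_ne_zero hy)
  obtain ⟨u₂, h₂⟩ := hpoly y.denom y.denom_ne_zero
  refine ⟨u₁ / u₂, ?_⟩
  have h3 := lt_sub_div h₁ h₂
  rwa [RatFunc.num_div_denom, ← map_div₀] at h3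

end

end PrescribedValuation

namespace PrescribedValuation

open Polynomial

section

variable {K : Type*} [Field K] {G : Type*} [AddCommGroup G] [LinearOrder G]
  [IsOrderedAddMonoid G] {v : AddValuation K (WithTop G)}

theorem Extends.residueMap_trans {E M : Type*} [Field E] [Field M] [Algebra K E] [Algebra K M]
    [Algebra E M] [IsScalarTower K E M] {Γ H : Type*} [AddCommGroup Γ] [LinearOrder Γ]
    [IsOrderedAddMonoid Γ] [AddCommGroup H] [LinearOrder H] [IsOrderedAddMonoid H]
    {ι : G →+ Γ} {j : Γ →+ H} {i : G →+ H} {w : AddValuation E (WithTop Γ)}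
    {W : AddValuation M (WithTop H)} (h : Extends ι v w) (h' : Extends j w W) (h'' : Extends i v W)
    (z : Residue v) : h'.residueMap (h.residueMap z) = h''.residueMap z := by
  obtain ⟨a, rfl⟩ := IsLocalRing.residue_surjective z
  rw [Extends.residueMap_residue, Extends.residueMap_residue, Extends.residueMap_residue]
  refine congrArg _ (Subtype.ext ?_)
  exact (IsScalarTower.algebraMap_apply K E M (a : K)).symm

/-- A valued field which is dense in `(M, W)`, in the sense of asymptotic equality, inherits the
value group and the residue field of `W`. -/
theorem hasExtension_of_dense {L M : Type*} [Field L] [Field M] [Algebra K L] [Algebra K M]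
    {H : Type*} [AddCommGroup H] [LinearOrder H] [IsOrderedAddMonoid H] {i : G →+ H}
    {W : AddValuation M (WithTop H)} (hW : Extends i v W) (hs : Function.Surjective W)
    {k : Type*} [Field k] [Algebra (Residue v) k] (jk : k →+* Residue W)
    (hjs : Function.Surjective jk) (hjk : ∀ z, jk (algebraMap (Residue v) k z) = hW.residueMap z)
    (τ : L →ₐ[K] M) (hτ : ∀ y, y ≠ 0 → ∃ u, W y < W (y - τ u)) : HasExtension v L i k := by
  obtain ⟨w, h, hs, hφ, -⟩ := exists_extension_of_approx hW.strictMono hW τ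
    (J := AddMonoidHom.id H) strictMono_id (fun _ => rfl) jk hjk Set.univ
    (fun e _ he => exists_coe_eq he) (fun g => (hs g).imp fun e he => ⟨trivial, he⟩)
    (fun y _ => hjs _)
    (fun z => (IsLocalRing.residue_surjective (jk z)).imp fun y hy => ⟨trivial, hy⟩)
    (fun u hu => ⟨τ u, trivial, lt_sub_self ((_root_.map_ne_zero τ).2 hu)⟩)
    (fun e _ he => hτ e he)
  exact ⟨w, h, hs, hφ⟩

variable {Γ : Type*} [AddCommGroup Γ] [LinearOrder Γ] [IsOrderedAddMonoid Γ] {ι : G →+ Γ}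
  {k : Type*} [Field k] [Algebra (Residue v) k] {E : Type*} [Field E] [Algebra K E]

theorem SimpleExt.exists_gauss (T : SimpleExt v ι k E) (hnt : ¬ IsTrivialVal v) {Γ' : Type uL}
    [AddCommGroup Γ'] [LinearOrder Γ'] [IsOrderedAddMonoid Γ'] {j : Γ →+ Γ'} (hj : StrictMono j)
    {γ : Γ'} (hγ : 0 ≤ γ) : ∃ W : AddValuation (RatFunc E) (WithTop Γ'),
      Extends j T.w W ∧ Extends (j.comp ι) v W ∧ W RatFunc.X = γ ∧
      (∀ (p : E[X]) i, W (algebraMap E[X] (RatFunc E) p) ≤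
        W (algebraMap E (RatFunc E) (p.coeff i) * RatFunc.X ^ i)) ∧
      ∃ τ : RatFunc K →ₐ[K] RatFunc E, ∀ y, y ≠ 0 → ∃ u, W y < W (y - τ u) := by
  let jt : WithTop Γ →+ WithTop Γ' := ⟨⟨WithTop.map j, map_withTop_zero j⟩, map_withTop_add j⟩
  obtain ⟨W, hWE, hWX, hWle⟩ := PrescribedValuation.exists_gauss
    (T.w.map jt rfl (strictMono_map hj).monotone) γ
  have hE : Extends j T.w W := ⟨hj, hWE⟩
  have hK : Extends (j.comp ι) v W := ⟨hj.comp T.ext.strictMono, fun a => by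
    rw [IsScalarTower.algebraMap_apply K E, hE.restrict, T.ext.restrict, WithTop.map_map]
    rfl⟩
  have hle : ∀ (p : E[X]) i, W (algebraMap E[X] (RatFunc E) p) ≤
      W (algebraMap E (RatFunc E) (p.coeff i) * RatFunc.X ^ i) := fun p i => by
    rw [AddValuation.map_mul, AddValuation.map_pow, hWE, hWX]
    exact hWle p i
  refine ⟨W, hE, hK, hWX, hle, ?_⟩
  obtain ⟨ρ, hρ0, -, hρ⟩ := T.exists_dense
  obtain ⟨π, hπ0, hπ⟩ := exists_pos_of_not_trivial hnt
  refine hρ j W hE hle (π * ρ) (mul_ne_zero hπ0 hρ0) ?_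
  rw [AddValuation.map_mul W, hWX, hK.restrict, hK.restrict]
  refine lt_of_lt_of_le ?_ (le_add_of_nonneg_right (WithTop.coe_nonneg.2 hγ))
  refine strictMono_map hK.strictMono ?_
  rw [AddValuation.map_mul]
  refine (zero_add (v ρ)).symm.trans_lt ?_
  exact WithTop.add_lt_add_right ((AddValuation.ne_top_iff v).2 hρ0) hπ

/-- A polynomial whose monomials have pairwise distinct values is dominated by one of them. -/
theorem exists_lt_sub_monomial {Γ' : Type*} [AddCommGroup Γ'] [LinearOrder Γ']
    [IsOrderedAddMonoid Γ'] {W : AddValuation (RatFunc E) (WithTop Γ')}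
    (hle : ∀ (p : E[X]) i, W (algebraMap E[X] (RatFunc E) p) ≤
      W (algebraMap E (RatFunc E) (p.coeff i) * RatFunc.X ^ i))
    (hinj : ∀ (c c' : E) (i i' : ℕ), c ≠ 0 → W (algebraMap E (RatFunc E) c * RatFunc.X ^ i) =
      W (algebraMap E (RatFunc E) c' * RatFunc.X ^ i') → i = i') {p : E[X]} (hp : p ≠ 0) :
    ∃ (c : E) (i : ℕ), c ≠ 0 ∧ W (algebraMap E[X] (RatFunc E) p) <
      W (algebraMap E[X] (RatFunc E) p - algebraMap E (RatFunc E) c * RatFunc.X ^ i) := by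
  classical
  have hp0 : algebraMap E[X] (RatFunc E) p ≠ 0 := RatFunc.algebraMap_ne_zero hp
  have hpt := (AddValuation.ne_top_iff W).2 hp0
  have hsum := algebraMap_eq_sum p
  obtain ⟨i, hi, hieq⟩ : ∃ i ∈ Finset.range (p.natDegree + 1), W (algebraMap E[X] (RatFunc E) p) =
      W (algebraMap E (RatFunc E) (p.coeff i) * RatFunc.X ^ i) := by
    by_contra! hne
    refine lt_irrefl (W (algebraMap E[X] (RatFunc E) p)) ?_
    conv_rhs => rw [hsum]
    exact AddValuation.map_lt_sum W hpt fun i hi => lt_of_le_of_ne (hle p i) (hne i hi)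
  have hc : p.coeff i ≠ 0 := by
    intro h
    rw [h, map_zero, zero_mul, AddValuation.map_zero] at hieq
    exact hpt hieq
  refine ⟨p.coeff i, i, hc, ?_⟩
  have h2 : algebraMap E[X] (RatFunc E) p - algebraMap E (RatFunc E) (p.coeff i) * RatFunc.X ^ i =
      ∑ j ∈ (Finset.range (p.natDegree + 1)).erase i,
        algebraMap E (RatFunc E) (p.coeff j) * RatFunc.X ^ j := by
    rw [sub_eq_iff_eq_add, Finset.sum_erase_add _ _ hi, ← hsum]
  rw [h2]
  refine AddValuation.map_lt_sum W hpt fun j hj => lt_of_le_of_ne (hle p j) fun h => ?_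
  exact (Finset.ne_of_mem_erase hj) (hinj _ _ _ _ hc (hieq.symm.trans h)).symm

/-- Existence of extensions with value group `Γ ⊕ ℤ`, for `v` nontrivial. -/
theorem SimpleExt.hasExtension_prod (T : SimpleExt v ι k E) (hnt : ¬ IsTrivialVal v)
    {Γ' : Type uL} [AddCommGroup Γ'] [LinearOrder Γ'] [IsOrderedAddMonoid Γ'] (e : Γ × ℤ ≃+ Γ')
    (he : StrictMono fun g : Γ => e (g, 0)) (h1 : 0 ≤ e (0, 1)) :
    HasExtension v (RatFunc K) ((e.toAddMonoidHom.comp (AddMonoidHom.inl Γ ℤ)).comp ι) k := by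
  obtain ⟨W, hE, hK, hX, hle, τ, hτ⟩ := T.exists_gauss hnt
    (j := e.toAddMonoidHom.comp (AddMonoidHom.inl Γ ℤ)) he h1
  have hmon : ∀ (c : E) (g : Γ) (i : ℕ), T.w c = g →
      W (algebraMap E (RatFunc E) c * RatFunc.X ^ i) = (e (g, (i : ℤ)) : Γ') := by
    intro c g i hg
    rw [AddValuation.map_mul, AddValuation.map_pow, hE.restrict, hX, hg]
    change ((e (g, 0) + i • e (0, 1) : Γ') : WithTop Γ') = _
    rw [← map_nsmul, ← map_add]
    simp
  have hinj : ∀ (c c' : E) (i i' : ℕ), c ≠ 0 →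
      W (algebraMap E (RatFunc E) c * RatFunc.X ^ i) =
      W (algebraMap E (RatFunc E) c' * RatFunc.X ^ i') → i = i' := by
    intro c c' i i' hc h
    obtain ⟨g, hg⟩ := exists_coe_eq (v := T.w) hc
    rw [hmon c g i hg] at h
    have hc' : c' ≠ 0 := by
      rintro rfl
      rw [map_zero, zero_mul, AddValuation.map_zero] at h
      exact WithTop.coe_ne_top h
    obtain ⟨g', hg'⟩ := exists_coe_eq (v := T.w) hc'
    rw [hmon c' g' i' hg', WithTop.coe_inj] at h
    have := congrArg Prod.snd (e.injective h)
    simpa using this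
  refine hasExtension_of_dense hK (fun t => ?_) (hE.residueMap.comp T.φ.toRingHom) (fun z => ?_)
    (fun z => ?_) τ hτ
  · cases t with
    | top => exact ⟨0, AddValuation.map_zero W⟩
    | coe g =>
      obtain ⟨⟨g, m⟩, rfl⟩ := e.surjective g
      obtain ⟨n, rfl | rfl⟩ := m.eq_nat_or_neg
      · obtain ⟨c, hc⟩ := T.surjective g
        exact ⟨_, hmon c g n hc⟩
      · obtain ⟨c, hc⟩ := T.surjective ((-g : Γ) : WithTop Γ)
        refine ⟨(algebraMap E (RatFunc E) c * RatFunc.X ^ n)⁻¹, ?_⟩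
        rw [AddValuation.map_inv, hmon c (-g) n hc]
        change ((-e (-g, (n : ℤ)) : Γ') : WithTop Γ') = _
        rw [← map_neg]
        simp
  · obtain ⟨y, rfl⟩ := IsLocalRing.residue_surjective z
    by_cases hy : W (y : RatFunc E) = 0
    · have hy0 : (y : RatFunc E) ≠ 0 := by
        rw [← AddValuation.ne_top_iff W, hy]
        exact WithTop.zero_ne_top
      obtain ⟨c, i, hc, hci⟩ := exists_lt_sub_monomial hle hinj (RatFunc.num_ne_zero hy0)
      obtain ⟨c', i', hc', hci'⟩ := exists_lt_sub_monomial hle hinj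
        (y : RatFunc E).denom_ne_zero
      have h3 := lt_sub_div hci hci'
      rw [RatFunc.num_div_denom] at h3
      have h4 := eq_of_lt_sub h3
      rw [hy] at h3 h4
      have hi : i = i' := by
        refine hinj c c' i i' hc ?_
        have h5 : algebraMap E (RatFunc E) c' * RatFunc.X ^ i' ≠ 0 := mul_ne_zero
          ((_root_.map_ne_zero _).2 hc') (pow_ne_zero _ RatFunc.X_ne_zero)
        rw [← div_mul_cancel₀ (algebraMap E (RatFunc E) c * RatFunc.X ^ i) h5,
          AddValuation.map_mul W, h4, zero_add]
      subst hi
      rw [mul_div_mul_right _ _ (pow_ne_zero _ RatFunc.X_ne_zero), ← map_div₀] at h3 h4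
      have h6 : c / c' ∈ valRing T.w := (hE.nonneg_iff _).1 h4.ge
      refine ⟨T.φ.symm (IsLocalRing.residue _ ⟨c / c', h6⟩), ?_⟩
      change hE.residueMap (T.φ (T.φ.symm _)) = _
      rw [RingEquiv.apply_symm_apply, Extends.residueMap_residue, eq_comm, residue_eq_iff]
      exact h3
    · refine ⟨0, ?_⟩
      rw [map_zero, eq_comm, residue_eq_zero_iff]
      exact lt_of_le_of_ne y.2 (Ne.symm hy)
  · change hE.residueMap (T.φ _) = _
    rw [T.φ_algebraMap, Extends.residueMap_trans T.ext hE hK]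

/-- Existence of extensions whose residue field is a rational function field, for `v`
nontrivial. -/
theorem SimpleExt.hasExtension_ratFunc (T : SimpleExt v ι k E) (hnt : ¬ IsTrivialVal v) :
    HasExtension v (RatFunc K) ι (RatFunc k) := by
  obtain ⟨W, hE, hK, hX, hle, τ, hτ⟩ := T.exists_gauss hnt
    (j := AddMonoidHom.id Γ) strictMono_id le_rfl
  have hWE : ∀ c, W (algebraMap E (RatFunc E) c) = T.w c := fun c => by
    rw [hE.restrict]
    exact congrFun WithTop.map_id _
  replace hle : ∀ (p : E[X]) i, W (algebraMap E[X] (RatFunc E) p) ≤ T.w (p.coeff i) :=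
    fun p i => by
      refine (hle p i).trans (le_of_eq ?_)
      rw [AddValuation.map_mul, AddValuation.map_pow, hX, hWE, WithTop.coe_zero, nsmul_zero,
        add_zero]
  let Y : valRing W := ⟨RatFunc.X, (mem_valRing W _).2 hX.ge⟩
  let θ : valRing T.w →+* k := T.φ.symm.toRingHom.comp (IsLocalRing.residue _)
  have hθ : Function.Surjective θ := T.φ.symm.surjective.comp IsLocalRing.residue_surjective
  let ψ : k →+* Residue W := hE.residueMap.comp T.φ.toRingHom
  have hψθ : ψ.comp θ = (IsLocalRing.residue _).comp hE.ringMap := by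
    ext a
    change hE.residueMap (T.φ (T.φ.symm _)) = _
    rw [RingEquiv.apply_symm_apply]
    rfl
  let _ := ψ.toAlgebra
  have hY : ∀ Q : (valRing T.w)[X], ((Q.eval₂ hE.ringMap Y : valRing W) : RatFunc E) =
      algebraMap E[X] (RatFunc E) (Q.map (valRing T.w).subtype) := by
    intro Q
    have h1 := hom_eval₂ Q hE.ringMap (valRing W).subtype Y
    refine h1.trans ?_
    have h2 : algebraMap E[X] (RatFunc E) (Q.map (valRing T.w).subtype) =
        eval₂ (algebraMap E (RatFunc E)) RatFunc.X (Q.map (valRing T.w).subtype) := by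
      rw [← aeval_def, ← RatFunc.algebraMap_X, aeval_algebraMap_apply, aeval_X_left_apply]
    rw [h2, eval₂_map]
    rfl
  have hres : ∀ Q : (valRing T.w)[X], IsLocalRing.residue _ (Q.eval₂ hE.ringMap Y) =
      aeval (IsLocalRing.residue _ Y) (Q.map θ) := by
    intro Q
    rw [hom_eval₂, ← hψθ, aeval_def, eval₂_map]
    rfl
  have hY0 : Transcendental k (IsLocalRing.residue _ Y) := by
    rw [transcendental_iff]
    intro q hq
    obtain ⟨Q, rfl⟩ := Polynomial.map_surjective θ hθ q
    rw [← hres, residue_eq_zero_iff, hY] at hq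
    ext i
    rw [coeff_map, coeff_zero]
    change T.φ.symm _ = 0
    rw [EmbeddingLike.map_eq_zero_iff, residue_eq_zero_iff]
    refine lt_of_lt_of_le hq ((hle _ i).trans (le_of_eq ?_))
    rw [coeff_map]
    rfl
  have hnorm : ∀ p : E[X], p ≠ 0 → ∃ (c : E) (Q : (valRing T.w)[X]), c ≠ 0 ∧
      IsLocalRing.residue _ (Q.eval₂ hE.ringMap Y) ≠ 0 ∧
      algebraMap E[X] (RatFunc E) p =
        algebraMap E (RatFunc E) c * (Q.eval₂ hE.ringMap Y : valRing W) := by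
    intro p hp
    obtain ⟨g, hg⟩ := exists_coe_eq (v := W) (RatFunc.algebraMap_ne_zero hp)
    obtain ⟨c, hc⟩ := T.surjective g
    have hc0 := ne_zero_of_coe hc
    have hCp : algebraMap E[X] (RatFunc E) p =
        algebraMap E (RatFunc E) c * algebraMap E[X] (RatFunc E) (C c⁻¹ * p) := by
      rw [map_mul, RatFunc.algebraMap_C, ← RatFunc.algebraMap_eq_C, ← mul_assoc, ← map_mul,
        mul_inv_cancel₀ hc0, map_one, one_mul]
    have hW0 : W (algebraMap E[X] (RatFunc E) (C c⁻¹ * p)) = 0 := by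
      have h1 := hg
      rw [hCp, AddValuation.map_mul W, hWE, hc] at h1
      exact (WithTop.add_left_inj WithTop.coe_ne_top).1 (h1.trans (add_zero _).symm)
    obtain ⟨Q, hQ⟩ : ∃ Q : (valRing T.w)[X], Q.map (valRing T.w).subtype = C c⁻¹ * p := by
      have : C c⁻¹ * p ∈ Polynomial.lifts (valRing T.w).subtype := by
        rw [Polynomial.lifts_iff_coeff_lifts]
        exact fun i => ⟨⟨_, hW0.ge.trans (hle _ i)⟩, rfl⟩
      exact (Polynomial.mem_lifts _).1 this
    refine ⟨c, Q, hc0, ?_, ?_⟩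
    · rw [Ne, residue_eq_zero_iff, hY, hQ, hW0]
      exact lt_irrefl _
    · rw [hY, hQ]
      exact hCp
  have hmem : ∀ Q : (valRing T.w)[X], IsLocalRing.residue _ (Q.eval₂ hE.ringMap Y) ∈
      (ratEval hY0).fieldRange := fun Q => ⟨algebraMap k[X] _ (Q.map θ), by
    rw [hres]
    exact ratEval_algebraMap hY0 _⟩
  refine hasExtension_of_dense (i := ι) hK (fun t => ?_) (ratEval hY0 : RatFunc k →+* Residue W)
    (fun z => ?_) (fun z => ?_) τ hτ
  · obtain ⟨c, rfl⟩ := T.surjective t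
    exact ⟨_, hWE c⟩
  · change z ∈ (ratEval hY0).fieldRange
    obtain ⟨y, rfl⟩ := IsLocalRing.residue_surjective z
    by_cases hy0 : (y : RatFunc E) = 0
    · have : y = 0 := Subtype.ext hy0
      rw [this, map_zero]
      exact zero_mem _
    obtain ⟨c, P, hc, hP, hpP⟩ := hnorm _ (RatFunc.num_ne_zero hy0)
    obtain ⟨d, Q, hd, hQ, hpQ⟩ := hnorm _ (y : RatFunc E).denom_ne_zero
    have hPw : W ((P.eval₂ hE.ringMap Y : valRing W) : RatFunc E) = 0 :=
      le_antisymm (not_lt.1 fun h => hP ((residue_eq_zero_iff W _).2 h)) (P.eval₂ hE.ringMap Y).2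
    have hQw : W ((Q.eval₂ hE.ringMap Y : valRing W) : RatFunc E) = 0 :=
      le_antisymm (not_lt.1 fun h => hQ ((residue_eq_zero_iff W _).2 h)) (Q.eval₂ hE.ringMap Y).2
    have hyQ : (y : RatFunc E) * (Q.eval₂ hE.ringMap Y : valRing W) =
        algebraMap E (RatFunc E) (c / d) * (P.eval₂ hE.ringMap Y : valRing W) := by
      have h1 : (y : RatFunc E) * algebraMap E[X] (RatFunc E) (y : RatFunc E).denom =
          algebraMap E[X] (RatFunc E) (y : RatFunc E).num := by
        rw [← eq_div_iff (RatFunc.algebraMap_ne_zero (y : RatFunc E).denom_ne_zero),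
          RatFunc.num_div_denom]
      rw [hpP, hpQ] at h1
      rw [map_div₀, div_mul_eq_mul_div, eq_div_iff ((_root_.map_ne_zero _).2 hd), ← h1]
      ring
    have hcd : c / d ∈ valRing T.w := by
      rw [mem_valRing, ← hWE]
      have h2 := congrArg W hyQ
      rw [AddValuation.map_mul W, AddValuation.map_mul W, hPw, hQw, add_zero, add_zero] at h2
      rw [← h2]
      exact y.2
    have h3 : y * Q.eval₂ hE.ringMap Y = hE.ringMap ⟨c / d, hcd⟩ * P.eval₂ hE.ringMap Y :=
      Subtype.ext hyQ
    have h4 := congrArg (IsLocalRing.residue _) h3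
    rw [map_mul, map_mul, ← eq_div_iff hQ] at h4
    rw [h4]
    refine div_mem (mul_mem ?_ (hmem P)) (hmem Q)
    rw [← Extends.residueMap_residue]
    refine ⟨algebraMap k _ (θ ⟨c / d, hcd⟩), ?_⟩
    refine ((ratEval hY0).commutes _).trans ?_
    exact congrArg (fun f => f (⟨c / d, hcd⟩ : valRing T.w)) hψθ
  · rw [IsScalarTower.algebraMap_apply (Residue v) k (RatFunc k)]
    refine ((ratEval hY0).commutes _).trans ?_
    change hE.residueMap (T.φ _) = _
    rw [T.φ_algebraMap, Extends.residueMap_trans T.ext hE hK]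

end

end PrescribedValuation

namespace PrescribedValuation

open Polynomial

/-- The valuation of the rational function field attached to an irreducible polynomial `p`, with
`p` of value `γ`. -/
theorem exists_primeVal {F : Type*} [Field F] {Γ : Type*} [AddCommGroup Γ] [LinearOrder Γ]
    [IsOrderedAddMonoid Γ] {γ : Γ} (hγ : 0 ≤ γ) {p : F[X]} (hp : Prime p) :
    ∃ W : AddValuation (RatFunc F) (WithTop Γ), W (algebraMap F[X] (RatFunc F) p) = γ ∧
      (∀ q, 0 ≤ W (algebraMap F[X] (RatFunc F) q)) ∧
      ∀ q, ¬ p ∣ q → W (algebraMap F[X] (RatFunc F) q) = 0 := by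
  let f : ℕ∞ →+ WithTop Γ := (multiplesHom Γ γ).withTopMap
  have hf : Monotone f := Monotone.withTop_map fun a b hab => nsmul_le_nsmul_left hγ hab
  have hfin : ∀ q : F[X], q ≠ 0 → FiniteMultiplicity p q :=
    fun q hq => FiniteMultiplicity.of_prime_left hp hq
  have hfn : ∀ n : ℕ, f (n : ℕ∞) = ((n • γ : Γ) : WithTop Γ) := fun n => rfl
  obtain ⟨W, hW⟩ := exists_extension_ratFunc ((multiplicity_addValuation hp).map f rfl hf)
    (fun q hq => by
      change f (emultiplicity p q) ≠ ⊤
      rw [(hfin q hq).emultiplicity_eq_multiplicity, hfn]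
      exact WithTop.coe_ne_top)
  replace hW : ∀ q, W (algebraMap F[X] (RatFunc F) q) = f (emultiplicity p q) := hW
  refine ⟨W, ?_, fun q => ?_, fun q hq => ?_⟩
  · rw [hW, (hfin p hp.ne_zero).emultiplicity_self]
    exact (hfn 1).trans (by rw [one_nsmul])
  · rw [hW, ← f.map_zero]
    exact hf zero_le
  · rw [hW, emultiplicity_eq_zero.2 hq, f.map_zero]

section

variable {K : Type*} [Field K] {G : Type*} [AddCommGroup G] [LinearOrder G]
  [IsOrderedAddMonoid G] {v : AddValuation K (WithTop G)} {k : Type*} [Field k]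
  [Algebra (Residue v) k]

theorem IsTrivialVal.eq_zero (ht : IsTrivialVal v) (hv : Function.Surjective v) (g : G) :
    g = 0 := by
  obtain ⟨a, ha⟩ := hv g
  rw [ht a (ne_zero_of_coe ha)] at ha
  exact (WithTop.coe_inj.1 ha).symm

/-- A simple algebraic extension of the residue field of a trivially valued field is a quotient of
the polynomial ring. -/
theorem IsTrivialVal.exists_surjective (ht : IsTrivialVal v)
    (halg : Algebra.IsAlgebraic (Residue v) k) {α : k}
    (hα : IntermediateField.adjoin (Residue v) {α} = ⊤) :
    ∃ θ : K[X] →+* k, Function.Surjective θ ∧ RingHom.ker θ ≠ ⊥ ∧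
      ∀ a : valRing v, θ (C (a : K)) = algebraMap (Residue v) k (IsLocalRing.residue _ a) := by
  have hmem : ∀ a, a ∈ valRing v := fun a => by
    rw [mem_valRing]
    by_cases ha : a = 0
    · rw [ha, AddValuation.map_zero]
      exact le_top
    · exact (ht a ha).ge
  let σ : K →+* Residue v := (IsLocalRing.residue _).comp ((RingHom.id K).codRestrict _ hmem)
  have hσ : Function.Surjective σ := by
    intro z
    obtain ⟨a, rfl⟩ := IsLocalRing.residue_surjective z
    exact ⟨a, rfl⟩
  have hθ : ∀ Q : K[X], (eval₂RingHom ((algebraMap (Residue v) k).comp σ) α) Q =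
      aeval α (Q.map σ) := fun Q => by
    rw [aeval_def, eval₂_map]
    rfl
  refine ⟨eval₂RingHom ((algebraMap (Residue v) k).comp σ) α, fun y => ?_, fun h => ?_,
    fun a => ?_⟩
  · have hy : y ∈ IntermediateField.adjoin (Residue v) {α} := hα ▸ IntermediateField.mem_top
    obtain ⟨f, -, rfl⟩ := exists_poly_of_mem_adjoin (halg.isAlgebraic α).isIntegral hy
    obtain ⟨Q, rfl⟩ := Polynomial.map_surjective σ hσ f
    exact ⟨Q, hθ Q⟩
  · obtain ⟨f, hf0, hf⟩ := halg.isAlgebraic α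
    obtain ⟨Q, rfl⟩ := Polynomial.map_surjective σ hσ f
    have hQ : Q ∈ RingHom.ker (eval₂RingHom ((algebraMap (Residue v) k).comp σ) α) :=
      (hθ Q).trans hf
    rw [h, Ideal.mem_bot] at hQ
    exact hf0 (by rw [hQ, Polynomial.map_zero])
  · rw [coe_eval₂RingHom, eval₂_C]
    rfl

theorem IsTrivialVal.hasExtension {Γ : Type*} [AddCommGroup Γ] [LinearOrder Γ]
    [IsOrderedAddMonoid Γ] (ht : IsTrivialVal v)
    (halg : Algebra.IsAlgebraic (Residue v) k) {α : k}
    (hα : IntermediateField.adjoin (Residue v) {α} = ⊤) {i : G →+ Γ} (hi : StrictMono i) {γ : Γ}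
    (hγ : 0 < γ) (hgen : ∀ g : Γ, ∃ m : ℤ, m • γ = g) : HasExtension v (RatFunc K) i k := by
  obtain ⟨θ, hθ, hker, hθC⟩ := ht.exists_surjective halg hα
  set p := Submodule.IsPrincipal.generator (RingHom.ker θ)
  have hdvd : ∀ q, p ∣ q ↔ θ q = 0 := fun q =>
    (Submodule.IsPrincipal.mem_iff_generator_dvd (RingHom.ker θ)).symm
  have := RingHom.ker_isPrime θ
  have hp : Prime p := Submodule.IsPrincipal.prime_generator_of_isPrime _ hker
  obtain ⟨W, hWp, hW0, hW⟩ := exists_primeVal hγ.le hp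
  have hWpos : ∀ q, p ∣ q → 0 < W (algebraMap K[X] (RatFunc K) q) := by
    rintro _ ⟨q, rfl⟩
    rw [map_mul (algebraMap K[X] (RatFunc K)), AddValuation.map_mul, hWp]
    exact add_pos_of_pos_of_nonneg (WithTop.coe_pos.2 hγ) (hW0 q)
  have hK : Extends i v W := ⟨hi, fun a => by
    by_cases ha : a = 0
    · rw [ha, map_zero, AddValuation.map_zero, AddValuation.map_zero]
      rfl
    · rw [ht a ha, map_withTop_zero, RatFunc.algebraMap_eq_C, ← RatFunc.algebraMap_C]
      exact hW _ fun h => hp.not_isUnit (isUnit_of_dvd_unit h (isUnit_C.2 (isUnit_iff_ne_zero.2 ha)))⟩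
  let Φ : K[X] →+* Residue W := (IsLocalRing.residue _).comp
    ((algebraMap K[X] (RatFunc K)).codRestrict (valRing W) hW0)
  have hΦ : ∀ q, Φ q = IsLocalRing.residue _ ⟨algebraMap K[X] (RatFunc K) q, hW0 q⟩ :=
    fun q => rfl
  have hle : RingHom.ker θ ≤ RingHom.ker Φ := fun q hq => by
    rw [RingHom.mem_ker, hΦ, residue_eq_zero_iff]
    exact hWpos q ((hdvd q).2 hq)
  let jk : k →+* Residue W := θ.liftOfSurjective hθ ⟨Φ, hle⟩
  have hjk : ∀ q, jk (θ q) = Φ q := fun q => RingHom.liftOfRightInverse_comp_apply θ _ _ ⟨Φ, hle⟩ q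
  refine hasExtension_of_dense hK (fun t => ?_) jk (fun z => ?_) (fun z => ?_)
    (AlgHom.id K (RatFunc K)) fun y hy => ⟨y, lt_sub_self hy⟩
  · cases t with
    | top => exact ⟨0, AddValuation.map_zero W⟩
    | coe g =>
      obtain ⟨m, rfl⟩ := hgen g
      obtain ⟨n, rfl | rfl⟩ := m.eq_nat_or_neg
      · refine ⟨algebraMap K[X] (RatFunc K) p ^ n, ?_⟩
        rw [AddValuation.map_pow, hWp, natCast_zsmul]
        rfl
      · refine ⟨(algebraMap K[X] (RatFunc K) p ^ n)⁻¹, ?_⟩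
        rw [AddValuation.map_inv, AddValuation.map_pow, hWp, neg_zsmul, natCast_zsmul]
        rfl
  · change z ∈ jk.fieldRange
    obtain ⟨y, rfl⟩ := IsLocalRing.residue_surjective z
    have hmem : ∀ q, Φ q ∈ jk.fieldRange := fun q => ⟨θ q, hjk q⟩
    have h1 : (y : RatFunc K) * algebraMap K[X] (RatFunc K) (y : RatFunc K).denom =
        algebraMap K[X] (RatFunc K) (y : RatFunc K).num := by
      rw [← eq_div_iff (RatFunc.algebraMap_ne_zero (y : RatFunc K).denom_ne_zero),
        RatFunc.num_div_denom]
    have hden : ¬ p ∣ (y : RatFunc K).denom := by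
      intro h
      have hnum : ¬ p ∣ (y : RatFunc K).num := fun h' =>
        hp.not_isUnit ((RatFunc.isCoprime_num_denom (y : RatFunc K)).isUnit_of_dvd' h' h)
      have h2 := congrArg W h1
      rw [AddValuation.map_mul, hW _ hnum] at h2
      exact ((hWpos _ h).trans_le (le_add_of_nonneg_left y.2)).ne' h2
    have hden' : Φ (y : RatFunc K).denom ≠ 0 := by
      rw [Ne, hΦ, residue_eq_zero_iff, hW _ hden]
      exact lt_irrefl _
    have h3 : IsLocalRing.residue _ y * Φ (y : RatFunc K).denom = Φ (y : RatFunc K).num := by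
      rw [hΦ, hΦ, ← map_mul]
      exact congrArg _ (Subtype.ext h1)
    rw [← eq_div_iff hden'] at h3
    rw [h3]
    exact div_mem (hmem _) (hmem _)
  · obtain ⟨a, rfl⟩ := IsLocalRing.residue_surjective z
    rw [← hθC, hjk, hΦ, Extends.residueMap_residue]
    refine congrArg _ (Subtype.ext ?_)
    rw [Extends.coe_ringMap, RatFunc.algebraMap_eq_C, ← RatFunc.algebraMap_C]

end

section

variable {K : Type uK} [Field K] {G : Type uG} [AddCommGroup G] [LinearOrder G]
  [IsOrderedAddMonoid G] {v : AddValuation K (WithTop G)} {Γ₀ : Type uH} [AddCommGroup Γ₀]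
  [LinearOrder Γ₀] [IsOrderedAddMonoid Γ₀] {ι : G →+ Γ₀} {k₀ : Type uk} [Field k₀]
  [Algebra (Residue v) k₀]

theorem hasExtension_prod_of_nonneg (hv : Function.Surjective v) (hι : StrictMono ι)
    (htors : IsAddTorsion (Γ₀ ⧸ ι.range)) (halg : Algebra.IsAlgebraic (Residue v) k₀)
    [Finite (Γ₀ ⧸ ι.range)] [FiniteDimensional (Residue v) k₀]
    (hsimple : IsTrivialVal v → ∃ α : k₀, IntermediateField.adjoin (Residue v) {α} = ⊤)
    {Γ : Type uL} [AddCommGroup Γ] [LinearOrder Γ] [IsOrderedAddMonoid Γ] (e : Γ₀ × ℤ ≃+ Γ)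
    (he : StrictMono fun g : Γ₀ => e (g, 0)) (h1 : 0 ≤ e (0, 1)) :
    HasExtension v (RatFunc K) ((e.toAddMonoidHom.comp (AddMonoidHom.inl Γ₀ ℤ)).comp ι) k₀ := by
  by_cases ht : IsTrivialVal v
  · obtain ⟨α, hα⟩ := hsimple ht
    refine ht.hasExtension halg hα (i := (e.toAddMonoidHom.comp (AddMonoidHom.inl Γ₀ ℤ)).comp ι)
      (he.comp hι) (γ := e (0, 1)) (lt_of_le_of_ne h1 fun h => ?_) fun g => ?_
    · have h2 := e.injective ((map_zero e).trans h)
      exact zero_ne_one (congrArg Prod.snd h2)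
    · obtain ⟨⟨g, m⟩, rfl⟩ := e.surjective g
      obtain ⟨n, hn, g', hg'⟩ := exists_nsmul_mem_range htors g
      have hg : g = 0 := by
        rw [ht.eq_zero hv g', map_zero] at hg'
        exact (nsmul_eq_zero_iff_right hn.ne').1 hg'.symm
      refine ⟨m, ?_⟩
      rw [← map_zsmul, hg]
      simp
  · obtain ⟨E, _, _, ⟨T⟩⟩ := exists_simpleExt hv ht hι htors halg
    exact T.hasExtension_prod ht e he h1

theorem hasExtension_prod (hv : Function.Surjective v) (hι : StrictMono ι)
    (htors : IsAddTorsion (Γ₀ ⧸ ι.range)) (halg : Algebra.IsAlgebraic (Residue v) k₀)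
    [Finite (Γ₀ ⧸ ι.range)] [FiniteDimensional (Residue v) k₀]
    (hsimple : IsTrivialVal v → ∃ α : k₀, IntermediateField.adjoin (Residue v) {α} = ⊤)
    {Γ : Type uL} [AddCommGroup Γ] [LinearOrder Γ] [IsOrderedAddMonoid Γ] (e : Γ₀ × ℤ ≃+ Γ)
    (he : StrictMono fun g : Γ₀ => e (g, 0)) :
    HasExtension v (RatFunc K) ((e.toAddMonoidHom.comp (AddMonoidHom.inl Γ₀ ℤ)).comp ι) k₀ := by
  rcases le_total 0 (e (0, 1)) with h1 | h1
  · exact hasExtension_prod_of_nonneg hv hι htors halg hsimple e he h1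
  · let e' : Γ₀ × ℤ ≃+ Γ := ((AddEquiv.refl Γ₀).prodCongr (AddEquiv.neg ℤ)).trans e
    have he' : ∀ g m, e' (g, m) = e (g, -m) := fun _ _ => rfl
    have h : e'.toAddMonoidHom.comp (AddMonoidHom.inl Γ₀ ℤ) =
        e.toAddMonoidHom.comp (AddMonoidHom.inl Γ₀ ℤ) := by
      ext g
      exact (he' g 0).trans (by rw [neg_zero]; rfl)
    rw [← h]
    refine hasExtension_prod_of_nonneg hv hι htors halg hsimple e' ?_ ?_
    · simpa only [he', neg_zero] using he
    · have h2 : ((0 : Γ₀), (-1 : ℤ)) = -(0, 1) := by simp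
      rw [he', h2, map_neg]
      exact neg_nonneg.2 h1

end

end PrescribedValuation

theorem theorem1p4
    {K : Type uK} [Field K]
    -- the value group `vK` of the valuation `v`
    {G : Type uG} [AddCommGroup G] [LinearOrder G] [IsOrderedAddMonoid G]
    (v : AddValuation K (WithTop G)) (hv : Function.Surjective v)
    -- an ordered abelian group extension of `vK` with torsion quotient
    {Γ₀ : Type uH} [AddCommGroup Γ₀] [LinearOrder Γ₀] [IsOrderedAddMonoid Γ₀]
    (ι : G →+ Γ₀) (hι : StrictMono ι) (htors : IsAddTorsion (Γ₀ ⧸ ι.range))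
    -- an algebraic extension of `Kv`
    {k₀ : Type uk} [Field k₀] [Algebra (Residue v) k₀] (halg : Algebra.IsAlgebraic (Residue v) k₀) :
    -- both extensions are finite
    (Finite (Γ₀ ⧸ ι.range) → FiniteDimensional (Residue v) k₀ →
      ((IsTrivialVal v → ∃ α : k₀, IntermediateField.adjoin (Residue v) {α} = ⊤) →
        ∀ (Γ : Type uL) [AddCommGroup Γ] [LinearOrder Γ] [IsOrderedAddMonoid Γ]
          -- `Γ` is `Γ₀ ⊕ ℤ` with an ordering that extends the one of `Γ₀`
          (e : Γ₀ × ℤ ≃+ Γ), StrictMono (fun g : Γ₀ => e (g, 0)) →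
          HasExtension v (RatFunc K)
            ((e.toAddMonoidHom.comp (AddMonoidHom.inl Γ₀ ℤ)).comp ι) k₀) ∧
      (¬ IsTrivialVal v → HasExtension v (RatFunc K) ι (RatFunc k₀))) ∧
    -- both extensions are countably generated
    (¬ IsTrivialVal v → GroupCountablyGenerated (Γ₀ ⧸ ι.range) →
      FieldCountablyGenerated (Residue v) k₀ →
      (Infinite (Γ₀ ⧸ ι.range) ∨ ¬ FiniteDimensional (Residue v) k₀ ∨
        AdmitsImmediateTranscendental.{uK, uG, uM} v) →
      HasExtension v (RatFunc K) ι k₀) := by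
  refine ⟨fun hfin hfd => ⟨fun hsimple Γ _ _ _ e he => ?_, fun hnt => ?_⟩,
    fun hnt hcγ hck hor => ?_⟩
  · exact hasExtension_prod hv hι htors halg hsimple e he
  · obtain ⟨E, _, _, ⟨T⟩⟩ := exists_simpleExt hv hnt hι htors halg
    exact T.hasExtension_ratFunc hnt
  · by_cases hinf : Infinite (Γ₀ ⧸ ι.range) ∨ ¬ FiniteDimensional (Residue v) k₀
    · exact hasExtension_of_infinite hv hι htors halg hnt hcγ hck hinf
    · rw [not_or, not_infinite_iff_finite, not_not] at hinf
      obtain ⟨hfin, hfd⟩ := hinf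
      refine hasExtension_of_admitsImmediate hv hι htors halg hnt ?_
      rcases hor with h | h | h
      · exact absurd hfin (not_finite_iff_infinite.2 h)
      · exact absurd hfd h
      · exact h
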